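/- **Setting.** $\|\cdot\|$ is the Euclidean norm of vectors and the induced $2$-norm of matrices; $\|z\|_{\mathcal L_\infty^{J}}=\sup_{t\in J}\|z(t)\|$ for an interval $J$, and $\|z\|_{\mathcal L_\infty}$ is the case $J=[0,\infty)$. Let $m\ge 1$. Let $\Theta,\Theta_d\subset\mathbb R^s$ be boxes with $\|v\|\le b_{\dot\theta}$ for $v\in\Theta_d$. A trajectory $\theta:[0,\infty)\to\Theta$ is *admissible* if it is differentiable with $\dot\theta(t)\in\Theta_d$. Matrices below depend continuously on $\theta\in\Theta$; $M^\dagger$ is the pseudo-inverse; for a matrix function $M$ put $b_M=\max_{\theta\in\Theta}\|M(\theta)\|$. Differential equations are understood in the Carathéodory sense. *Plant:* $\dot x=A(\theta)x+B(\theta)\omega u_{\rm total}+f(t,x)$, $y=C(\theta)x$, $x(0)=x_0$, $\|x_0\|\le\rho_0$ ($\rho_0>0$), with $x\in\mathbb R^n$, $u_{\rm total}\in\mathbb R^m$, $y\in\mathbb R^p$, and $u_{\rm total}=K_x(\theta)x+u$. Put $A_m=A+BK_x$. The reference signal $r:[0,\infty)\to\mathbb R^p$ is measurable and bounded, and $K_r(\theta)\in\mathbb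 R^{m\times p}$. *Assumptions.* (i) There are a $C^1$ symmetric $P(\theta)>0$ and $\mu_P>0$ with $A_m^\top P+PA_m+\dot P\le-\mu_PP$ on $\Theta\times\Theta_d$, where $\dot P=\sum_i\dot\theta_i\,\partial P/\partial\theta_i$. (ii) $\omega$ is strictly row-diagonally dominant and $\omega\in\Omega$, where $\Omega\subset\mathbb R^{m\times m}$ is a convex polytope containing $\mathbb I_m$. (iii) $B(\theta)$ has full column rank, and $B,B^\dagger,K_x$ are Lipschitz on $\Theta$ with positive constants $L_B,L_{B^\dagger},L_{K_x}$. $B_u(\theta)\in\mathbb R^{n\times(n-m)}$ is such that $[B,B_u]$ has rank $n$ and $B^\top B_u=0$. (iv) For $t,t_1,t_2\ge0$: $\|f(t,0)\|\le b_f^0$; for every $\delta>0$, $\|f(t,x_1)-f(t,x_2)\|\le L_f^\delta\|x_1-x_2\|$ if $\|x_1\|,\|x_2\|\le\delta$; and $\|f(t_1,x)-f(t_2,x)\|\le l_f|t_1-t_2|$ for all $x$ (with $L_f^\delta,l_f>0$). Define $\bar f(t,x)=f(t,x)+B(\theta)(\omega-\mathbb I_m)K_x(\theta)x$ and $f_1,f_2$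 by $B(\theta)f_1+B_u(\theta)f_2=\bar f$. *Adaptive controller.* Let $a>0$, let $T>0$ be the sampling time, and let $K\in\mathbb R^{m\times m}$ be such that $-wK$ is Hurwitz for every $w\in\Omega$. Predictor: $\dot{\hat x}=A_mx+Bu+\hat\sigma-a(\hat x-x)$, $\hat x(0)=\hat x_0$ arbitrary. Adaptive law: $\hat\sigma(t)=-\frac{a}{e^{aT}-1}(\hat x-x)(iT)$ for $t\in[iT,(i+1)T)$, $i=0,1,\dots$; $\hat\sigma_c=0$ on $[0,T)$ and $\hat\sigma_c=\hat\sigma$ on $[T,\infty)$; $B(\theta)\hat\sigma_m+B_u(\theta)\hat\sigma_{um}=\hat\sigma_c$. Control law: $\dot u=-K(u+\hat\sigma_m+\bar{\mathcal H}(\theta)\hat\sigma_{um}-K_r(\theta)r)$, $u(0)=0$, where $\bar{\mathcal H}(\theta)$ is a given LPV state-space system with zero initial state, $n-m$ inputs and $m$ outputs. *Reference system.* $\dot x_r=A_mx_r+B(\omega u_r+f_1(t,x_r))+B_uf_2(t,x_r)$, $x_r(0)=x_0$, $y_r=C(\theta)x_r$, $u_r=-\omega^{-1}\mathcal C\big(f_1(\cdot,x_r)+\bar{\mathcal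 H}(\theta)f_2(\cdot,x_r)-K_r(\theta)r\big)$, where $\mathcal C$ is the mapping with transfer function $\omega K(s\mathbb I_m+\omega K)^{-1}$. *Mappings (zero initial states).* $\mathcal H_{xm},\mathcal H_{xum}$ are the input-to-state mappings of $\dot x=A_mx+Bv$ and $\dot x=A_mx+B_uv$; $\mathcal G_{xm}=\mathcal H_{xm}(\mathbb I_m-\mathcal C)$, $\mathcal G_{xum}=\mathcal H_{xum}-\mathcal H_{xm}\mathcal C\bar{\mathcal H}$, $\mathcal F=\mathcal C(B^\dagger+\bar{\mathcal H}B_u^\dagger)$. For a mapping $\mathcal G$, $\|\mathcal G\|_{\bar{\mathcal L}_1}$ denotes an arbitrary fixed $\gamma>0$ such that input $v$ and output $z$ satisfy $\|z\|_{\mathcal L_\infty^{[0,\tau]}}\le\gamma\|v\|_{\mathcal L_\infty^{[0,\tau]}}$ for all $\tau\ge0$ and all admissible $\theta$; such bounds are assumed given for $\mathcal G_{xm},\mathcal G_{xum},\mathcal H_{xm}\mathcal CK_r,\mathcal H_{xm},\bar{\mathcal H},\omega^{-1}\mathcal C\bar{\mathcal H}$. $\|\omega^{-1}\mathcal C\|_{\mathcal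 L_1}$ is the exact peak-to-peak gain. (v) $\mathcal F$ has a state-space realization $(A_{\mathcal F},B_{\mathcal F},C_{\mathcal F},0)$ for which there are a $C^1$ symmetric $P_{\mathcal F}(\theta)>0$ and $\mu_{\mathcal F}>0$ with $A_{\mathcal F}^\top P_{\mathcal F}+P_{\mathcal F}A_{\mathcal F}+\dot P_{\mathcal F}\le-\mu_{\mathcal F}P_{\mathcal F}$ on $\Theta\times\Theta_d$. *Constants.* Let $\bar\lambda(\cdot),\underline\lambda(\cdot)$ be the largest and smallest eigenvalue over $\theta\in\Theta$, and $c_\Omega=\max_{w\in\Omega}\|w-\mathbb I_m\|$. Put $\rho_{\rm in}=\rho_0\sqrt{\bar\lambda(P)/\underline\lambda(P)}$, $b_{f_1}^0=b_{B^\dagger}b_f^0$, $b_{f_2}^0=b_{B_u^\dagger}b_f^0$, $L_{f_1}^\delta=L_f^\delta b_{B^\dagger}+\max_{w\in\Omega,\theta\in\Theta}\|(w-\mathbb I_m)K_x(\theta)\|$, $L_{f_2}^\delta=L_f^\delta b_{B_u^\dagger}$, $L_{\bar f}^\delta=L_f^\delta+\max_{w\in\Omega,\theta\in\Theta}\|B(\theta)(w-\mathbb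 I_m)K_x(\theta)\|$, $l_{\bar f}^\delta=l_f+c_\Omega(L_Bb_{K_x}+b_BL_{K_x})\delta b_{\dot\theta}$. For $\rho_r,\gamma_1,\bar\gamma_0>0$ put $\rho=\rho_r+\gamma_1$, $\rho_{ur}=\|\omega^{-1}\mathcal C\|_{\mathcal L_1}\big(b_{K_r}\|r\|_{\mathcal L_\infty}+L_{f_1}^{\rho_r}\rho_r+b_{f_1}^0+\|\bar{\mathcal H}\|_{\bar{\mathcal L}_1}(L_{f_2}^{\rho_r}\rho_r+b_{f_2}^0)\big)$, $\gamma_2=\big(\|\omega^{-1}\mathcal C\|_{\mathcal L_1}L_{f_1}^\rho+\|\omega^{-1}\mathcal C\bar{\mathcal H}\|_{\bar{\mathcal L}_1}L_{f_2}^\rho\big)\gamma_1+\|\omega^{-1}\|\bar\gamma_0$, $\rho_u=\rho_{ur}+\gamma_2$, and, for $T>0$, $b_\sigma=b_Bc_\Omega(\rho_u+b_{K_x}\rho)+L_f^\rho\rho+b_f^0$, $b_{\dot x}=b_{A_m}\rho+b_B\rho_u\max_{w\in\Omega}\|w\|+L_f^\rho\rho+b_f^0+b_Bc_\Omega b_{K_x}\rho$,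 $b_{\dot u}=\|K\|\big[\rho_u+(b_{B^\dagger}+\|\bar{\mathcal H}\|_{\bar{\mathcal L}_1}b_{B_u^\dagger})e^{-aT}\sqrt n\,b_\sigma+b_{K_r}\|r\|_{\mathcal L_\infty}\big]$, $b_{\tilde\sigma}=2\sqrt n\,T\big[\|\omega-\mathbb I_m\|(b_Bb_{\dot u}+L_Bb_{\dot\theta}\rho_u)+l_{\bar f}^\rho+L_{\bar f}^\rho b_{\dot x}\big]+(1-e^{-aT})\sqrt n\,b_\sigma$, $\beta(t)=\sqrt{\sqrt{\bar\lambda(P_{\mathcal F})/\underline\lambda(P_{\mathcal F})}\,(1-e^{-\mu_{\mathcal F}t})}\;\frac{2}{\mu_{\mathcal F}\underline\lambda(P_{\mathcal F})}\max_{\theta\in\Theta}\|P_{\mathcal F}(\theta)B_{\mathcal F}(\theta)\|$ for $0\le t\le\infty$, $\gamma_0(T,\rho,\rho_u)=b_{C_{\mathcal F}}\Big(\sqrt{\bar\lambda(P_{\mathcal F})/\underline\lambda(P_{\mathcal F})}\;\beta(T)\,b_\sigma+\beta(\infty)\,b_{\tilde\sigma}\Big)$. **Theorem.** Suppose (i)–(v)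 and, for some $\rho_r,\gamma_1>0$, the stability condition $$\|\mathcal G_{xm}\|_{\bar{\mathcal L}_1}(L_{f_1}^\rho\rho_r+b_{f_1}^0)+\|\mathcal G_{xum}\|_{\bar{\mathcal L}_1}(L_{f_2}^\rho\rho_r+b_{f_2}^0)<\rho_r-\|\mathcal H_{xm}\mathcal CK_r\|_{\bar{\mathcal L}_1}\|r\|_{\mathcal L_\infty}-\rho_{\rm in}.$$ 1. Let $\bar\gamma_0>0$ and $T>0$ satisfy $$\frac{\|\mathcal H_{xm}\|_{\bar{\mathcal L}_1}}{1-\|\mathcal G_{xm}\|_{\bar{\mathcal L}_1}L_{f_1}^\rho-\|\mathcal G_{xum}\|_{\bar{\mathcal L}_1}L_{f_2}^\rho}\,\bar\gamma_0<\gamma_1,\qquad \gamma_0(T,\rho,\rho_u)<\bar\gamma_0.$$ Then for every admissible $\theta$, every $f$ as in (iv), all $x_0$ with $\|x_0\|\le\rho_0$, all $\hat x_0$, and all solutions of the adaptive closed-loop system and of the reference system, $$\|x\|_{\mathcal L_\infty}\le\rho,\quad\|u\|_{\mathcal L_\infty}\le\rho_u,\quad\|x_r-x\|_{\mathcal L_\infty}\le\gamma_1,\quad\|u_r-u\|_{\mathcal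 L_\infty}\le\gamma_2,\quad\|y_r-y\|_{\mathcal L_\infty}\le b_C\gamma_1;$$ the same bounds hold on $J$ for solutions that are only given on an interval $J\subseteq[0,\infty)$ containing $0$. 2. $\gamma_0(T,\rho,\rho_u)\to0$ as $T\to0^+$, for every $\bar\gamma_0$; and for every $\varepsilon>0$ there is $T_0>0$ such that for every $T\in(0,T_0)$ and all $\theta,f,x_0,\hat x_0$ and solutions as in part 1 (including those on an interval $J$), $\|x_r-x\|_{\mathcal L_\infty}\le\varepsilon$, $\|u_r-u\|_{\mathcal L_\infty}\le\varepsilon$ and $\|y_r-y\|_{\mathcal L_\infty}\le\varepsilon$. -/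

import Mathlib

open Set Filter Topology MeasureTheory
open scoped ENNReal

noncomputable section

namespace LPV

/-- Euclidean `k`-space (with the 2-norm).  A real `k × l` matrix is represented by the continuous
linear map `Vec l →L[ℝ] Vec k`; its operator norm is the 2-norm of the matrix, its `adjoint` is the
transpose. -/
abbrev Vec (k : ℕ) := EuclideanSpace ℝ (Fin k)

/-- Real `k × l` matrices. -/
abbrev Mat (k l : ℕ) := Vec l →L[ℝ] Vec k

/-- Matrix transpose. -/
def tr {k l : ℕ} (M : Mat k l) : Mat l k := ContinuousLinearMap.adjoint M

/-- The pseudo-inverse `(Mᵀ M)⁻¹ Mᵀ` of a matrix of full column rank. -/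
def pinv {k l : ℕ} (M : Mat k l) : Mat l k := (tr M ∘L M).inverse ∘L tr M

/-- The `(i, j)` entry of a matrix. -/
def entry {k l : ℕ} (M : Mat k l) (i : Fin k) (j : Fin l) : ℝ := M (EuclideanSpace.single j 1) i

/-- Strict row diagonal dominance. -/
def StrictlyRowDiagDominant {k : ℕ} (M : Mat k k) : Prop :=
  ∀ i, ∑ j ∈ Finset.univ.erase i, |entry M i j| < |entry M i i|

/-- All complex eigenvalues of the real matrix `M` have negative real part. -/
def IsHurwitz {k : ℕ} (M : Mat k k) : Prop :=
  ∀ z ∈ ((LinearMap.charpoly (M : Vec k →ₗ[ℝ] Vec k)).map (algebraMap ℝ ℂ)).roots, z.re < 0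

/-- The box `[lo₁, hi₁] × ⋯ × [lo_s, hi_s]`. -/
def box {s : ℕ} (lo hi : Vec s) : Set (Vec s) := {v | ∀ i, lo i ≤ v i ∧ v i ≤ hi i}

/-- `max_{z ∈ S} ‖M z‖`. -/
def maxNorm {Z W : Type*} [Norm W] (S : Set Z) (M : Z → W) : ℝ := sSup ((fun z => ‖M z‖) '' S)

/-! ### Signals and input-output mappings -/

/-- `sup_{t ∈ J} ‖x t‖` in `[0, ∞]`: the `L_∞` norm for `J = [0, ∞)`, the truncated `L_∞` norm for
`J = [0, τ]`. -/
def linf {k : ℕ} (J : Set ℝ) (x : ℝ → Vec k) : ℝ≥0∞ := ⨆ t ∈ J, ‖x t‖ₑ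

/-- `x` is a (Carathéodory) solution of `ẋ(t) = g(t)`, `x(0) = x₀` on the interval `J ∋ 0`. -/
def SolvesOn {k : ℕ} (J : Set ℝ) (x : ℝ → Vec k) (x₀ : Vec k) (g : ℝ → Vec k) : Prop :=
  ∀ t ∈ J, IntervalIntegrable g volume 0 t ∧ x t = x₀ + ∫ ξ in (0 : ℝ)..t, g ξ

/-- Trajectories `θ : [0, ∞) → Θ` of the scheduling parameter with `θ̇(t) ∈ Θd`. -/
def Trajectories {s : ℕ} (Θ Θd : Set (Vec s)) : Set (ℝ → Vec s) :=
  {θ | ∃ θ' : ℝ → Vec s, ∀ t, 0 ≤ t →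
    θ t ∈ Θ ∧ θ' t ∈ Θd ∧ HasDerivWithinAt θ (θ' t) (Ici 0) t}

/-- A `θ`-dependent input-output mapping, given by its graph: `G J θ u y` says that on the time
interval `J` the input `u` produces the output `y` along the parameter trajectory `θ`. -/
abbrev IOMap (s k l : ℕ) := Set ℝ → (ℝ → Vec s) → (ℝ → Vec k) → (ℝ → Vec l) → Prop

/-- A parameter-dependent quadruple of state-space matrices (`d` states, `k` inputs,
`l` outputs). -/
structure StateSpace (s d k l : ℕ) where
  A : Vec s → Mat d d
  B : Vec s → Mat d k
  C : Vec s → Mat l d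
  D : Vec s → Mat l k

namespace StateSpace

variable {s d k l : ℕ}

/-- The input-output mapping of a state-space system with zero initial state. -/
def map (G : StateSpace s d k l) : IOMap s k l := fun J θ u y =>
  ∃ x : ℝ → Vec d,
    SolvesOn J x 0 (fun t => G.A (θ t) (x t) + G.B (θ t) (u t)) ∧
    ∀ t ∈ J, y t = G.C (θ t) (x t) + G.D (θ t) (u t)

/-- All state-space matrices depend continuously on the parameter. -/
def ContOn (G : StateSpace s d k l) (Θ : Set (Vec s)) : Prop :=
  ContinuousOn G.A Θ ∧ ContinuousOn G.B Θ ∧ ContinuousOn G.C Θ ∧ ContinuousOn G.D Θ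

end StateSpace

namespace IOMap

variable {s k l q : ℕ}

/-- The static mapping `y(t) = M(θ(t)) u(t)`. -/
def gain (M : Vec s → Mat l k) : IOMap s k l := fun J θ u y => ∀ t ∈ J, y t = M (θ t) (u t)

/-- The composition `G₂ G₁` (first `G₁`, then `G₂`). -/
def comp (G₂ : IOMap s l q) (G₁ : IOMap s k l) : IOMap s k q := fun J θ u y =>
  ∃ v, G₁ J θ u v ∧ G₂ J θ v y

/-- The sum `G₁ + G₂`. -/
def add (G₁ G₂ : IOMap s k l) : IOMap s k l := fun J θ u y =>
  ∃ y₁ y₂, G₁ J θ u y₁ ∧ G₂ J θ u y₂ ∧ ∀ t ∈ J, y t = y₁ t + y₂ t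

/-- The difference `G₁ - G₂`. -/
def sub (G₁ G₂ : IOMap s k l) : IOMap s k l := fun J θ u y =>
  ∃ y₁ y₂, G₁ J θ u y₁ ∧ G₂ J θ u y₂ ∧ ∀ t ∈ J, y t = y₁ t - y₂ t

/-- The peak-to-peak gain (for a time-invariant system: the `L₁` norm). -/
def ppg (G : IOMap s k l) (adm : Set (ℝ → Vec s)) : ℝ≥0∞ :=
  ⨆ θ ∈ adm, ⨆ (u : ℝ → Vec k) (_ : Measurable u) (_ : linf (Ici 0) u ≤ 1),
    ⨆ (y : ℝ → Vec l) (_ : G (Ici 0) θ u y), linf (Ici 0) y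

/-- `γ > 0` is a bound on the peak-to-peak gain. -/
def IsPPGBound (G : IOMap s k l) (adm : Set (ℝ → Vec s)) (γ : ℝ) : Prop :=
  0 < γ ∧ ∀ θ ∈ adm, ∀ τ : ℝ, 0 ≤ τ → ∀ u : ℝ → Vec k, Measurable u → ∀ y : ℝ → Vec l,
    G (Icc 0 τ) θ u y → linf (Icc 0 τ) y ≤ ENNReal.ofReal γ * linf (Icc 0 τ) u

end IOMap

/-- `S` is a state-space realization of the mapping `G`: along all admissible parameter
trajectories, bounded inputs produce the same outputs. -/
def Realizes {s d k l : ℕ} (S : StateSpace s d k l) (G : IOMap s k l)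
    (adm : Set (ℝ → Vec s)) : Prop :=
  ∀ θ ∈ adm, ∀ τ : ℝ, 0 ≤ τ → ∀ u : ℝ → Vec k, Measurable u → linf (Icc 0 τ) u ≠ ⊤ →
    ∀ y : ℝ → Vec l, S.map (Icc 0 τ) θ u y ↔ G (Icc 0 τ) θ u y

/-! ### Parameter-dependent Lyapunov functions -/

/-- `P(θ)` is a continuously differentiable (with derivative `P'`) parameter-dependent symmetric
matrix and `μ > 0` a constant such that `P(θ) > 0` on `Θ` and
`Aᵀ(θ) P(θ) + P(θ) A(θ) + Ṗ(θ) ≤ -μ P(θ)` for `(θ, θ̇) ∈ Θ × Θd`,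
where `Ṗ(θ) = ∑ᵢ (∂P/∂θᵢ) θ̇ᵢ`. -/
structure IsLyapunov {s d : ℕ} (Θ Θd : Set (Vec s)) (A P : Vec s → Mat d d)
    (P' : Vec s → Vec s →L[ℝ] Mat d d) (μ : ℝ) : Prop where
  mu_pos : 0 < μ
  hasDeriv : ∀ θ ∈ Θ, HasFDerivWithinAt P (P' θ) Θ θ
  deriv_cont : ContinuousOn P' Θ
  symm : ∀ θ ∈ Θ, tr (P θ) = P θ
  pos : ∀ θ ∈ Θ, ∀ x : Vec d, x ≠ 0 → 0 < inner ℝ x (P θ x)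
  lmi : ∀ θ ∈ Θ, ∀ v ∈ Θd, tr (A θ) ∘L P θ + P θ ∘L A θ + P' θ v ≤ -(μ • P θ)

/-- The largest eigenvalue of the positive definite matrices `P(θ)`, `θ ∈ Θ`. -/
def lamMax {s d : ℕ} (Θ : Set (Vec s)) (P : Vec s → Mat d d) : ℝ :=
  sSup {c | ∃ θ ∈ Θ, c ∈ spectrum ℝ (P θ)}

/-- The smallest eigenvalue of the positive definite matrices `P(θ)`, `θ ∈ Θ`. -/
def lamMin {s d : ℕ} (Θ : Set (Vec s)) (P : Vec s → Mat d d) : ℝ :=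
  sInf {c | ∃ θ ∈ Θ, c ∈ spectrum ℝ (P θ)}

/-- `β_Θ(∞, μ, P, B)`. -/
def betaInf {s d k : ℕ} (Θ : Set (Vec s)) (μ : ℝ) (P : Vec s → Mat d d) (B : Vec s → Mat d k) :
    ℝ :=
  Real.sqrt (Real.sqrt (lamMax Θ P / lamMin Θ P)) * (2 / (μ * lamMin Θ P)) *
    maxNorm Θ (fun θ => P θ ∘L B θ)

/-- `β_Θ(t, μ, P, B)`. -/
def beta {s d k : ℕ} (Θ : Set (Vec s)) (t μ : ℝ) (P : Vec s → Mat d d) (B : Vec s → Mat d k) :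
    ℝ :=
  Real.sqrt (Real.sqrt (lamMax Θ P / lamMin Θ P) * (1 - Real.exp (-(μ * t)))) *
    (2 / (μ * lamMin Θ P)) * maxNorm Θ (fun θ => P θ ∘L B θ)

/-! ### The control problem -/

/-- The data of the problem.  Dimensions: `n` states, `m` inputs, `p` outputs, `s` scheduling
parameters, `nH` states of the feedforward mapping, `nF` states of the realization of `𝓕`. -/
structure Setup (n m p s nH nF : ℕ) where
  /-- vertices of the box `Θ` -/
  θlo : Vec s
  θhi : Vec s
  /-- vertices of the box `Θd` -/
  νlo : Vec s
  νhi : Vec s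
  /-- bound on `‖θ̇‖` -/
  bθ' : ℝ
  A : Vec s → Mat n n
  B : Vec s → Mat n m
  /-- the complementary input matrix -/
  Bu : Vec s → Mat n (n - m)
  C : Vec s → Mat p n
  /-- baseline feedback gain -/
  Kx : Vec s → Mat m n
  /-- feedforward gain -/
  Kr : Vec s → Mat m p
  /-- set of possible input gains, and the true input gain -/
  Ω : Set (Mat m m)
  ω : Mat m m
  /-- Lipschitz constants of `B`, `B†`, `Kx` -/
  LB : ℝ
  LBd : ℝ
  LKx : ℝ
  /-- constants of the uncertainty `f` -/
  bf0 : ℝ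
  Lf : ℝ → ℝ
  lf : ℝ
  /-- bound on the initial state -/
  ρ0 : ℝ
  /-- reference signal -/
  r : ℝ → Vec p
  /-- filter gain -/
  K : Mat m m
  /-- predictor gain -/
  a : ℝ
  /-- the feedforward mapping for the unmatched uncertainty -/
  Hbar : StateSpace s nH (n - m) m
  /-- Lyapunov matrix of the ideal closed loop -/
  P : Vec s → Mat n n
  P' : Vec s → Vec s →L[ℝ] Mat n n
  μP : ℝ
  /-- state-space matrices of `𝓕(θ)` -/
  AF : Vec s → Mat nF nF
  BF : Vec s → Mat nF n
  CF : Vec s → Mat m nF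
  /-- Lyapunov matrix of `𝓕(θ)` -/
  PF : Vec s → Mat nF nF
  PF' : Vec s → Vec s →L[ℝ] Mat nF nF
  μF : ℝ
  /-- PPG bounds of `𝓖xm`, `𝓖xum`, `𝓗xm 𝓒 Kr`, `𝓗xm`, `𝓗bar`, `ω⁻¹ 𝓒 𝓗bar` -/
  gGxm : ℝ
  gGxum : ℝ
  gHxmCKr : ℝ
  gHxm : ℝ
  gHbar : ℝ
  gCHbar : ℝ
  /-- bound `ρ_r` for the reference system, and the user-selected `γ₁` -/
  ρr : ℝ
  γ1 : ℝ

namespace Setup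

variable {n m p s nH nF : ℕ} (S : Setup n m p s nH nF)

def Θ : Set (Vec s) := box S.θlo S.θhi

def Θd : Set (Vec s) := box S.νlo S.νhi

/-- Admissible parameter trajectories. -/
def adm : Set (ℝ → Vec s) := Trajectories S.Θ S.Θd

def Am (θ : Vec s) : Mat n n := S.A θ + S.B θ ∘L S.Kx θ

/-- `B†(θ)`. -/
def Bd (θ : Vec s) : Mat m n := pinv (S.B θ)

/-- `Bu†(θ)`. -/
def Bud (θ : Vec s) : Mat (n - m) n := pinv (S.Bu θ)

/-- `ω⁻¹`. -/
def ωinv : Mat m m := S.ω.inverse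

/-! #### Mappings -/

/-- The filter `𝓒(s) = ωK (s I + ωK)⁻¹`. -/
def filter : StateSpace s m m m where
  A := fun _ => -(S.ω ∘L S.K)
  B := fun _ => ContinuousLinearMap.id ℝ (Vec m)
  C := fun _ => S.ω ∘L S.K
  D := fun _ => 0

def mapC : IOMap s m m := S.filter.map

def mapHbar : IOMap s (n - m) m := S.Hbar.map

/-- Input-to-state mapping of `ẋ = Am(θ) x + B(θ) u`. -/
def mapHxm : IOMap s m n :=
  (⟨S.Am, S.B, fun _ => ContinuousLinearMap.id ℝ (Vec n), fun _ => 0⟩ : StateSpace s n m n).map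

/-- Input-to-state mapping of `ẋ = Am(θ) x + Bu(θ) u`. -/
def mapHxum : IOMap s (n - m) n :=
  (⟨S.Am, S.Bu, fun _ => ContinuousLinearMap.id ℝ (Vec n), fun _ => 0⟩ :
    StateSpace s n (n - m) n).map

/-- `𝓖xm = 𝓗xm (I - 𝓒)`. -/
def mapGxm : IOMap s m n :=
  IOMap.comp S.mapHxm (IOMap.sub (IOMap.gain fun _ => ContinuousLinearMap.id ℝ (Vec m)) S.mapC)

/-- `𝓖xum = 𝓗xum - 𝓗xm 𝓒 𝓗bar`. -/
def mapGxum : IOMap s (n - m) n :=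
  IOMap.sub S.mapHxum (IOMap.comp S.mapHxm (IOMap.comp S.mapC S.mapHbar))

/-- `𝓗xm 𝓒 Kr`. -/
def mapHxmCKr : IOMap s p n :=
  IOMap.comp S.mapHxm (IOMap.comp S.mapC (IOMap.gain S.Kr))

/-- `ω⁻¹ 𝓒`. -/
def mapωC : IOMap s m m := IOMap.comp (IOMap.gain fun _ => S.ωinv) S.mapC

/-- `ω⁻¹ 𝓒 𝓗bar`. -/
def mapωCHbar : IOMap s (n - m) m := IOMap.comp S.mapωC S.mapHbar

/-- `𝓕 = 𝓒 (B† + 𝓗bar Bu†)`. -/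
def mapF : IOMap s n m :=
  IOMap.comp S.mapC
    (IOMap.add (IOMap.gain S.Bd) (IOMap.comp S.mapHbar (IOMap.gain S.Bud)))

/-- The system with the state-space matrices `(AF, BF, CF, 0)`. -/
def sysF : StateSpace s nF n m := ⟨S.AF, S.BF, S.CF, fun _ => 0⟩

/-! #### Constants -/

def bAm : ℝ := maxNorm S.Θ S.Am
def bB : ℝ := maxNorm S.Θ S.B
def bBd : ℝ := maxNorm S.Θ S.Bd
def bBud : ℝ := maxNorm S.Θ S.Bud
def bC : ℝ := maxNorm S.Θ S.C
def bKx : ℝ := maxNorm S.Θ S.Kx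
def bKr : ℝ := maxNorm S.Θ S.Kr

/-- `max_{ω ∈ Ω} ‖ω‖`. -/
def maxω : ℝ := maxNorm S.Ω (fun w => w)

/-- `max_{ω ∈ Ω} ‖ω - I‖`. -/
def maxωI : ℝ := maxNorm S.Ω (fun w => w - ContinuousLinearMap.id ℝ (Vec m))

/-- `‖r‖` in `L_∞`. -/
def rNorm : ℝ := (linf (Ici 0) S.r).toReal

def bf10 : ℝ := S.bBd * S.bf0
def bf20 : ℝ := S.bBud * S.bf0

/-- Lipschitz constant in `x` of the matched component `f₁` on the ball of radius `δ`. -/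
def Lf1 (δ : ℝ) : ℝ :=
  S.Lf δ * S.bBd +
    maxNorm (S.Ω ×ˢ S.Θ) (fun z => (z.1 - ContinuousLinearMap.id ℝ (Vec m)) ∘L S.Kx z.2)

/-- Lipschitz constant in `x` of the unmatched component `f₂` on the ball of radius `δ`. -/
def Lf2 (δ : ℝ) : ℝ := S.Lf δ * S.bBud

/-- Lipschitz constant in `x` of `f + B(θ)(ω - I)Kx(θ)x` on the ball of radius `δ`. -/
def Lfbar (δ : ℝ) : ℝ :=
  S.Lf δ + maxNorm (S.Ω ×ˢ S.Θ)
    (fun z => S.B z.2 ∘L (z.1 - ContinuousLinearMap.id ℝ (Vec m)) ∘L S.Kx z.2)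

/-- Lipschitz constant in `t` of `f + B(θ(t))(ω - I)Kx(θ(t))x` on the ball of radius `δ`. -/
def lfbar (δ : ℝ) : ℝ :=
  S.lf + S.maxωI * (S.LB * S.bKx + S.bB * S.LKx) * δ * S.bθ'

def ρin : ℝ := S.ρ0 * Real.sqrt (lamMax S.Θ S.P / lamMin S.Θ S.P)

def ρ : ℝ := S.ρr + S.γ1

/-- The `L₁` norm of `ω⁻¹ 𝓒(s)`. -/
def l1ωC : ℝ := (IOMap.ppg S.mapωC S.adm).toReal

def ρur : ℝ :=
  S.l1ωC * (S.bKr * S.rNorm + S.Lf1 S.ρr * S.ρr + S.bf10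
    + S.gHbar * (S.Lf2 S.ρr * S.ρr + S.bf20))

def γ2 (γ0bar : ℝ) : ℝ :=
  (S.l1ωC * S.Lf1 S.ρ + S.gCHbar * S.Lf2 S.ρ) * S.γ1 + ‖S.ωinv‖ * γ0bar

def ρu (γ0bar : ℝ) : ℝ := S.ρur + S.γ2 γ0bar

/-- `b_σ(ρ, ρ_u)`. -/
def bσ (ρ ρu : ℝ) : ℝ := S.bB * S.maxωI * (ρu + S.bKx * ρ) + S.Lf ρ * ρ + S.bf0

/-- `b_ẋ(ρ, ρ_u)`. -/
def bx' (ρ ρu : ℝ) : ℝ :=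
  S.bAm * ρ + S.bB * ρu * S.maxω + S.Lf ρ * ρ + S.bf0 + S.bB * S.maxωI * S.bKx * ρ

/-- `b_{σ̂c}(ρ, ρ_u)`. -/
def bσhatc (T ρ ρu : ℝ) : ℝ := Real.exp (-(S.a * T)) * Real.sqrt n * S.bσ ρ ρu

/-- `b_u̇(ρ, ρ_u)`. -/
def bu' (T ρ ρu : ℝ) : ℝ :=
  ‖S.K‖ * (ρu + (S.bBd + S.gHbar * S.bBud) * S.bσhatc T ρ ρu + S.bKr * S.rNorm)

/-- `b_{σ̃}(ρ, ρ_u)`. -/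
def bσtil (T ρ ρu : ℝ) : ℝ :=
  2 * Real.sqrt n * T *
      (‖S.ω - ContinuousLinearMap.id ℝ (Vec m)‖ * (S.bB * S.bu' T ρ ρu + S.LB * S.bθ' * ρu)
        + S.lfbar ρ + S.Lfbar ρ * S.bx' ρ ρu)
    + (1 - Real.exp (-(S.a * T))) * Real.sqrt n * S.bσ ρ ρu

/-- `γ₀(T, ρ, ρ_u)`. -/
def γ0 (T ρ ρu : ℝ) : ℝ :=
  maxNorm S.Θ S.CF *
    (Real.sqrt (lamMax S.Θ S.PF / lamMin S.Θ S.PF) * beta S.Θ T S.μF S.PF S.BF * S.bσ ρ ρu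
      + betaInf S.Θ S.μF S.PF S.BF * S.bσtil T ρ ρu)

/-! #### Assumptions -/

/-- The standing assumptions on the plant, the baseline controller and the design. -/
structure Assumptions : Prop where
  /-- bound on the parameter rate -/
  rate_bound : ∀ v ∈ S.Θd, ‖v‖ ≤ S.bθ'
  /-- continuity of the parameter-dependent matrices -/
  A_cont : ContinuousOn S.A S.Θ
  Bu_cont : ContinuousOn S.Bu S.Θ
  C_cont : ContinuousOn S.C S.Θ
  Kr_cont : ContinuousOn S.Kr S.Θ
  Hbar_cont : S.Hbar.ContOn S.Θ
  sysF_cont : S.sysF.ContOn S.Θ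
  /-- Lyapunov stability of the ideal closed-loop system -/
  lyap : IsLyapunov S.Θ S.Θd S.Am S.P S.P' S.μP
  /-- partial knowledge of the input gain; `Ω` is a convex polytope containing `ω` and `I` -/
  ω_dom : StrictlyRowDiagDominant S.ω
  ω_mem : S.ω ∈ S.Ω
  Ω_polytope : ∃ V : Set (Mat m m), V.Finite ∧ S.Ω = convexHull ℝ V
  id_mem : ContinuousLinearMap.id ℝ (Vec m) ∈ S.Ω
  /-- `B` has full column rank; `B`, `B†` and `Kx` are Lipschitz -/
  B_inj : ∀ θ ∈ S.Θ, Function.Injective (S.B θ)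
  LB_pos : 0 < S.LB
  LBd_pos : 0 < S.LBd
  LKx_pos : 0 < S.LKx
  B_lip : ∀ θ₁ ∈ S.Θ, ∀ θ₂ ∈ S.Θ, ‖S.B θ₁ - S.B θ₂‖ ≤ S.LB * ‖θ₁ - θ₂‖
  Bd_lip : ∀ θ₁ ∈ S.Θ, ∀ θ₂ ∈ S.Θ, ‖S.Bd θ₁ - S.Bd θ₂‖ ≤ S.LBd * ‖θ₁ - θ₂‖
  Kx_lip : ∀ θ₁ ∈ S.Θ, ∀ θ₂ ∈ S.Θ, ‖S.Kx θ₁ - S.Kx θ₂‖ ≤ S.LKx * ‖θ₁ - θ₂‖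
  /-- `[B, Bu]` has rank `n` and `Bᵀ Bu = 0` -/
  Bbar_rank : ∀ θ ∈ S.Θ, ∀ z : Vec n, ∃ v w, S.B θ v + S.Bu θ w = z
  B_orth : ∀ θ ∈ S.Θ, tr (S.B θ) ∘L S.Bu θ = 0
  /-- positivity of the constants of the uncertainty -/
  Lf_pos : ∀ δ, 0 < δ → 0 < S.Lf δ
  lf_pos : 0 < S.lf
  ρ0_pos : 0 < S.ρ0
  /-- the reference signal is measurable and bounded -/
  r_meas : Measurable S.r
  r_bdd : linf (Ici 0) S.r ≠ ⊤
  /-- the filter is stable for every possible input gain; the predictor gain is positive -/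
  filter_stable : ∀ w ∈ S.Ω, IsHurwitz (-(w ∘L S.K))
  a_pos : 0 < S.a
  /-- `(AF, BF, CF)` realizes `𝓕(θ)` and admits a parameter-dependent Lyapunov function -/
  realF : Realizes S.sysF S.mapF S.adm
  lyapF : IsLyapunov S.Θ S.Θd S.AF S.PF S.PF' S.μF
  /-- PPG bounds -/
  ppg_Gxm : IOMap.IsPPGBound S.mapGxm S.adm S.gGxm
  ppg_Gxum : IOMap.IsPPGBound S.mapGxum S.adm S.gGxum
  ppg_HxmCKr : IOMap.IsPPGBound S.mapHxmCKr S.adm S.gHxmCKr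
  ppg_Hxm : IOMap.IsPPGBound S.mapHxm S.adm S.gHxm
  ppg_Hbar : IOMap.IsPPGBound S.mapHbar S.adm S.gHbar
  ppg_CHbar : IOMap.IsPPGBound S.mapωCHbar S.adm S.gCHbar

/-- The stability condition. -/
def StabilityCondition : Prop :=
  S.gGxm * (S.Lf1 S.ρ * S.ρr + S.bf10) + S.gGxum * (S.Lf2 S.ρ * S.ρr + S.bf20) <
    S.ρr - S.gHxmCKr * S.rNorm - S.ρin

/-- The constraint linking `γ̄₀` and `γ₁`. -/
def GammaConstraint (γ0bar : ℝ) : Prop :=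
  S.gHxm / (1 - S.gGxm * S.Lf1 S.ρ - S.gGxum * S.Lf2 S.ρ) * γ0bar < S.γ1

/-- The assumptions on the unknown nonlinearity `f(t, x)`: uniform boundedness of `f(t, 0)`,
semiglobal Lipschitz continuity in `x`, and Lipschitz continuity in `t`. -/
structure Uncertainty (f : ℝ → Vec n → Vec n) : Prop where
  zero_bound : ∀ t, 0 ≤ t → ‖f t 0‖ ≤ S.bf0
  lip_x : ∀ δ, 0 < δ → ∀ t, 0 ≤ t → ∀ x₁ x₂, ‖x₁‖ ≤ δ → ‖x₂‖ ≤ δ →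
    ‖f t x₁ - f t x₂‖ ≤ S.Lf δ * ‖x₁ - x₂‖
  lip_t : ∀ x t₁ t₂, 0 ≤ t₁ → 0 ≤ t₂ → ‖f t₁ x - f t₂ x‖ ≤ S.lf * |t₁ - t₂|

/-! #### The closed-loop systems -/

/-- `(x, u, y)` are the state, the adaptive input and the output on the time interval `J` of the
plant under `u_total = Kx(θ) x + u`, where `u` is generated by the state predictor (state `xh`,
initial state `xh₀`), the piecewise-constant adaptive law with sampling time `T` (estimate `σh`),
and the filtered control law. -/
def AdaptiveSolution (T : ℝ) (f : ℝ → Vec n → Vec n) (θ : ℝ → Vec s) (x₀ xh₀ : Vec n) (J : Set ℝ)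
    (x : ℝ → Vec n) (u : ℝ → Vec m) (y : ℝ → Vec p) : Prop :=
  ∃ (xh σh σc : ℝ → Vec n) (σm : ℝ → Vec m) (σum : ℝ → Vec (n - m)) (ηh₂ : ℝ → Vec m),
    -- plant
    SolvesOn J x x₀ (fun t =>
      S.A (θ t) (x t) + S.B (θ t) (S.ω (S.Kx (θ t) (x t) + u t)) + f t (x t)) ∧
    (∀ t ∈ J, y t = S.C (θ t) (x t)) ∧
    -- state predictor
    SolvesOn J xh xh₀ (fun t =>
      S.Am (θ t) (x t) + S.B (θ t) (u t) + σh t - S.a • (xh t - x t)) ∧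
    -- adaptive law
    (∀ i : ℕ, ∀ t ∈ J, i * T ≤ t → t < (i + 1) * T →
      σh t = -((S.a / (Real.exp (S.a * T) - 1)) • (xh (i * T) - x (i * T)))) ∧
    (∀ t ∈ J, t < T → σc t = 0) ∧
    (∀ t ∈ J, T ≤ t → σc t = σh t) ∧
    -- matched and unmatched components: `[σm; σum] = [B, Bu]⁻¹ σc`
    (∀ t ∈ J, S.B (θ t) (σm t) + S.Bu (θ t) (σum t) = σc t) ∧
    -- control law
    S.mapHbar J θ σum ηh₂ ∧
    SolvesOn J u 0 (fun t => -(S.K (u t + σm t + ηh₂ t - S.Kr (θ t) (S.r t))))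

/-- `(xr, ur, yr)` are the state, input and output on `J` of the non-adaptive reference system;
`η₁(t) = f₁(t, xr(t))` and `η₂(t) = f₂(t, xr(t))` are defined by
`B(θ) f₁ + Bu(θ) f₂ = f + B(θ)(ω - I)Kx(θ)x`, and
`ur = -ω⁻¹ 𝓒 (η₁ + 𝓗bar(θ) η₂ - Kr(θ) r)`. -/
def ReferenceSolution (f : ℝ → Vec n → Vec n) (θ : ℝ → Vec s) (x₀ : Vec n) (J : Set ℝ)
    (xr : ℝ → Vec n) (ur : ℝ → Vec m) (yr : ℝ → Vec p) : Prop :=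
  ∃ (η₁ : ℝ → Vec m) (η₂ : ℝ → Vec (n - m)) (h c : ℝ → Vec m),
    (∀ t ∈ J, S.B (θ t) (η₁ t) + S.Bu (θ t) (η₂ t) =
      f t (xr t) + S.B (θ t) (S.ω (S.Kx (θ t) (xr t)) - S.Kx (θ t) (xr t))) ∧
    SolvesOn J xr x₀ (fun t =>
      S.Am (θ t) (xr t) + S.B (θ t) (S.ω (ur t) + η₁ t) + S.Bu (θ t) (η₂ t)) ∧
    S.mapHbar J θ η₂ h ∧
    S.mapC J θ (fun t => η₁ t + h t - S.Kr (θ t) (S.r t)) c ∧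
    (∀ t ∈ J, ur t = -(S.ωinv (c t))) ∧
    (∀ t ∈ J, yr t = S.C (θ t) (xr t))

/-- For sampling time `T`, the property `Q J x u y xr ur yr` holds for every admissible parameter
trajectory, uncertainty, initial state with `‖x₀‖ ≤ ρ₀`, predictor initial state, interval `J` with
left end `0` (in particular `J = [0, ∞)`), and all solutions of the adaptive closed-loop system and
of the reference system on `J`. -/
def ForAllRuns (T : ℝ) (Q : Set ℝ → (ℝ → Vec n) → (ℝ → Vec m) → (ℝ → Vec p) →
    (ℝ → Vec n) → (ℝ → Vec m) → (ℝ → Vec p) → Prop) : Prop :=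
  ∀ θ ∈ S.adm, ∀ f : ℝ → Vec n → Vec n, S.Uncertainty f →
    ∀ x₀ xh₀ : Vec n, ‖x₀‖ ≤ S.ρ0 →
    ∀ J : Set ℝ, J.OrdConnected → 0 ∈ J → J ⊆ Ici 0 →
    ∀ (x : ℝ → Vec n) (u : ℝ → Vec m) (y : ℝ → Vec p), S.AdaptiveSolution T f θ x₀ xh₀ J x u y →
    ∀ (xr : ℝ → Vec n) (ur : ℝ → Vec m) (yr : ℝ → Vec p), S.ReferenceSolution f θ x₀ J xr ur yr →
    Q J x u y xr ur yr

end Setup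

end LPV

end

/-!
Feeding the uncertainty through `𝓒` makes both the adaptive closed loop and the reference system
instances of one filtered loop. They share initial state and reference input, so by linearity their
difference is again a filtered loop, started at `0` and driven only by the estimation error passed
through `𝓕`. Each value of the piecewise constant estimate cancels the predictor error carried over
from the previous sampling interval, so the next one is, up to the factor `e^{-aT}`, a weighted
average of the uncertainty over the interval in between; its error is `O(T)` as long as `x` and `u`
stay bounded. The Lyapunov function of `𝓕` turns this into the bound `γ₀(T)`, and the stability
condition is the small-gain condition which closes the loop: it bounds `x_r` by `ρ_r`, and shows
that bounds `γ₁`, `γ₂` on the deviations up to time `t` hold strictly at `t`. A continuity argument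
starting at time `0` then makes them hold for all times.
-/

namespace LPV

/-! ### Carathéodory solutions -/

section Solutions

variable {k l : ℕ} {J : Set ℝ} {τ : ℝ} {x y g h : ℝ → Vec k} {x₀ y₀ : Vec k}

lemma SolvesOn.mono {J' : Set ℝ} (hx : SolvesOn J x x₀ g) (hJ : J' ⊆ J) : SolvesOn J' x x₀ g :=
  fun t ht => hx t (hJ ht)

lemma SolvesOn.congr_rhs (hx : SolvesOn (Icc 0 τ) x x₀ g) (hg : ∀ t ∈ Icc 0 τ, g t = h t) :
    SolvesOn (Icc 0 τ) x x₀ h := by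
  intro t ht
  have hgt : EqOn g h (uIcc 0 t) := fun ξ hξ => by
    rw [uIcc_of_le ht.1] at hξ
    exact hg ξ ⟨hξ.1, hξ.2.trans ht.2⟩
  refine ⟨(hx t ht).1.congr (hgt.mono uIoc_subset_uIcc), ?_⟩
  rw [(hx t ht).2, intervalIntegral.integral_congr hgt]

lemma SolvesOn.congr_state (hx : SolvesOn J x x₀ g) (hy : ∀ t ∈ J, y t = x t) :
    SolvesOn J y x₀ g :=
  fun t ht => ⟨(hx t ht).1, (hy t ht).trans (hx t ht).2⟩

lemma SolvesOn.clm (hx : SolvesOn J x x₀ g) (L : Mat l k) :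
    SolvesOn J (fun t => L (x t)) (L x₀) (fun t => L (g t)) := by
  intro t ht
  obtain ⟨hg, hxt⟩ := hx t ht
  refine ⟨⟨L.integrable_comp hg.1, L.integrable_comp hg.2⟩, ?_⟩
  simp only [hxt, map_add, L.intervalIntegral_comp_comm hg]

lemma SolvesOn.const_smul (hx : SolvesOn J x x₀ g) (c : ℝ) :
    SolvesOn J (fun t => c • x t) (c • x₀) (fun t => c • g t) := by
  simpa using hx.clm (c • ContinuousLinearMap.id ℝ (Vec k))

lemma SolvesOn.add (hx : SolvesOn J x x₀ g) (hy : SolvesOn J y y₀ h) :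
    SolvesOn J (fun t => x t + y t) (x₀ + y₀) (fun t => g t + h t) := by
  intro t ht
  refine ⟨(hx t ht).1.add (hy t ht).1, ?_⟩
  simp only [(hx t ht).2, (hy t ht).2, intervalIntegral.integral_add (hx t ht).1 (hy t ht).1]
  abel

lemma SolvesOn.sub (hx : SolvesOn J x x₀ g) (hy : SolvesOn J y y₀ h) :
    SolvesOn J (fun t => x t - y t) (x₀ - y₀) (fun t => g t - h t) := by
  simpa [sub_eq_add_neg] using hx.add (hy.const_smul (-1))

lemma SolvesOn.continuousOn (hτ : 0 ≤ τ) (hx : SolvesOn (Icc 0 τ) x x₀ g) :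
    ContinuousOn x (Icc 0 τ) := by
  have hg : IntegrableOn g (uIcc 0 τ) := by
    rw [uIcc_of_le hτ, integrableOn_Icc_iff_integrableOn_Ioc]
    exact (hx τ ⟨hτ, le_rfl⟩).1.1
  have hprim := intervalIntegral.continuousOn_primitive_interval hg
  rw [uIcc_of_le hτ] at hprim
  exact (continuousOn_const.add hprim).congr fun t ht => (hx t ht).2

lemma SolvesOn.zero_apply (hx : SolvesOn J x x₀ g) (h0 : 0 ∈ J) : x 0 = x₀ := by
  simpa using (hx 0 h0).2

lemma SolvesOn.sub_eq_integral (hx : SolvesOn J x x₀ g) {t₁ t₂ : ℝ} (h₁ : t₁ ∈ J) (h₂ : t₂ ∈ J) :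
    x t₂ - x t₁ = ∫ ξ in t₁..t₂, g ξ := by
  rw [(hx t₁ h₁).2, (hx t₂ h₂).2, add_sub_add_left_eq_sub,
    intervalIntegral.integral_interval_sub_left (hx t₂ h₂).1 (hx t₁ h₁).1]

lemma SolvesOn.intervalIntegrable (hx : SolvesOn J x x₀ g) {t₁ t₂ : ℝ} (h₁ : t₁ ∈ J)
    (h₂ : t₂ ∈ J) : IntervalIntegrable g volume t₁ t₂ :=
  (hx t₁ h₁).1.symm.trans (hx t₂ h₂).1

lemma SolvesOn.norm_sub_le [hJ : J.OrdConnected] {c : ℝ} (hx : SolvesOn J x x₀ g)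
    (hc : ∀ t ∈ J, ‖g t‖ ≤ c) {t₁ t₂ : ℝ} (h₁ : t₁ ∈ J) (h₂ : t₂ ∈ J) :
    ‖x t₂ - x t₁‖ ≤ c * |t₂ - t₁| := by
  rw [hx.sub_eq_integral h₁ h₂]
  exact intervalIntegral.norm_integral_le_of_norm_le_const fun ξ hξ =>
    hc ξ (hJ.uIcc_subset h₁ h₂ (uIoc_subset_uIcc hξ))

lemma SolvesOn.hasDerivWithinAt_right (hx : SolvesOn (Icc 0 τ) x x₀ g) {t : ℝ} (ht : t ∈ Ico 0 τ)
    (hg : ContinuousWithinAt g (Ici t) t) : HasDerivWithinAt x (g t) (Ici t) t := by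
  have hgτ := (hx τ ⟨ht.1.trans ht.2.le, le_rfl⟩).1
  have hmeas : StronglyMeasurableAtFilter g (𝓝[>] t) :=
    ⟨Ioc t τ, Ioc_mem_nhdsGT ht.2, hgτ.1.aestronglyMeasurable.mono_measure
      (Measure.restrict_mono (Ioc_subset_Ioc_left ht.1) le_rfl)⟩
  have hprim : HasDerivWithinAt (fun s => x₀ + ∫ ξ in (0 : ℝ)..s, g ξ) (g t) (Ici t) t :=
    (intervalIntegral.integral_hasDerivWithinAt_right (hx t ⟨ht.1, ht.2.le⟩).1 hmeas
      (hg.mono Ioi_subset_Ici_self)).const_add x₀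
  refine hprim.congr_of_eventuallyEq ?_ (hx t ⟨ht.1, ht.2.le⟩).2
  filter_upwards [Icc_mem_nhdsGE ht.2] with s hs
  exact (hx s ⟨ht.1.trans hs.1, hs.2⟩).2

end Solutions

lemma exists_continuous_extension {W : Type*} [TopologicalSpace W] {τ : ℝ} (hτ : 0 ≤ τ)
    {u : ℝ → W} (hu : ContinuousOn u (Icc 0 τ)) :
    ∃ u' : ℝ → W, Continuous u' ∧ ∀ t ∈ Icc 0 τ, u' t = u t :=
  ⟨IccExtend hτ ((Icc 0 τ).domRestrict u),
    (continuousOn_iff_continuous_domRestrict.1 hu).Icc_extend',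
    fun t ht => by simp [IccExtend_of_mem hτ _ ht]⟩

/-! ### Linear differential equations -/

section Volterra

variable {E : Type*} [NormedAddCommGroup E] [NormedSpace ℝ E]

lemma norm_exp_smul_integral_le {q c t : ℝ} (hq : 0 < q) (hc : 0 ≤ c) (ht : 0 ≤ t) {v : ℝ → E}
    (hv : ∀ ξ ∈ Ioc 0 t, ‖v ξ‖ ≤ c) :
    ‖Real.exp (-(q * t)) • ∫ ξ in (0 : ℝ)..t, Real.exp (q * ξ) • v ξ‖ ≤ c / q := by
  have integrable : ‖∫ ξ in (0 : ℝ)..t, Real.exp (q * ξ) • v ξ‖ ≤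
      ∫ ξ in (0 : ℝ)..t, c * Real.exp (q * ξ) := by
    refine intervalIntegral.norm_integral_le_of_norm_le ht
      (Eventually.of_forall fun ξ hξ => ?_) (Continuous.intervalIntegrable (by fun_prop) _ _)
    rw [norm_smul, Real.norm_of_nonneg (Real.exp_pos _).le, mul_comm]
    gcongr
    exact hv ξ hξ
  have hval : ∫ ξ in (0 : ℝ)..t, c * Real.exp (q * ξ) = c / q * (Real.exp (q * t) - 1) := by
    rw [intervalIntegral.integral_const_mul,
      intervalIntegral.integral_comp_mul_left (fun x => Real.exp x) hq.ne', integral_exp,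
      mul_zero, Real.exp_zero, smul_eq_mul]
    ring
  have hcq : 0 ≤ c / q := by positivity
  rw [norm_smul, Real.norm_of_nonneg (Real.exp_pos _).le]
  calc Real.exp (-(q * t)) * ‖∫ ξ in (0 : ℝ)..t, Real.exp (q * ξ) • v ξ‖
      ≤ Real.exp (-(q * t)) * (c / q * (Real.exp (q * t) - 1)) := by
        rw [← hval]; gcongr
    _ = c / q * (1 - Real.exp (-(q * t))) := by
        rw [Real.exp_neg]; field_simp
    _ ≤ c / q := mul_le_of_le_one_right hcq (by linarith [Real.exp_pos (-(q * t))])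

/-- The operator `w ↦ e^{-qt} (y(t) + ∫₀ᵗ A(ξ) e^{qξ} w(ξ) dξ)` on continuous functions on
`[0, τ]`.  If `w` is a fixed point, then `t ↦ e^{qt} w(t)` solves the Volterra equation
`x(t) = y(t) + ∫₀ᵗ A(ξ) x(ξ) dξ`; for large `q` the operator is a contraction. -/
noncomputable def weightedVolterra {τ : ℝ} (hτ : 0 ≤ τ) (q : ℝ) {A : ℝ → E →L[ℝ] E} {y : ℝ → E}
    (hA : Continuous A) (hy : Continuous y) (w : C(Icc (0 : ℝ) τ, E)) : C(Icc (0 : ℝ) τ, E) where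
  toFun t := Real.exp (-(q * t)) •
    (y t + ∫ ξ in (0 : ℝ)..t, Real.exp (q * ξ) • A ξ (w (projIcc 0 τ hτ ξ)))
  continuous_toFun := by
    have : Continuous (projIcc 0 τ hτ) := continuous_projIcc
    have integrable : Continuous fun ξ : ℝ => Real.exp (q * ξ) • A ξ (w (projIcc 0 τ hτ ξ)) := by
      fun_prop
    have := intervalIntegral.continuous_primitive
      (fun a b => integrable.intervalIntegrable (μ := volume) a b) 0
    fun_prop

lemma contractingWith_weightedVolterra {τ : ℝ} (hτ : 0 ≤ τ) {L : ℝ} {A : ℝ → E →L[ℝ] E}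
    {y : ℝ → E} (hA : Continuous A) (hy : Continuous y) (hL : ∀ t ∈ Icc 0 τ, ‖A t‖ ≤ L) :
    ContractingWith (1 / 2) (weightedVolterra hτ (2 * L + 1) hA hy) := by
  have hL0 : 0 ≤ L := (norm_nonneg _).trans (hL 0 ⟨le_rfl, hτ⟩)
  refine ⟨by rw [← NNReal.coe_lt_coe]; norm_num, LipschitzWith.of_dist_le_mul fun w v => ?_⟩
  rw [ContinuousMap.dist_le (by positivity)]
  rintro ⟨t, ht⟩
  have : Continuous (projIcc 0 τ hτ) := continuous_projIcc
  have hcont : ∀ w : C(Icc (0 : ℝ) τ, E),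
      Continuous fun ξ : ℝ => Real.exp ((2 * L + 1) * ξ) • A ξ (w (projIcc 0 τ hτ ξ)) :=
    fun w => by fun_prop
  have hdiff : weightedVolterra hτ (2 * L + 1) hA hy w ⟨t, ht⟩ -
      weightedVolterra hτ (2 * L + 1) hA hy v ⟨t, ht⟩ = Real.exp (-((2 * L + 1) * t)) •
        ∫ ξ in (0 : ℝ)..t, Real.exp ((2 * L + 1) * ξ) •
          A ξ (w (projIcc 0 τ hτ ξ) - v (projIcc 0 τ hτ ξ)) := by
    simp only [weightedVolterra, ContinuousMap.coe_mk]
    rw [← smul_sub, add_sub_add_left_eq_sub, ← intervalIntegral.integral_sub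
      ((hcont w).intervalIntegrable _ _) ((hcont v).intervalIntegrable _ _)]
    simp only [map_sub, smul_sub]
  rw [dist_eq_norm, hdiff]
  calc _ ≤ L * dist w v / (2 * L + 1) := by
        refine norm_exp_smul_integral_le (by positivity) (by positivity) ht.1 fun ξ hξ => ?_
        refine (A ξ).le_of_opNorm_le_of_le (hL ξ ⟨hξ.1.le, hξ.2.trans ht.2⟩) ?_
        rw [← dist_eq_norm]
        exact ContinuousMap.dist_apply_le_dist _
    _ ≤ (1 / 2 : NNReal) * dist w v := by
        have hq : L / (2 * L + 1) ≤ 1 / 2 := by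
          rw [div_le_div_iff₀ (by positivity) two_pos]; linarith
        rw [mul_div_right_comm]
        push_cast
        gcongr

theorem exists_volterra_solution [CompleteSpace E] {τ : ℝ} (hτ : 0 ≤ τ) {A : ℝ → E →L[ℝ] E}
    {y : ℝ → E} (hA : Continuous A) (hy : Continuous y) :
    ∃ x : ℝ → E, Continuous x ∧ ∀ t ∈ Icc 0 τ, x t = y t + ∫ ξ in (0 : ℝ)..t, A ξ (x ξ) := by
  obtain ⟨L, hL⟩ := isCompact_Icc.exists_bound_of_continuousOn (s := Icc (0 : ℝ) τ)
    hA.continuousOn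
  have hΦ := contractingWith_weightedVolterra hτ hA hy hL
  set q := 2 * L + 1
  set w := hΦ.fixedPoint
  have : Continuous (projIcc 0 τ hτ) := continuous_projIcc
  refine ⟨fun t => Real.exp (q * t) • w (projIcc 0 τ hτ t), by fun_prop, fun t ht => ?_⟩
  have hw : weightedVolterra hτ q hA hy w = w := hΦ.fixedPoint_isFixedPt
  have hwt : w (projIcc 0 τ hτ t) = Real.exp (-(q * t)) •
      (y t + ∫ ξ in (0 : ℝ)..t, Real.exp (q * ξ) • A ξ (w (projIcc 0 τ hτ ξ))) := by
    conv_lhs => rw [projIcc_of_mem hτ ht, ← hw]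
    rfl
  simp only [map_smul]
  rw [hwt, smul_smul, ← Real.exp_add, add_neg_cancel, Real.exp_zero, one_smul]

end Volterra

lemma exists_solvesOn_linear {k : ℕ} {τ : ℝ} (hτ : 0 ≤ τ) {A : ℝ → Mat k k} {g : ℝ → Vec k}
    (hA : ContinuousOn A (Icc 0 τ)) (hg : ContinuousOn g (Icc 0 τ)) (x₀ : Vec k) :
    ∃ x, SolvesOn (Icc 0 τ) x x₀ (fun t => A t (x t) + g t) := by
  obtain ⟨A', hA', hAA'⟩ := exists_continuous_extension hτ hA
  obtain ⟨g', hg', hgg'⟩ := exists_continuous_extension hτ hg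
  have hprim : Continuous fun t => x₀ + ∫ ξ in (0 : ℝ)..t, g' ξ := continuous_const.add
    (intervalIntegral.continuous_primitive (fun a b => hg'.intervalIntegrable a b) 0)
  obtain ⟨x, hxc, hx⟩ := exists_volterra_solution hτ hA' hprim
  have hAx : Continuous fun ξ => A' ξ (x ξ) := by fun_prop
  have hsol : SolvesOn (Icc 0 τ) x x₀ (fun t => A' t (x t) + g' t) := by
    intro t ht
    refine ⟨(hAx.add hg').intervalIntegrable _ _, ?_⟩
    rw [hx t ht, intervalIntegral.integral_add (hAx.intervalIntegrable _ _)
      (hg'.intervalIntegrable _ _)]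
    abel
  exact ⟨x, hsol.congr_rhs fun t ht => by rw [hAA' t ht, hgg' t ht]⟩

/-! ### Input-output mappings -/

namespace Trajectories

variable {s : ℕ} {Θ Θd : Set (Vec s)} {θ : ℝ → Vec s}

lemma continuousOn (hθ : θ ∈ Trajectories Θ Θd) : ContinuousOn θ (Ici 0) := by
  obtain ⟨θ', hθ'⟩ := hθ
  exact fun t ht => (hθ' t ht).2.2.continuousWithinAt

lemma mem (hθ : θ ∈ Trajectories Θ Θd) {t : ℝ} (ht : 0 ≤ t) : θ t ∈ Θ := by
  obtain ⟨θ', hθ'⟩ := hθ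
  exact (hθ' t ht).1

lemma continuousOn_comp {W : Type*} [TopologicalSpace W] (hθ : θ ∈ Trajectories Θ Θd)
    {M : Vec s → W} (hM : ContinuousOn M Θ) (τ : ℝ) :
    ContinuousOn (fun t => M (θ t)) (Icc 0 τ) :=
  hM.comp ((continuousOn hθ).mono Icc_subset_Ici_self) fun _ ht => mem hθ ht.1

lemma norm_sub_le {b : ℝ} (hb : ∀ v ∈ Θd, ‖v‖ ≤ b) (hθ : θ ∈ Trajectories Θ Θd) {t₁ t₂ : ℝ}
    (h₁ : 0 ≤ t₁) (h₂ : 0 ≤ t₂) : ‖θ t₂ - θ t₁‖ ≤ b * |t₂ - t₁| := by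
  obtain ⟨θ', hθ'⟩ := hθ
  exact (convex_Ici (0 : ℝ)).norm_image_sub_le_of_norm_hasDerivWithin_le
    (fun t ht => (hθ' t ht).2.2) (fun t ht => hb _ (hθ' t ht).2.1) h₁ h₂

end Trajectories

namespace StateSpace

variable {s d k l : ℕ} {G : StateSpace s d k l} {J : Set ℝ} {τ : ℝ} {θ : ℝ → Vec s}
  {u v : ℝ → Vec k} {y z : ℝ → Vec l}

lemma map_mono {J' : Set ℝ} (hy : G.map J θ u y) (hJ : J' ⊆ J) : G.map J' θ u y := by
  obtain ⟨x, hx, hxy⟩ := hy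
  exact ⟨x, hx.mono hJ, fun t ht => hxy t (hJ ht)⟩

lemma map_congr (hy : G.map (Icc 0 τ) θ u y) (huv : ∀ t ∈ Icc 0 τ, u t = v t)
    (hyz : ∀ t ∈ Icc 0 τ, y t = z t) : G.map (Icc 0 τ) θ v z := by
  obtain ⟨x, hx, hxy⟩ := hy
  exact ⟨x, hx.congr_rhs fun t ht => by rw [huv t ht],
    fun t ht => by rw [← hyz t ht, hxy t ht, huv t ht]⟩

lemma map_add (hy : G.map (Icc 0 τ) θ u y) (hz : G.map (Icc 0 τ) θ v z) :
    G.map (Icc 0 τ) θ (fun t => u t + v t) (fun t => y t + z t) := by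
  obtain ⟨x₁, hx₁, hy₁⟩ := hy
  obtain ⟨x₂, hx₂, hy₂⟩ := hz
  refine ⟨fun t => x₁ t + x₂ t, ?_, fun t ht => ?_⟩
  · have hadd := hx₁.add hx₂
    rw [add_zero] at hadd
    exact hadd.congr_rhs fun t _ => by simp only [_root_.map_add]; abel
  · simp only [_root_.map_add, hy₁ t ht, hy₂ t ht]; abel

lemma map_smul (hy : G.map (Icc 0 τ) θ u y) (c : ℝ) :
    G.map (Icc 0 τ) θ (fun t => c • u t) (fun t => c • y t) := by
  obtain ⟨x, hx, hxy⟩ := hy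
  refine ⟨fun t => c • x t, ?_, fun t ht => ?_⟩
  · have hsmul := hx.const_smul c
    rw [smul_zero] at hsmul
    exact hsmul.congr_rhs fun t _ => by simp only [_root_.map_smul, smul_add]
  · simp only [_root_.map_smul, hxy t ht, smul_add]

lemma map_neg (hy : G.map (Icc 0 τ) θ u y) :
    G.map (Icc 0 τ) θ (fun t => -u t) (fun t => -y t) := by
  simpa using map_smul hy (-1)

lemma map_sub (hy : G.map (Icc 0 τ) θ u y) (hz : G.map (Icc 0 τ) θ v z) :
    G.map (Icc 0 τ) θ (fun t => u t - v t) (fun t => y t - z t) := by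
  simpa [sub_eq_add_neg] using map_add hy (map_neg hz)

variable {Θ Θd : Set (Vec s)}

lemma continuousOn_of_map (hτ : 0 ≤ τ) (hC : ContinuousOn G.C Θ) (hθ : θ ∈ Trajectories Θ Θd)
    (hy : G.map (Icc 0 τ) θ u y) (hD : ContinuousOn (fun t => G.D (θ t) (u t)) (Icc 0 τ)) :
    ContinuousOn y (Icc 0 τ) := by
  obtain ⟨x, hx, hxy⟩ := hy
  exact (((Trajectories.continuousOn_comp hθ hC τ).clm_apply (hx.continuousOn hτ)).add hD).congr
    hxy

lemma exists_continuous_map (hτ : 0 ≤ τ) (hG : G.ContOn Θ) (hθ : θ ∈ Trajectories Θ Θd)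
    (hu : ContinuousOn u (Icc 0 τ)) : ∃ y, G.map (Icc 0 τ) θ u y ∧ Continuous y := by
  obtain ⟨hA, hB, hC, hD⟩ := hG
  obtain ⟨x, hx⟩ := exists_solvesOn_linear hτ (Trajectories.continuousOn_comp hθ hA τ)
    ((Trajectories.continuousOn_comp hθ hB τ).clm_apply hu) 0
  obtain ⟨y, hyc, hy⟩ := exists_continuous_extension hτ
    (((Trajectories.continuousOn_comp hθ hC τ).clm_apply (hx.continuousOn hτ)).add
      ((Trajectories.continuousOn_comp hθ hD τ).clm_apply hu))
  exact ⟨y, ⟨x, hx, hy⟩, hyc⟩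

end StateSpace

/-! ### Compact parameter sets and extreme eigenvalues -/

lemma isCompact_box {s : ℕ} (lo hi : Vec s) : IsCompact (box lo hi) := by
  have hbox : box lo hi = (PiLp.continuousLinearEquiv 2 ℝ (fun _ : Fin s => ℝ)).toHomeomorph ⁻¹'
      (Icc (fun i => lo i) (fun i => hi i)) := by
    ext v
    simp [box, Pi.le_def, forall_and]
  rw [hbox]
  exact (Homeomorph.isCompact_preimage _).2 isCompact_Icc

lemma maxNorm_nonneg {Z W : Type*} [SeminormedAddCommGroup W] (S : Set Z) (M : Z → W) :
    0 ≤ maxNorm S M := by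
  apply Real.sSup_nonneg
  rintro _ ⟨z, _, rfl⟩
  exact norm_nonneg _

lemma norm_le_maxNorm {Z W : Type*} [TopologicalSpace Z] [SeminormedAddCommGroup W]
    {S : Set Z} {M : Z → W} (hS : IsCompact S) (hM : ContinuousOn M S) {z : Z} (hz : z ∈ S) :
    ‖M z‖ ≤ maxNorm S M :=
  le_csSup (hS.image_of_continuousOn hM.norm).bddAbove (mem_image_of_mem _ hz)

section Spectrum

variable {d : ℕ} {M : Mat d d}

lemma exists_eigenvector_of_mem_spectrum {c : ℝ} (hc : c ∈ spectrum ℝ M) :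
    ∃ v : Vec d, v ≠ 0 ∧ M v = c • v := by
  have hc' : c ∈ spectrum ℝ (M : Module.End ℝ (Vec d)) := by
    rwa [← AlgEquiv.spectrum_eq (Module.End.toContinuousLinearMap (Vec d))]
  obtain ⟨v, hv⟩ := (Module.End.hasEigenvalue_iff_mem_spectrum.2 hc').exists_hasEigenvector
  exact ⟨v, hv.2, hv.apply_eq_smul⟩

lemma isSymmetric_of_tr_eq (hM : tr M = M) : (M : Vec d →ₗ[ℝ] Vec d).IsSymmetric := by
  intro x y
  have hadj := ContinuousLinearMap.adjoint_inner_left M y x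
  change inner ℝ (tr M x) y = _ at hadj
  rwa [hM] at hadj

lemma exists_inner_eq_sum_spectrum (hM : tr M = M) (x : Vec d) :
    ∃ (lam wt : Fin d → ℝ), (∀ i, lam i ∈ spectrum ℝ M) ∧ (∀ i, 0 ≤ wt i) ∧
      ∑ i, wt i = ‖x‖ ^ 2 ∧ inner ℝ x (M x) = ∑ i, lam i * wt i := by
  have hsymm := isSymmetric_of_tr_eq hM
  have hd : Module.finrank ℝ (Vec d) = d := finrank_euclideanSpace_fin
  let b := hsymm.eigenvectorBasis hd
  refine ⟨hsymm.eigenvalues hd, fun i => inner ℝ (b i) x ^ 2, fun i => ?_, fun i => sq_nonneg _,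
    ?_, ?_⟩
  · have hi := Module.End.hasEigenvalue_iff_mem_spectrum.1 (hsymm.hasEigenvalue_eigenvalues hd i)
    rwa [← AlgEquiv.spectrum_eq (Module.End.toContinuousLinearMap (Vec d))] at hi
  · rw [← real_inner_self_eq_norm_sq, ← b.sum_inner_mul_inner x x]
    refine Finset.sum_congr rfl fun i _ => ?_
    rw [real_inner_comm (b i) x]; ring
  · rw [← b.sum_inner_mul_inner x (M x)]
    refine Finset.sum_congr rfl fun i _ => ?_
    have hcoord : inner ℝ (b i) (M x) = hsymm.eigenvalues hd i * inner ℝ (b i) x := by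
      have hbi : M (b i) = hsymm.eigenvalues hd i • b i := hsymm.apply_eigenvectorBasis hd i
      rw [← real_inner_smul_left, ← hbi]
      exact (hsymm (b i) x).symm
    rw [hcoord, real_inner_comm (b i) x]; ring

lemma le_of_mem_spectrum_of_forall_inner_ge {c lam : ℝ}
    (hc : ∀ x : Vec d, c * ‖x‖ ^ 2 ≤ inner ℝ x (M x)) (hlam : lam ∈ spectrum ℝ M) : c ≤ lam := by
  obtain ⟨v, hv, hMv⟩ := exists_eigenvector_of_mem_spectrum hlam
  have hcv := hc v
  rw [hMv, real_inner_smul_right, real_inner_self_eq_norm_sq] at hcv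
  exact le_of_mul_le_mul_right hcv (by positivity)

lemma le_norm_of_mem_spectrum {lam : ℝ} (hlam : lam ∈ spectrum ℝ M) : lam ≤ ‖M‖ := by
  obtain ⟨v, hv, hMv⟩ := exists_eigenvector_of_mem_spectrum hlam
  have hMv_le := M.le_opNorm v
  rw [hMv, norm_smul] at hMv_le
  exact (le_abs_self _).trans (le_of_mul_le_mul_right hMv_le (norm_pos_iff.2 hv))

lemma exists_mem_spectrum_of_tr_eq (hd : 0 < d) (hM : tr M = M) : ∃ c, c ∈ spectrum ℝ M := by
  obtain ⟨lam, _, hlam, -⟩ := exists_inner_eq_sum_spectrum hM 0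
  exact ⟨lam ⟨0, hd⟩, hlam _⟩

end Spectrum

/-! ### Decay estimates from a parameter-dependent Lyapunov function -/

section Decay

variable {V V' : ℝ → ℝ} {μ κ a b t : ℝ}

/-- `√V` need not be differentiable at a zero of `V`; `√(V + ε²)` is, and it satisfies a linear
differential inequality up to an error of order `ε`. -/
lemma sqrt_add_sq_le_of_deriv_right_le (hμ : 0 < μ) (hκ : 0 ≤ κ) (hVc : ContinuousOn V (Icc a b))
    (hV0 : ∀ t ∈ Icc a b, 0 ≤ V t) (hV : ∀ t ∈ Ico a b, HasDerivWithinAt V (V' t) (Ici t) t)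
    (hV' : ∀ t ∈ Ico a b, V' t ≤ -(μ * V t) + 2 * (κ * √(V t))) (ht : t ∈ Icc a b)
    {ε : ℝ} (hε : 0 < ε) :
    √(V t + ε ^ 2) ≤ √(V a + ε ^ 2) * Real.exp (-(μ / 2 * (t - a))) +
      (1 - Real.exp (-(μ / 2 * (t - a)))) * (2 / μ * κ + ε) := by
  have hgronwall := le_gronwallBound_of_liminf_deriv_right_le (f := fun t => √(V t + ε ^ 2))
    (f' := fun t => V' t / (2 * √(V t + ε ^ 2))) (δ := √(V a + ε ^ 2)) (K := -(μ / 2))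
    (ε := κ + μ / 2 * ε) (a := a) (b := b) (hVc.add continuousOn_const).sqrt
    (fun t ht r hr => by
      have := hV0 t (Ico_subset_Icc_self ht)
      have hslope := (((hV t ht).add_const (ε ^ 2)).sqrt (by positivity)).liminf_right_slope_le hr
      simpa only [slope_def_field, div_eq_inv_mul] using hslope)
    le_rfl
    (fun t ht => by
      have hVt := hV0 t (Ico_subset_Icc_self ht)
      have hε_le : ε ≤ √(V t + ε ^ 2) := Real.le_sqrt_of_sq_le (by linarith)
      have hsq : √(V t + ε ^ 2) ^ 2 = V t + ε ^ 2 := Real.sq_sqrt (by positivity)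
      have hsqrt_le : √(V t) ≤ √(V t + ε ^ 2) :=
        Real.sqrt_le_sqrt (le_add_of_nonneg_right (sq_nonneg ε))
      rw [div_le_iff₀ (by positivity)]
      nlinarith [hV' t ht, mul_le_mul_of_nonneg_left hsqrt_le hκ,
        mul_le_mul_of_nonneg_left hε_le (mul_nonneg hμ.le hε.le)])
    t ht
  rw [gronwallBound_of_K_ne_0 (by linarith)] at hgronwall
  refine hgronwall.trans_eq ?_
  beta_reduce
  rw [show -(μ / 2) * (t - a) = -(μ / 2 * (t - a)) by ring]
  field_simp
  ring

lemma sqrt_le_of_deriv_right_le (hμ : 0 < μ) (hκ : 0 ≤ κ) (hVc : ContinuousOn V (Icc a b))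
    (hV0 : ∀ t ∈ Icc a b, 0 ≤ V t) (hV : ∀ t ∈ Ico a b, HasDerivWithinAt V (V' t) (Ici t) t)
    (hV' : ∀ t ∈ Ico a b, V' t ≤ -(μ * V t) + 2 * (κ * √(V t))) (ht : t ∈ Icc a b) :
    √(V t) ≤ √(V a) * Real.exp (-(μ / 2 * (t - a))) +
      (1 - Real.exp (-(μ / 2 * (t - a)))) * (2 / μ * κ) := by
  refine le_of_forall_pos_le_add fun ε hε => ?_
  have hreg := sqrt_add_sq_le_of_deriv_right_le hμ hκ hVc hV0 hV hV' ht hε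
  have hle : √(V t) ≤ √(V t + ε ^ 2) :=
    Real.sqrt_le_sqrt (le_add_of_nonneg_right (sq_nonneg ε))
  have hinit : √(V a + ε ^ 2) ≤ √(V a) + ε := by
    refine (Real.sqrt_le_left (by positivity)).2 ?_
    nlinarith [Real.sq_sqrt (hV0 a ⟨le_rfl, ht.1.trans ht.2⟩),
      mul_nonneg (Real.sqrt_nonneg (V a)) hε.le]
  linarith [mul_le_mul_of_nonneg_right hinit (Real.exp_pos (-(μ / 2 * (t - a)))).le]

end Decay

namespace IsLyapunov

variable {s d : ℕ} {Θ Θd : Set (Vec s)} {A P : Vec s → Mat d d} {P' : Vec s → Vec s →L[ℝ] Mat d d}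
  {μ : ℝ} (h : IsLyapunov Θ Θd A P P' μ)

include h

lemma continuousOn : ContinuousOn P Θ := fun θ hθ => (h.hasDeriv θ hθ).continuousWithinAt

lemma exists_le_inner (hΘ : IsCompact Θ) :
    ∃ c > 0, ∀ θ ∈ Θ, ∀ x : Vec d, c * ‖x‖ ^ 2 ≤ inner ℝ x (P θ x) := by
  have hcont : ContinuousOn (fun z : Vec s × Vec d => inner ℝ z.2 (P z.1 z.2))
      (Θ ×ˢ Metric.sphere (0 : Vec d) 1) :=
    continuousOn_snd.inner
      ((h.continuousOn.comp continuousOn_fst fun z hz => hz.1).clm_apply continuousOn_snd)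
  obtain ⟨c, hc, hmin⟩ := (hΘ.prod (isCompact_sphere _ _)).exists_forall_le' hcont (a := 0)
    fun z hz => h.pos z.1 hz.1 z.2 (Metric.ne_of_mem_sphere hz.2 one_ne_zero)
  refine ⟨c, hc, fun θ hθ x => ?_⟩
  rcases eq_or_ne x 0 with rfl | hx
  · simp
  have hunit := hmin (θ, ‖x‖⁻¹ • x) ⟨hθ, by simp [norm_smul, hx]⟩
  simp only [map_smul, real_inner_smul_left, real_inner_smul_right] at hunit
  have : 0 < ‖x‖ := norm_pos_iff.2 hx
  calc c * ‖x‖ ^ 2 ≤ (‖x‖⁻¹ * (‖x‖⁻¹ * inner ℝ x (P θ x))) * ‖x‖ ^ 2 :=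
        mul_le_mul_of_nonneg_right hunit (sq_nonneg _)
    _ = inner ℝ x (P θ x) := by field_simp

lemma lamMin_pos (hΘ : IsCompact Θ) (hne : Θ.Nonempty) (hd : 0 < d) : 0 < lamMin Θ P := by
  obtain ⟨c, hc, hlow⟩ := h.exists_le_inner hΘ
  obtain ⟨θ, hθ⟩ := hne
  obtain ⟨lam, hlam⟩ := exists_mem_spectrum_of_tr_eq hd (h.symm θ hθ)
  refine hc.trans_le (le_csInf ⟨lam, θ, hθ, hlam⟩ ?_)
  rintro _ ⟨θ', hθ', hlam'⟩
  exact le_of_mem_spectrum_of_forall_inner_ge (hlow θ' hθ') hlam'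

lemma lamMin_mul_sq_le (hΘ : IsCompact Θ) {θ : Vec s} (hθ : θ ∈ Θ) (x : Vec d) :
    lamMin Θ P * ‖x‖ ^ 2 ≤ inner ℝ x (P θ x) := by
  obtain ⟨c, _, hlow⟩ := h.exists_le_inner hΘ
  have hbdd : BddBelow {c | ∃ θ ∈ Θ, c ∈ spectrum ℝ (P θ)} := by
    refine ⟨c, ?_⟩
    rintro _ ⟨θ', hθ', hlam'⟩
    exact le_of_mem_spectrum_of_forall_inner_ge (hlow θ' hθ') hlam'
  obtain ⟨lam, wt, hlam, hwt, hsum, hinner⟩ := exists_inner_eq_sum_spectrum (h.symm θ hθ) x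
  rw [hinner, ← hsum, Finset.mul_sum]
  exact Finset.sum_le_sum fun i _ =>
    mul_le_mul_of_nonneg_right (csInf_le hbdd ⟨θ, hθ, hlam i⟩) (hwt i)

lemma inner_le_lamMax_mul_sq (hΘ : IsCompact Θ) {θ : Vec s} (hθ : θ ∈ Θ) (x : Vec d) :
    inner ℝ x (P θ x) ≤ lamMax Θ P * ‖x‖ ^ 2 := by
  have hbdd : BddAbove {c | ∃ θ ∈ Θ, c ∈ spectrum ℝ (P θ)} := by
    refine ⟨maxNorm Θ P, ?_⟩
    rintro _ ⟨θ', hθ', hlam'⟩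
    exact (le_norm_of_mem_spectrum hlam').trans (norm_le_maxNorm hΘ h.continuousOn hθ')
  obtain ⟨lam, wt, hlam, hwt, hsum, hinner⟩ := exists_inner_eq_sum_spectrum (h.symm θ hθ) x
  rw [hinner, ← hsum, Finset.mul_sum]
  exact Finset.sum_le_sum fun i _ =>
    mul_le_mul_of_nonneg_right (le_csSup hbdd ⟨θ, hθ, hlam i⟩) (hwt i)

lemma lamMin_le_lamMax (hΘ : IsCompact Θ) (hne : Θ.Nonempty) (hd : 0 < d) :
    lamMin Θ P ≤ lamMax Θ P := by
  obtain ⟨θ, hθ⟩ := hne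
  have hunit := (h.lamMin_mul_sq_le hΘ hθ (EuclideanSpace.single ⟨0, hd⟩ 1)).trans
    (h.inner_le_lamMax_mul_sq hΘ hθ _)
  simpa using hunit

lemma sqrt_lamMin_mul_norm_le (hΘ : IsCompact Θ) (hlam : 0 ≤ lamMin Θ P) {θ : Vec s} (hθ : θ ∈ Θ)
    (x : Vec d) : √(lamMin Θ P) * ‖x‖ ≤ √(inner ℝ x (P θ x)) := by
  apply Real.le_sqrt_of_sq_le
  rw [mul_pow, Real.sq_sqrt hlam]
  exact h.lamMin_mul_sq_le hΘ hθ x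

lemma sqrt_inner_le (hΘ : IsCompact Θ) (hlam : 0 ≤ lamMax Θ P) {θ : Vec s} (hθ : θ ∈ Θ)
    (x : Vec d) : √(inner ℝ x (P θ x)) ≤ √(lamMax Θ P) * ‖x‖ := by
  refine (Real.sqrt_le_left (by positivity)).2 ?_
  rw [mul_pow, Real.sq_sqrt hlam]
  exact h.inner_le_lamMax_mul_sq hΘ hθ x

lemma inner_deriv_le {θ v : Vec s} (hθ : θ ∈ Θ) (hv : v ∈ Θd) (x w : Vec d) :
    inner ℝ x (P' θ v x + P θ (A θ x + w)) + inner ℝ (A θ x + w) (P θ x) ≤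
      -(μ * inner ℝ x (P θ x)) + 2 * (‖P θ w‖ * ‖x‖) := by
  have hlmi := ((ContinuousLinearMap.le_def _ _).1 (h.lmi θ hθ v hv)).inner_nonneg_right x
  have hadj : inner ℝ x (tr (A θ) (P θ x)) = inner ℝ (A θ x) (P θ x) :=
    ContinuousLinearMap.adjoint_inner_right (A θ) x (P θ x)
  have hsymm : inner ℝ w (P θ x) = inner ℝ x (P θ w) :=
    (isSymmetric_of_tr_eq (h.symm θ hθ) w x).symm.trans (real_inner_comm _ _)
  have hcs : inner ℝ x (P θ w) ≤ ‖P θ w‖ * ‖x‖ :=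
    (real_inner_le_norm _ _).trans_eq (mul_comm _ _)
  simp only [sub_apply, neg_apply, smul_apply, add_apply, ContinuousLinearMap.comp_apply,
    inner_sub_right, inner_neg_right, inner_add_right, real_inner_smul_right, hadj] at hlmi
  rw [map_add, inner_add_right, inner_add_right, inner_add_left, hsymm]
  linarith

variable {θ : ℝ → Vec s} {t₀ τ : ℝ} {x w : ℝ → Vec d}

lemma exists_hasDerivWithinAt_inner_le (hθ : θ ∈ Trajectories Θ Θd) {t : ℝ} (ht : 0 ≤ t)
    (hx : HasDerivWithinAt x (A (θ t) (x t) + w t) (Ici t) t) :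
    ∃ V', HasDerivWithinAt (fun t => inner ℝ (x t) (P (θ t) (x t))) V' (Ici t) t ∧
      V' ≤ -(μ * inner ℝ (x t) (P (θ t) (x t))) + 2 * (‖P (θ t) (w t)‖ * ‖x t‖) := by
  obtain ⟨θ', hθ'⟩ := hθ
  have hP : HasDerivWithinAt (fun t => P (θ t)) (P' (θ t) (θ' t)) (Ici t) t :=
    (h.hasDeriv (θ t) (hθ' t ht).1).comp_hasDerivWithinAt t
      ((hθ' t ht).2.2.mono (Ici_subset_Ici.2 ht)) fun r hr => (hθ' r (ht.trans hr)).1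
  exact ⟨_, hx.inner ℝ (hP.clm_apply hx), h.inner_deriv_le (hθ' t ht).1 (hθ' t ht).2.1 (x t) (w t)⟩

theorem norm_le (hΘ : IsCompact Θ) (hd : 0 < d) (hθ : θ ∈ Trajectories Θ Θd) (ht₀ : 0 ≤ t₀)
    (hx : ContinuousOn x (Icc t₀ τ))
    (hx' : ∀ t ∈ Ico t₀ τ, HasDerivWithinAt x (A (θ t) (x t) + w t) (Ici t) t) {c : ℝ}
    (hw : ∀ t ∈ Ico t₀ τ, ‖P (θ t) (w t)‖ ≤ c) (hc : 0 ≤ c) {t : ℝ} (ht : t ∈ Icc t₀ τ) :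
    ‖x t‖ ≤ √(lamMax Θ P / lamMin Θ P) * Real.exp (-(μ / 2 * (t - t₀))) * ‖x t₀‖ +
      (1 - Real.exp (-(μ / 2 * (t - t₀)))) * (2 / (μ * lamMin Θ P)) * c := by
  have hmem : ∀ t ∈ Icc t₀ τ, θ t ∈ Θ := fun t ht => Trajectories.mem hθ (ht₀.trans ht.1)
  have hne : Θ.Nonempty := ⟨θ t, hmem t ht⟩
  have hmin : 0 < lamMin Θ P := h.lamMin_pos hΘ hne hd
  have hmax : 0 ≤ lamMax Θ P := hmin.le.trans (h.lamMin_le_lamMax hΘ hne hd)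
  have hnorm : ∀ t ∈ Icc t₀ τ, ‖x t‖ ≤ √(inner ℝ (x t) (P (θ t) (x t))) / √(lamMin Θ P) := by
    intro t ht
    rw [le_div_iff₀' (Real.sqrt_pos.2 hmin)]
    exact h.sqrt_lamMin_mul_norm_le hΘ hmin.le (hmem t ht) _
  have hderiv := fun t (ht : t ∈ Ico t₀ τ) =>
    h.exists_hasDerivWithinAt_inner_le hθ (ht₀.trans ht.1) (hx' t ht)
  choose! V' hV' hV'_le using hderiv
  have hsqrt := sqrt_le_of_deriv_right_le h.mu_pos (div_nonneg hc (Real.sqrt_nonneg (lamMin Θ P)))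
    (hx.inner (((Trajectories.continuousOn_comp hθ h.continuousOn τ).mono
      (Icc_subset_Icc_left ht₀)).clm_apply hx))
    (fun t ht => le_trans (by positivity) (h.lamMin_mul_sq_le hΘ (hmem t ht) (x t))) hV'
    (fun t ht => by
      refine (hV'_le t ht).trans ?_
      rw [div_mul_eq_mul_div, ← mul_div_assoc']
      gcongr
      exacts [hw t ht, hnorm t (Ico_subset_Icc_self ht)]) ht
  have hinit := h.sqrt_inner_le hΘ hmax (hmem t₀ ⟨le_rfl, ht.1.trans ht.2⟩) (x t₀)
  calc ‖x t‖ ≤ √(inner ℝ (x t) (P (θ t) (x t))) / √(lamMin Θ P) := hnorm t ht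
    _ ≤ (√(lamMax Θ P) * ‖x t₀‖ * Real.exp (-(μ / 2 * (t - t₀))) +
          (1 - Real.exp (-(μ / 2 * (t - t₀)))) * (2 / μ * (c / √(lamMin Θ P)))) /
            √(lamMin Θ P) := by
        gcongr
        exact hsqrt.trans (by gcongr)
    _ = _ := by
        have := h.mu_pos
        rw [Real.sqrt_div hmax, add_div]
        congr 1
        · ring
        · rw [mul_div_assoc', mul_div_assoc', div_div, Real.mul_self_sqrt hmin.le]
          field_simp

end IsLyapunov

/-! ### Pseudo-inverses -/

section PseudoInverse

variable {k l q : ℕ}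

lemma exists_equiv_of_injective {M : Mat l l} (hM : Function.Injective M) :
    ∃ e : Vec l ≃L[ℝ] Vec l, (e : Mat l l) = M := by
  refine ⟨(LinearEquiv.ofInjectiveEndo (M : Vec l →ₗ[ℝ] Vec l) hM).toContinuousLinearEquiv, ?_⟩
  ext x : 1
  rfl

lemma injective_tr_comp_self {M : Mat k l} (hM : Function.Injective M) :
    Function.Injective (tr M ∘L M) := by
  rw [injective_iff_map_eq_zero]
  intro x hx
  have hinner : inner ℝ x ((tr M ∘L M) x) = inner ℝ (M x) (M x) :=
    ContinuousLinearMap.adjoint_inner_right M x (M x)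
  rw [hx, inner_zero_right] at hinner
  exact hM ((inner_self_eq_zero.1 hinner.symm).trans (map_zero M).symm)

lemma pinv_apply_self {M : Mat k l} (hM : Function.Injective M) (x : Vec l) :
    pinv M (M x) = x := by
  obtain ⟨e, he⟩ := exists_equiv_of_injective (injective_tr_comp_self hM)
  change (tr M ∘L M).inverse ((tr M ∘L M) x) = x
  rw [← he, ContinuousLinearMap.inverse_equiv]
  exact e.symm_apply_apply x

lemma pinv_apply_of_tr_comp_eq_zero {M : Mat k l} {N : Mat k q} (h : tr M ∘L N = 0) (x : Vec q) :
    pinv M (N x) = 0 := by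
  have hx : tr M (N x) = 0 := DFunLike.congr_fun h x
  simp [pinv, hx]

lemma continuous_tr : Continuous (tr : Mat k l → Mat l k) :=
  (ContinuousLinearMap.adjoint (𝕜 := ℝ) (E := Vec l) (F := Vec k)).continuous

lemma continuousOn_pinv {Z : Type*} [TopologicalSpace Z] {S : Set Z} {M : Z → Mat k l}
    (hM : ContinuousOn M S) (hinj : ∀ z ∈ S, Function.Injective (M z)) :
    ContinuousOn (fun z => pinv (M z)) S := by
  have htr : ContinuousOn (fun z => tr (M z)) S := continuous_tr.comp_continuousOn hM
  refine ContinuousOn.clm_comp (fun z hz => ?_) htr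
  obtain ⟨e, he⟩ := exists_equiv_of_injective (injective_tr_comp_self (hinj z hz))
  have hinv : ContinuousAt ContinuousLinearMap.inverse (tr (M z) ∘L M z) := by
    rw [← he]
    exact (contDiffAt_map_inverse (𝕜 := ℝ) (n := 0) e).continuousAt
  exact ContinuousAt.comp_continuousWithinAt (f := fun z => tr (M z) ∘L M z) hinv
    (htr.clm_comp hM z hz)

lemma tr_comp_eq_zero_symm {M : Mat k l} {N : Mat k q} (h : tr M ∘L N = 0) : tr N ∘L M = 0 := by
  have hadj : tr (tr M ∘L N) = tr N ∘L M := by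
    simp only [tr, ContinuousLinearMap.adjoint_comp, ContinuousLinearMap.adjoint_adjoint]
  rw [← hadj, h]
  exact map_zero _

end PseudoInverse

lemma continuousOn_of_norm_sub_le {E F : Type*} [SeminormedAddCommGroup E]
    [SeminormedAddCommGroup F] {D : Set E} {M : E → F} {L : ℝ}
    (h : ∀ x ∈ D, ∀ y ∈ D, ‖M x - M y‖ ≤ L * ‖x - y‖) : ContinuousOn M D :=
  (LipschitzOnWith.of_dist_le' (K := L) fun x hx y hy => by
    simpa only [dist_eq_norm] using h x hx y hy).continuousOn

/-! ### Supremum norms and gains -/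

section Gains

variable {s k l : ℕ} {J : Set ℝ} {x : ℝ → Vec k} {b t : ℝ}

lemma enorm_le_linf (ht : t ∈ J) : ‖x t‖ₑ ≤ linf J x :=
  le_iSup₂ (f := fun t (_ : t ∈ J) => ‖x t‖ₑ) t ht

lemma linf_le_ofReal (h : ∀ t ∈ J, ‖x t‖ ≤ b) : linf J x ≤ ENNReal.ofReal b := by
  refine iSup₂_le fun t ht => ?_
  rw [← ofReal_norm]
  exact ENNReal.ofReal_le_ofReal (h t ht)

lemma norm_le_of_linf_le (hb : 0 ≤ b) (h : linf J x ≤ ENNReal.ofReal b) (ht : t ∈ J) :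
    ‖x t‖ ≤ b := by
  have hxt := (enorm_le_linf ht).trans h
  rw [← ofReal_norm] at hxt
  exact (ENNReal.ofReal_le_ofReal_iff hb).1 hxt

lemma IOMap.IsPPGBound.norm_le {G : IOMap s k l} {adm : Set (ℝ → Vec s)} {γ : ℝ}
    (hG : G.IsPPGBound adm γ) {θ : ℝ → Vec s} (hθ : θ ∈ adm) {τ : ℝ} (hτ : 0 ≤ τ) {u : ℝ → Vec k}
    (hu : Measurable u) {y : ℝ → Vec l} (hy : G (Icc 0 τ) θ u y)
    (hb : ∀ t ∈ Icc 0 τ, ‖u t‖ ≤ b) (ht : t ∈ Icc 0 τ) : ‖y t‖ ≤ γ * b := by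
  have hb0 : 0 ≤ b := (norm_nonneg _).trans (hb t ht)
  refine norm_le_of_linf_le (mul_nonneg hG.1.le hb0) ((hG.2 θ hθ τ hτ u hu y hy).trans ?_) ht
  rw [ENNReal.ofReal_mul hG.1.le]
  gcongr
  exact linf_le_ofReal hb

end Gains

/-! ### Constants of the control problem -/

namespace Setup

variable {n m p s nH nF : ℕ} {S : Setup n m p s nH nF}

lemma isCompact_Θ : IsCompact S.Θ := isCompact_box _ _

lemma mem_Θ {θ : ℝ → Vec s} (hθ : θ ∈ S.adm) {t : ℝ} (ht : 0 ≤ t) : θ t ∈ S.Θ :=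
  Trajectories.mem hθ ht

lemma maxωI_nonneg : 0 ≤ S.maxωI := maxNorm_nonneg _ _
lemma bB_nonneg : 0 ≤ S.bB := maxNorm_nonneg _ _
lemma bBd_nonneg : 0 ≤ S.bBd := maxNorm_nonneg _ _
lemma bBud_nonneg : 0 ≤ S.bBud := maxNorm_nonneg _ _
lemma bKx_nonneg : 0 ≤ S.bKx := maxNorm_nonneg _ _

/-- The lumped uncertainty `f̄(t, x) = f(t, x) + B(θ)(ω - I)Kx(θ)x` of the paper, whose components
along `B(θ)` and `Bu(θ)` are `f₁` and `f₂`. -/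
noncomputable def fbar (S : Setup n m p s nH nF) (f : ℝ → Vec n → Vec n) (θ : ℝ → Vec s) (t : ℝ)
    (x : Vec n) : Vec n :=
  f t x + S.B (θ t) (S.ω (S.Kx (θ t) x) - S.Kx (θ t) x)

namespace Assumptions

variable (hS : S.Assumptions)

include hS

lemma isCompact_Ω : IsCompact S.Ω := by
  obtain ⟨V, hV, hΩ⟩ := hS.Ω_polytope
  rw [hΩ]
  exact hV.isCompact_convexHull (𝕜 := ℝ)

lemma B_cont : ContinuousOn S.B S.Θ := continuousOn_of_norm_sub_le hS.B_lip
lemma Bd_cont : ContinuousOn S.Bd S.Θ := continuousOn_of_norm_sub_le hS.Bd_lip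
lemma Kx_cont : ContinuousOn S.Kx S.Θ := continuousOn_of_norm_sub_le hS.Kx_lip
lemma Am_cont : ContinuousOn S.Am S.Θ := hS.A_cont.add (hS.B_cont.clm_comp hS.Kx_cont)

lemma m_le_n {θ : Vec s} (hθ : θ ∈ S.Θ) : m ≤ n := by
  simpa using LinearMap.finrank_le_finrank_of_injective (f := (S.B θ : Vec m →ₗ[ℝ] Vec n))
    (hS.B_inj θ hθ)

lemma Bu_inj (θ : Vec s) (hθ : θ ∈ S.Θ) : Function.Injective (S.Bu θ) := by
  have hmn := hS.m_le_n hθ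
  let BBu : Vec m × Vec (n - m) →ₗ[ℝ] Vec n :=
    LinearMap.coprod (S.B θ : Vec m →ₗ[ℝ] Vec n) (S.Bu θ : Vec (n - m) →ₗ[ℝ] Vec n)
  have hsurj : Function.Surjective BBu := by
    intro z
    obtain ⟨v, w, hz⟩ := hS.Bbar_rank θ hθ z
    exact ⟨(v, w), by simpa [BBu] using hz⟩
  have hinj : Function.Injective BBu :=
    (LinearMap.injective_iff_surjective_of_finrank_eq_finrank (by simp; omega)).2 hsurj
  intro w₁ w₂ hw
  have hw' : BBu (0, w₁) = BBu (0, w₂) := by simpa [BBu] using hw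
  simpa using hinj hw'

lemma Bud_cont : ContinuousOn S.Bud S.Θ := continuousOn_pinv hS.Bu_cont hS.Bu_inj

lemma Bd_decomp {θ : Vec s} (hθ : θ ∈ S.Θ) (v : Vec m) (w : Vec (n - m)) :
    S.Bd θ (S.B θ v + S.Bu θ w) = v := by
  rw [map_add, Bd, pinv_apply_self (hS.B_inj θ hθ),
    pinv_apply_of_tr_comp_eq_zero (hS.B_orth θ hθ), add_zero]

lemma Bud_decomp {θ : Vec s} (hθ : θ ∈ S.Θ) (v : Vec m) (w : Vec (n - m)) :
    S.Bud θ (S.B θ v + S.Bu θ w) = w := by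
  rw [map_add, Bud, pinv_apply_self (hS.Bu_inj θ hθ),
    pinv_apply_of_tr_comp_eq_zero (tr_comp_eq_zero_symm (hS.B_orth θ hθ)), zero_add]

lemma Bd_B {θ : Vec s} (hθ : θ ∈ S.Θ) (v : Vec m) : S.Bd θ (S.B θ v) = v := by
  simpa using hS.Bd_decomp hθ v 0

lemma Bud_B {θ : Vec s} (hθ : θ ∈ S.Θ) (v : Vec m) : S.Bud θ (S.B θ v) = 0 := by
  simpa using hS.Bud_decomp hθ v 0

lemma B_Bd_add_Bu_Bud {θ : Vec s} (hθ : θ ∈ S.Θ) (z : Vec n) :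
    S.B θ (S.Bd θ z) + S.Bu θ (S.Bud θ z) = z := by
  obtain ⟨v, w, rfl⟩ := hS.Bbar_rank θ hθ z
  rw [hS.Bd_decomp hθ, hS.Bud_decomp hθ]

lemma norm_B_le {θ : Vec s} (hθ : θ ∈ S.Θ) : ‖S.B θ‖ ≤ S.bB :=
  norm_le_maxNorm isCompact_Θ hS.B_cont hθ

lemma norm_Bd_le {θ : Vec s} (hθ : θ ∈ S.Θ) : ‖S.Bd θ‖ ≤ S.bBd :=
  norm_le_maxNorm isCompact_Θ hS.Bd_cont hθ

lemma norm_Bud_le {θ : Vec s} (hθ : θ ∈ S.Θ) : ‖S.Bud θ‖ ≤ S.bBud :=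
  norm_le_maxNorm isCompact_Θ hS.Bud_cont hθ

lemma norm_Kx_le {θ : Vec s} (hθ : θ ∈ S.Θ) : ‖S.Kx θ‖ ≤ S.bKx :=
  norm_le_maxNorm isCompact_Θ hS.Kx_cont hθ

lemma norm_Kr_le {θ : Vec s} (hθ : θ ∈ S.Θ) : ‖S.Kr θ‖ ≤ S.bKr :=
  norm_le_maxNorm isCompact_Θ hS.Kr_cont hθ

lemma norm_C_le {θ : Vec s} (hθ : θ ∈ S.Θ) : ‖S.C θ‖ ≤ S.bC :=
  norm_le_maxNorm isCompact_Θ hS.C_cont hθ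

lemma norm_Am_le {θ : Vec s} (hθ : θ ∈ S.Θ) : ‖S.Am θ‖ ≤ S.bAm :=
  norm_le_maxNorm isCompact_Θ hS.Am_cont hθ

lemma norm_ω_le : ‖S.ω‖ ≤ S.maxω :=
  norm_le_maxNorm hS.isCompact_Ω (M := fun w : Mat m m => w) continuousOn_id hS.ω_mem

lemma norm_ωI_le : ‖S.ω - ContinuousLinearMap.id ℝ (Vec m)‖ ≤ S.maxωI :=
  norm_le_maxNorm hS.isCompact_Ω
    (M := fun w : Mat m m => w - ContinuousLinearMap.id ℝ (Vec m)) (by fun_prop) hS.ω_mem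

lemma continuousOn_ωI_Kx :
    ContinuousOn (fun z : Mat m m × Vec s => (z.1 - ContinuousLinearMap.id ℝ (Vec m)) ∘L S.Kx z.2)
      (S.Ω ×ˢ S.Θ) :=
  ContinuousOn.clm_comp (by fun_prop) (hS.Kx_cont.comp continuousOn_snd fun z hz => hz.2)

lemma norm_ωI_Kx_le {θ : Vec s} (hθ : θ ∈ S.Θ) :
    ‖(S.ω - ContinuousLinearMap.id ℝ (Vec m)) ∘L S.Kx θ‖ ≤ maxNorm (S.Ω ×ˢ S.Θ)
      (fun z => (z.1 - ContinuousLinearMap.id ℝ (Vec m)) ∘L S.Kx z.2) :=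
  norm_le_maxNorm (z := (S.ω, θ)) (hS.isCompact_Ω.prod isCompact_Θ) hS.continuousOn_ωI_Kx
    ⟨hS.ω_mem, hθ⟩

lemma norm_B_ωI_Kx_le {θ : Vec s} (hθ : θ ∈ S.Θ) :
    ‖S.B θ ∘L (S.ω - ContinuousLinearMap.id ℝ (Vec m)) ∘L S.Kx θ‖ ≤ maxNorm (S.Ω ×ˢ S.Θ)
      (fun z => S.B z.2 ∘L (z.1 - ContinuousLinearMap.id ℝ (Vec m)) ∘L S.Kx z.2) :=
  norm_le_maxNorm (z := (S.ω, θ)) (hS.isCompact_Ω.prod isCompact_Θ)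
    ((hS.B_cont.comp continuousOn_snd fun z (hz : z ∈ S.Ω ×ˢ S.Θ) => hz.2).clm_comp
      hS.continuousOn_ωI_Kx) ⟨hS.ω_mem, hθ⟩

lemma norm_r_le {t : ℝ} (ht : 0 ≤ t) : ‖S.r t‖ ≤ S.rNorm := by
  simpa [rNorm] using ENNReal.toReal_mono hS.r_bdd (enorm_le_linf (x := S.r) (mem_Ici.2 ht))

lemma rate_nonneg {θ : ℝ → Vec s} (hθ : θ ∈ S.adm) : 0 ≤ S.bθ' := by
  obtain ⟨θ', hθ'⟩ := hθ
  exact (norm_nonneg _).trans (hS.rate_bound _ (hθ' 0 le_rfl).2.1)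

lemma Lf1_nonneg {δ : ℝ} (hδ : 0 < δ) : 0 ≤ S.Lf1 δ :=
  add_nonneg (mul_nonneg (hS.Lf_pos δ hδ).le bBd_nonneg) (maxNorm_nonneg _ _)

lemma Lf2_nonneg {δ : ℝ} (hδ : 0 < δ) : 0 ≤ S.Lf2 δ :=
  mul_nonneg (hS.Lf_pos δ hδ).le bBud_nonneg

lemma Lfbar_nonneg {δ : ℝ} (hδ : 0 < δ) : 0 ≤ S.Lfbar δ :=
  add_nonneg (hS.Lf_pos δ hδ).le (maxNorm_nonneg _ _)

lemma norm_B_ωI_apply_le {θ : Vec s} (hθ : θ ∈ S.Θ) (v : Vec m) :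
    ‖S.B θ (S.ω v - v)‖ ≤ S.bB * S.maxωI * ‖v‖ := by
  have hv : ‖S.ω v - v‖ ≤ S.maxωI * ‖v‖ :=
    ContinuousLinearMap.le_of_opNorm_le (S.ω - ContinuousLinearMap.id ℝ (Vec m)) hS.norm_ωI_le v
  exact (ContinuousLinearMap.le_of_opNorm_le_of_le _ (hS.norm_B_le hθ) hv).trans_eq
    (mul_assoc _ _ _).symm

end Assumptions

/-! ### Bounds on the uncertainty -/

section Fbar

variable {f : ℝ → Vec n → Vec n} {θ : ℝ → Vec s}

lemma fbar_zero (t : ℝ) : S.fbar f θ t 0 = f t 0 := by simp [fbar]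

lemma fbar_sub (t : ℝ) (x₁ x₂ : Vec n) : S.fbar f θ t x₁ - S.fbar f θ t x₂ =
    (f t x₁ - f t x₂) +
      S.B (θ t) (((S.ω - ContinuousLinearMap.id ℝ (Vec m)) ∘L S.Kx (θ t)) (x₁ - x₂)) := by
  simp only [fbar, ContinuousLinearMap.comp_apply, sub_apply, ContinuousLinearMap.id_apply,
    map_sub]
  abel

lemma fbar_time_sub (t₁ t₂ : ℝ) (x : Vec n) : S.fbar f θ t₁ x - S.fbar f θ t₂ x =
    (f t₁ x - f t₂ x) + ((S.B (θ t₁) - S.B (θ t₂))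
        ((S.ω - ContinuousLinearMap.id ℝ (Vec m)) (S.Kx (θ t₁) x)) +
      S.B (θ t₂) ((S.ω - ContinuousLinearMap.id ℝ (Vec m)) ((S.Kx (θ t₁) - S.Kx (θ t₂)) x))) := by
  simp only [fbar, sub_apply, ContinuousLinearMap.id_apply, map_sub]
  abel

end Fbar

namespace Uncertainty

variable {f : ℝ → Vec n → Vec n} {θ : ℝ → Vec s} (hf : S.Uncertainty f)

include hf

lemma bf0_nonneg : 0 ≤ S.bf0 := (norm_nonneg _).trans (hf.zero_bound 0 le_rfl)

lemma bf10_nonneg : 0 ≤ S.bf10 := mul_nonneg bBd_nonneg hf.bf0_nonneg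

lemma bf20_nonneg : 0 ≤ S.bf20 := mul_nonneg bBud_nonneg hf.bf0_nonneg

variable (hS : S.Assumptions)

include hS

lemma norm_le {δ t : ℝ} (hδ : 0 < δ) (ht : 0 ≤ t) {x : Vec n} (hx : ‖x‖ ≤ δ) :
    ‖f t x‖ ≤ S.Lf δ * δ + S.bf0 := by
  have hlip := hf.lip_x δ hδ t ht x 0 hx (by simpa using hδ.le)
  rw [sub_zero] at hlip
  linarith [norm_le_norm_sub_add (f t x) (f t 0), hf.zero_bound t ht,
    mul_le_mul_of_nonneg_left hx (hS.Lf_pos δ hδ).le]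

variable (hθ : θ ∈ S.adm)

include hθ

lemma norm_Bd_fbar_sub_le {δ t : ℝ} (hδ : 0 < δ) (ht : 0 ≤ t) {x₁ x₂ : Vec n}
    (h₁ : ‖x₁‖ ≤ δ) (h₂ : ‖x₂‖ ≤ δ) :
    ‖S.Bd (θ t) (S.fbar f θ t x₁ - S.fbar f θ t x₂)‖ ≤ S.Lf1 δ * ‖x₁ - x₂‖ := by
  rw [fbar_sub, map_add, hS.Bd_B (mem_Θ hθ ht), Lf1, add_mul]
  refine (norm_add_le _ _).trans (add_le_add ?_
    (ContinuousLinearMap.le_of_opNorm_le _ (hS.norm_ωI_Kx_le (mem_Θ hθ ht)) _))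
  refine (ContinuousLinearMap.le_of_opNorm_le_of_le _ (hS.norm_Bd_le (mem_Θ hθ ht))
    (hf.lip_x δ hδ t ht _ _ h₁ h₂)).trans_eq ?_
  ring

lemma norm_Bud_fbar_sub_le {δ t : ℝ} (hδ : 0 < δ) (ht : 0 ≤ t) {x₁ x₂ : Vec n}
    (h₁ : ‖x₁‖ ≤ δ) (h₂ : ‖x₂‖ ≤ δ) :
    ‖S.Bud (θ t) (S.fbar f θ t x₁ - S.fbar f θ t x₂)‖ ≤ S.Lf2 δ * ‖x₁ - x₂‖ := by
  rw [fbar_sub, map_add, hS.Bud_B (mem_Θ hθ ht), add_zero, Lf2]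
  refine (ContinuousLinearMap.le_of_opNorm_le_of_le _ (hS.norm_Bud_le (mem_Θ hθ ht))
    (hf.lip_x δ hδ t ht _ _ h₁ h₂)).trans_eq ?_
  ring

lemma norm_fbar_sub_le {δ t : ℝ} (hδ : 0 < δ) (ht : 0 ≤ t) {x₁ x₂ : Vec n}
    (h₁ : ‖x₁‖ ≤ δ) (h₂ : ‖x₂‖ ≤ δ) :
    ‖S.fbar f θ t x₁ - S.fbar f θ t x₂‖ ≤ S.Lfbar δ * ‖x₁ - x₂‖ := by
  rw [fbar_sub, Lfbar, add_mul]
  exact (norm_add_le _ _).trans (add_le_add (hf.lip_x δ hδ t ht _ _ h₁ h₂)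
    (ContinuousLinearMap.le_of_opNorm_le _ (hS.norm_B_ωI_Kx_le (mem_Θ hθ ht)) _))

lemma norm_Bd_fbar_le {δ t : ℝ} (hδ : 0 < δ) (ht : 0 ≤ t) {x : Vec n} (hx : ‖x‖ ≤ δ) :
    ‖S.Bd (θ t) (S.fbar f θ t x)‖ ≤ S.Lf1 δ * ‖x‖ + S.bf10 := by
  have hsub := hf.norm_Bd_fbar_sub_le hS hθ hδ ht hx (x₂ := 0) (by simpa using hδ.le)
  have hzero : ‖S.Bd (θ t) (f t 0)‖ ≤ S.bf10 :=
    ContinuousLinearMap.le_of_opNorm_le_of_le _ (hS.norm_Bd_le (mem_Θ hθ ht)) (hf.zero_bound t ht)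
  rw [fbar_zero, sub_zero, map_sub] at hsub
  exact (norm_le_norm_sub_add _ _).trans (add_le_add hsub hzero)

lemma norm_Bud_fbar_le {δ t : ℝ} (hδ : 0 < δ) (ht : 0 ≤ t) {x : Vec n} (hx : ‖x‖ ≤ δ) :
    ‖S.Bud (θ t) (S.fbar f θ t x)‖ ≤ S.Lf2 δ * ‖x‖ + S.bf20 := by
  have hsub := hf.norm_Bud_fbar_sub_le hS hθ hδ ht hx (x₂ := 0) (by simpa using hδ.le)
  have hzero : ‖S.Bud (θ t) (f t 0)‖ ≤ S.bf20 :=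
    ContinuousLinearMap.le_of_opNorm_le_of_le _ (hS.norm_Bud_le (mem_Θ hθ ht)) (hf.zero_bound t ht)
  rw [fbar_zero, sub_zero, map_sub] at hsub
  exact (norm_le_norm_sub_add _ _).trans (add_le_add hsub hzero)

lemma norm_fbar_le {δ t : ℝ} (hδ : 0 < δ) (ht : 0 ≤ t) {x : Vec n} (hx : ‖x‖ ≤ δ) :
    ‖S.fbar f θ t x‖ ≤ S.Lf δ * δ + S.bf0 + S.bB * S.maxωI * S.bKx * δ := by
  refine (norm_add_le _ _).trans (add_le_add (hf.norm_le hS hδ ht hx) ?_)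
  calc ‖S.B (θ t) (S.ω (S.Kx (θ t) x) - S.Kx (θ t) x)‖
      ≤ S.bB * S.maxωI * ‖S.Kx (θ t) x‖ := hS.norm_B_ωI_apply_le (mem_Θ hθ ht) _
    _ ≤ S.bB * S.maxωI * (S.bKx * δ) :=
        mul_le_mul_of_nonneg_left
          (ContinuousLinearMap.le_of_opNorm_le_of_le _ (hS.norm_Kx_le (mem_Θ hθ ht)) hx)
          (mul_nonneg bB_nonneg maxωI_nonneg)
    _ = S.bB * S.maxωI * S.bKx * δ := (mul_assoc _ _ _).symm

lemma norm_fbar_time_sub_le {δ t₁ t₂ : ℝ} (h₁ : 0 ≤ t₁) (h₂ : 0 ≤ t₂) {x : Vec n}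
    (hx : ‖x‖ ≤ δ) : ‖S.fbar f θ t₁ x - S.fbar f θ t₂ x‖ ≤ S.lfbar δ * |t₁ - t₂| := by
  have hθ_sub : ‖θ t₁ - θ t₂‖ ≤ S.bθ' * |t₁ - t₂| :=
    Trajectories.norm_sub_le hS.rate_bound hθ h₂ h₁
  have hB_sub : ‖(S.B (θ t₁) - S.B (θ t₂))
      ((S.ω - ContinuousLinearMap.id ℝ (Vec m)) (S.Kx (θ t₁) x))‖ ≤
      S.LB * (S.bθ' * |t₁ - t₂|) * (S.maxωI * (S.bKx * δ)) :=
    ContinuousLinearMap.le_of_opNorm_le_of_le _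
      ((hS.B_lip _ (mem_Θ hθ h₁) _ (mem_Θ hθ h₂)).trans
        (mul_le_mul_of_nonneg_left hθ_sub hS.LB_pos.le))
      (ContinuousLinearMap.le_of_opNorm_le_of_le _ hS.norm_ωI_le
        (ContinuousLinearMap.le_of_opNorm_le_of_le _ (hS.norm_Kx_le (mem_Θ hθ h₁)) hx))
  have hKx_sub : ‖S.B (θ t₂) ((S.ω - ContinuousLinearMap.id ℝ (Vec m))
      ((S.Kx (θ t₁) - S.Kx (θ t₂)) x))‖ ≤
      S.bB * (S.maxωI * (S.LKx * (S.bθ' * |t₁ - t₂|) * δ)) :=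
    ContinuousLinearMap.le_of_opNorm_le_of_le _ (hS.norm_B_le (mem_Θ hθ h₂))
      (ContinuousLinearMap.le_of_opNorm_le_of_le _ hS.norm_ωI_le
        (ContinuousLinearMap.le_of_opNorm_le_of_le _
          ((hS.Kx_lip _ (mem_Θ hθ h₁) _ (mem_Θ hθ h₂)).trans
            (mul_le_mul_of_nonneg_left hθ_sub hS.LKx_pos.le)) hx))
  rw [fbar_time_sub]
  refine (norm_add_le _ _).trans ((add_le_add (hf.lip_t x t₁ t₂ h₁ h₂)
    ((norm_add_le _ _).trans (add_le_add hB_sub hKx_sub))).trans_eq ?_)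
  rw [lfbar]; ring

lemma continuousOn_fbar {τ : ℝ} {x : ℝ → Vec n} (hx : ContinuousOn x (Icc 0 τ)) :
    ContinuousOn (fun t => S.fbar f θ t (x t)) (Icc 0 τ) := by
  obtain ⟨c, hc⟩ := isCompact_Icc.exists_bound_of_continuousOn hx
  have hδ : 0 < max c 1 := lt_max_of_lt_right one_pos
  have hjoint : ContinuousOn (fun z : ℝ × Vec n => S.fbar f θ z.1 z.2)
      (Icc 0 τ ×ˢ Metric.closedBall 0 (max c 1)) := by
    refine continuousOn_prod_of_continuousOn_lipschitzOnWith' _ (S.Lfbar (max c 1)).toNNReal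
      (fun t ht => LipschitzOnWith.of_dist_le' fun y hy z hz => ?_)
      (fun y hy => continuousOn_of_norm_sub_le fun t₁ h₁ t₂ h₂ =>
        hf.norm_fbar_time_sub_le hS hθ h₁.1 h₂.1 (mem_closedBall_zero_iff.1 hy))
    rw [dist_eq_norm, dist_eq_norm]
    exact hf.norm_fbar_sub_le hS hθ hδ ht.1 (mem_closedBall_zero_iff.1 hy)
      (mem_closedBall_zero_iff.1 hz)
  exact hjoint.comp (continuousOn_id.prodMk hx) fun t ht =>
    ⟨ht, mem_closedBall_zero_iff.2 ((hc t ht).trans (le_max_left _ _))⟩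

end Uncertainty

end Setup

/-! ### Bounded inputs of Hurwitz systems -/

section ScalarEquation

lemma norm_one_add_mul_le (z : ℂ) (h : ℝ) :
    ‖1 + z * h‖ ≤ 1 + h * z.re + h ^ 2 * ‖z‖ ^ 2 / 2 := by
  have norm_sq : ‖z‖ ^ 2 = z.re ^ 2 + z.im ^ 2 := by
    rw [← Complex.normSq_eq_norm_sq, Complex.normSq_apply]; ring
  have norm_one_add_sq : ‖1 + z * h‖ ^ 2 = 1 + 2 * (h * z.re) + h ^ 2 * ‖z‖ ^ 2 := by
    rw [norm_sq, ← Complex.normSq_eq_norm_sq, Complex.normSq_apply]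
    simp only [Complex.add_re, Complex.one_re, Complex.re_mul_ofReal, Complex.add_im,
      Complex.one_im, Complex.im_mul_ofReal]
    ring
  refine (abs_le_of_sq_le_sq' ?_ ?_).2
  · rw [norm_one_add_sq]
    nlinarith [sq_nonneg (h * z.re + h ^ 2 * ‖z‖ ^ 2 / 2)]
  · rw [norm_sq]
    nlinarith [sq_nonneg (1 + h * z.re), sq_nonneg (h * z.im)]

variable {V : Type*} [NormedAddCommGroup V] [NormedSpace ℂ V] {w h : ℝ → V} {lam : ℂ} {b τ : ℝ}

lemma norm_le_of_integral_increment [CompleteSpace V] {x y q : ℝ} (hxy : x ≤ y)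
    (integrable : IntervalIntegrable (fun ξ => lam • w ξ + h ξ) volume x y)
    (hinc : w y - w x = ∫ ξ in x..y, (lam • w ξ + h ξ))
    (hw : ∀ ξ ∈ Icc x y, ‖w ξ - w x‖ ≤ q) (hh : ∀ ξ ∈ Icc x y, ‖h ξ‖ ≤ b) :
    ‖w y‖ ≤ (1 + (y - x) * lam.re + (y - x) ^ 2 * ‖lam‖ ^ 2 / 2) * ‖w x‖ +
      (‖lam‖ * q + b) * (y - x) := by
  have remainder_le :
      ‖∫ ξ in x..y, ((lam • w ξ + h ξ) - lam • w x)‖ ≤ (‖lam‖ * q + b) * (y - x) := by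
    rw [← abs_of_nonneg (sub_nonneg.2 hxy)]
    refine intervalIntegral.norm_integral_le_of_norm_le_const fun ξ hξ => ?_
    rw [uIoc_of_le hxy] at hξ
    rw [add_sub_right_comm, ← smul_sub]
    refine (norm_add_le _ _).trans (add_le_add ?_ (hh ξ (Ioc_subset_Icc_self hξ)))
    rw [norm_smul]
    exact mul_le_mul_of_nonneg_left (hw ξ (Ioc_subset_Icc_self hξ)) (norm_nonneg _)
  have expansion : w y = (1 + lam * ((y - x : ℝ) : ℂ)) • w x +
      ∫ ξ in x..y, ((lam • w ξ + h ξ) - lam • w x) := by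
    rw [intervalIntegral.integral_sub integrable intervalIntegrable_const, ← hinc,
      intervalIntegral.integral_const, add_smul, one_smul, mul_comm, mul_smul, Complex.coe_smul]
    abel
  rw [expansion]
  refine (norm_add_le _ _).trans (add_le_add ?_ remainder_le)
  rw [norm_smul]
  exact mul_le_mul_of_nonneg_right (norm_one_add_mul_le lam (y - x)) (norm_nonneg _)

lemma eventually_slope_norm_lt [CompleteSpace V] (hw : ContinuousOn w (Icc 0 τ))
    (hh : ∀ t ∈ Icc 0 τ, ‖h t‖ ≤ b)
    (integrable : ∀ t ∈ Icc 0 τ, IntervalIntegrable (fun ξ => lam • w ξ + h ξ) volume 0 t)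
    (hs : ∀ t ∈ Icc 0 τ, w t = ∫ ξ in (0 : ℝ)..t, (lam • w ξ + h ξ))
    {x r : ℝ} (hx : x ∈ Ico 0 τ) (hr : lam.re * ‖w x‖ + b < r) :
    ∀ᶠ y in 𝓝[>] x, (y - x)⁻¹ * (‖w y‖ - ‖w x‖) < r := by
  obtain ⟨η, hη, rfl⟩ : ∃ η > 0, r = η + (lam.re * ‖w x‖ + b) := ⟨_, sub_pos.2 hr, by ring⟩
  obtain ⟨q, hq, hlamq⟩ : ∃ q > 0, ‖lam‖ * q < η / 2 := by
    refine ⟨η / (2 * (‖lam‖ + 1)), by positivity, ?_⟩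
    rw [← mul_div_assoc, div_lt_div_iff₀ (by positivity) two_pos]
    nlinarith [norm_nonneg lam]
  have near : ∀ᶠ y in 𝓝[≥] x, ‖w y - w x‖ < q :=
    have hwx : ContinuousWithinAt w (Ici x) x :=
      (hw x ⟨hx.1, hx.2.le⟩).mono_of_mem_nhdsWithin
        (mem_of_superset (Icc_mem_nhdsGE hx.2) (Icc_subset_Icc_left hx.1))
    (tendsto_iff_norm_sub_tendsto_zero.1 hwx).eventually (gt_mem_nhds hq)
  obtain ⟨y₀, hy₀, hy₀q⟩ := mem_nhdsGE_iff_exists_Icc_subset.1 near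
  have quadratic_small : ∀ᶠ y in 𝓝[>] x, (y - x) * (‖lam‖ ^ 2 / 2 * ‖w x‖) < η / 2 := by
    have hc : Continuous fun y : ℝ => (y - x) * (‖lam‖ ^ 2 / 2 * ‖w x‖) := by fun_prop
    refine ((hc.tendsto x).mono_left nhdsWithin_le_nhds).eventually (gt_mem_nhds ?_)
    simpa using hη
  filter_upwards [quadratic_small, Ioc_mem_nhdsGT hx.2, Ioc_mem_nhdsGT (mem_Ioi.1 hy₀)]
    with y hyη hyτ hyy₀
  have hyx : 0 < y - x := sub_pos.2 hyτ.1
  have hx' : x ∈ Icc 0 τ := ⟨hx.1, hx.2.le⟩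
  have hy' : y ∈ Icc 0 τ := ⟨hx.1.trans hyτ.1.le, hyτ.2⟩
  have increment := norm_le_of_integral_increment hyτ.1.le
    ((integrable x hx').symm.trans (integrable y hy')) (by
      rw [hs y hy', hs x hx', intervalIntegral.integral_interval_sub_left (integrable y hy')
        (integrable x hx')])
    (fun ξ hξ => (hy₀q ⟨hξ.1, hξ.2.trans hyy₀.2⟩).le)
    (fun ξ hξ => hh ξ ⟨hx.1.trans hξ.1, hξ.2.trans hyτ.2⟩)
  rw [inv_mul_lt_iff₀ hyx]
  have := mul_lt_mul_of_pos_left hyη hyx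
  have := mul_lt_mul_of_pos_left hlamq hyx
  linarith

lemma norm_le_of_scalar_equation [CompleteSpace V] (hlam : lam.re < 0)
    (hw : ContinuousOn w (Icc 0 τ)) (hh : ∀ t ∈ Icc 0 τ, ‖h t‖ ≤ b)
    (hi : ∀ t ∈ Icc 0 τ, IntervalIntegrable h volume 0 t)
    (hs : ∀ t ∈ Icc 0 τ, w t = ∫ ξ in (0 : ℝ)..t, (lam • w ξ + h ξ))
    {t : ℝ} (ht : t ∈ Icc 0 τ) : ‖w t‖ ≤ b / -lam.re := by
  have integrable : ∀ t ∈ Icc 0 τ, IntervalIntegrable (fun ξ => lam • w ξ + h ξ) volume 0 t := by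
    refine fun t ht => .add (ContinuousOn.intervalIntegrable ?_) (hi t ht)
    rw [uIcc_of_le ht.1]
    exact (hw.mono (Icc_subset_Icc_right ht.2)).const_smul lam
  have hb : 0 ≤ b := (norm_nonneg _).trans (hh t ht)
  have hw0 : w 0 = 0 := by simpa using hs 0 ⟨le_rfl, ht.1.trans ht.2⟩
  have gronwall := le_gronwallBound_of_liminf_deriv_right_le
    (f' := fun t => lam.re * ‖w t‖ + b) hw.norm
    (fun x hx r hr => (eventually_slope_norm_lt hw hh integrable hs hx hr).frequently)
    (norm_le_zero_iff.2 hw0) (fun _ _ => le_rfl) t ht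
  simp only [gronwallBound_of_K_ne_0 hlam.ne, zero_mul, zero_add] at gronwall
  calc ‖w t‖ ≤ b / lam.re * (Real.exp (lam.re * (t - 0)) - 1) := gronwall
    _ = b / -lam.re * (1 - Real.exp (lam.re * (t - 0))) := by rw [div_neg]; ring
    _ ≤ b / -lam.re := mul_le_of_le_one_right (div_nonneg hb (neg_nonneg.2 hlam.le))
        (sub_le_self _ (Real.exp_pos _).le)

end ScalarEquation

section Hurwitz

variable {V : Type*} [NormedAddCommGroup V] [NormedSpace ℂ V]

/-- `z` solves `ż = L z + g`, `z(0) = 0` on `[0, τ]` with an input `g` bounded by one. A uniform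
bound on all such `z` is a finite peak-to-peak gain. -/
def IsUnitResponse (L : V →L[ℂ] V) (τ : ℝ) (z : ℝ → V) : Prop :=
  ContinuousOn z (Icc 0 τ) ∧ ∃ g : ℝ → V, (∀ t ∈ Icc 0 τ, ‖g t‖ ≤ 1) ∧
    (∀ t ∈ Icc 0 τ, IntervalIntegrable g volume 0 t) ∧
    ∀ t ∈ Icc 0 τ, z t = ∫ ξ in (0 : ℝ)..t, (L (z ξ) + g ξ)

variable [CompleteSpace V]

/-- If `Q` commutes with `L`, then `w = Q z` solves `ẇ = a w + ((L - a) Q z + Q g)`. -/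
lemma IsUnitResponse.norm_apply_le {L Q : V →L[ℂ] V} (hLQ : Commute L Q) {a : ℂ} (ha : a.re < 0)
    {τ c : ℝ} {z : ℝ → V} (hz : IsUnitResponse L τ z)
    (hc : ∀ t ∈ Icc 0 τ, ‖(L - algebraMap ℂ (V →L[ℂ] V) a) (Q (z t))‖ ≤ c) {t : ℝ}
    (ht : t ∈ Icc 0 τ) : ‖Q (z t)‖ ≤ (c + ‖Q‖) / -a.re := by
  obtain ⟨hzc, g, hg, hgi, hzs⟩ := hz
  have integrable_apply : ∀ N : V →L[ℂ] V, ∀ t ∈ Icc 0 τ,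
      IntervalIntegrable (fun ξ => N (z ξ)) volume 0 t := by
    refine fun N t ht => ContinuousOn.intervalIntegrable ?_
    rw [uIcc_of_le ht.1]
    exact N.continuous.comp_continuousOn (hzc.mono (Icc_subset_Icc_right ht.2))
  refine norm_le_of_scalar_equation (w := fun t => Q (z t))
    (h := fun ξ => (L - algebraMap ℂ (V →L[ℂ] V) a) (Q (z ξ)) + Q (g ξ)) ha
    (Q.continuous.comp_continuousOn hzc) (fun t ht => ?_) (fun t ht => ?_) (fun t ht => ?_) ht
  · exact (norm_add_le _ _).trans (add_le_add (hc t ht)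
      ((Q.le_opNorm_of_le (hg t ht)).trans_eq (mul_one _)))
  · exact (integrable_apply ((L - algebraMap ℂ (V →L[ℂ] V) a) ∘L Q) t ht).add
      ⟨Q.integrable_comp (hgi t ht).1, Q.integrable_comp (hgi t ht).2⟩
  · nth_rewrite 1 [hzs t ht]
    rw [← Q.intervalIntegral_comp_comm ((integrable_apply L t ht).add (hgi t ht))]
    refine intervalIntegral.integral_congr fun ξ _ => ?_
    have commute_apply : Q (L (z ξ)) = L (Q (z ξ)) := (DFunLike.congr_fun hLQ.eq (z ξ)).symm
    simp only [map_add, commute_apply, sub_apply, Algebra.algebraMap_eq_smul_one, smul_apply,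
      one_apply_eq_self]
    abel

lemma exists_bound_of_bound_prod (L : V →L[ℂ] V) (Λ : List ℂ) (hΛ : ∀ z ∈ Λ, z.re < 0) (c : ℝ)
    (hc : ∀ τ z, IsUnitResponse L τ z → ∀ t ∈ Icc 0 τ,
      ‖(Λ.map fun a => L - algebraMap ℂ (V →L[ℂ] V) a).prod (z t)‖ ≤ c) :
    ∃ c', ∀ τ z, IsUnitResponse L τ z → ∀ t ∈ Icc 0 τ, ‖z t‖ ≤ c' := by
  induction Λ generalizing c with
  | nil => exact ⟨c, by simpa using hc⟩
  | cons a Λ ih =>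
    have hcomm : Commute L (Λ.map fun a => L - algebraMap ℂ (V →L[ℂ] V) a).prod := by
      refine Commute.list_prod_right _ _ fun y hy => ?_
      obtain ⟨d, -, rfl⟩ := List.mem_map.1 hy
      exact (Commute.refl L).sub_right (Algebra.commutes d L).symm
    simp only [List.map_cons, List.prod_cons, mul_apply_eq_comp] at hc
    exact ih (fun z hz => hΛ z (List.mem_cons_of_mem _ hz)) _ fun τ z hz t ht =>
      hz.norm_apply_le hcomm (hΛ a List.mem_cons_self) (hc τ z hz) ht

lemma exists_bound_of_aeval_eq_zero (L : V →L[ℂ] V) {q : Polynomial ℂ}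
    (hq : q.Monic) (hroots : ∀ z ∈ q.roots, z.re < 0) (hL : Polynomial.aeval L q = 0) :
    ∃ c, ∀ τ z, IsUnitResponse L τ z → ∀ t ∈ Icc 0 τ, ‖z t‖ ≤ c := by
  have factorization : q = (q.roots.toList.map fun a => Polynomial.X - Polynomial.C a).prod := by
    conv_lhs => rw [(IsAlgClosed.splits q).eq_prod_roots_of_monic hq,
      ← Multiset.coe_toList q.roots, Multiset.map_coe, Multiset.prod_coe]
  have prod_eq_zero :
      (q.roots.toList.map fun a => L - algebraMap ℂ (V →L[ℂ] V) a).prod = 0 := by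
    rw [factorization, map_list_prod, List.map_map] at hL
    simpa [Function.comp_def] using hL
  exact exists_bound_of_bound_prod L q.roots.toList (fun z hz => hroots z (by simpa using hz)) 0
    fun τ z _ t _ => by simp [prod_eq_zero]

variable {k : ℕ}

/-- The inclusion of `ℝᵏ` in `ℂᵏ`, where a Hurwitz matrix can be split along its eigenvalues. -/
noncomputable def complexify : Vec k →L[ℝ] EuclideanSpace ℂ (Fin k) :=
  LinearMap.toContinuousLinearMap
    { toFun := fun x => WithLp.toLp 2 fun i => (x i : ℂ)
      map_add' := fun x y => by ext i; simp
      map_smul' := fun c x => by ext i; simp }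

lemma norm_complexify (x : Vec k) : ‖complexify x‖ = ‖x‖ := by
  simp [EuclideanSpace.norm_eq, complexify]

lemma exists_complexification (M : Mat k k) :
    ∃ L : EuclideanSpace ℂ (Fin k) →L[ℂ] EuclideanSpace ℂ (Fin k),
      (∀ x, complexify (M x) = L (complexify x)) ∧
      Polynomial.aeval L
        ((LinearMap.charpoly (M : Vec k →ₗ[ℝ] Vec k)).map (algebraMap ℝ ℂ)) = 0 := by
  obtain ⟨A, rfl⟩ : ∃ A, Matrix.toEuclideanCLM (n := Fin k) (𝕜 := ℝ) A = M :=
    ⟨_, Matrix.toEuclideanCLM.apply_symm_apply M⟩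
  refine ⟨Matrix.toEuclideanCLM (𝕜 := ℂ) (A.map (algebraMap ℝ ℂ)), fun x => ?_, ?_⟩
  · ext i
    simp [complexify, Matrix.mulVec, dotProduct]
  · rw [Matrix.coe_toEuclideanCLM_eq_toEuclideanLin, Matrix.toEuclideanLin,
      Matrix.toLpLin_eq_toLin,
      Matrix.charpoly_toLin, ← Matrix.charpoly_map, Polynomial.aeval_algHom_apply,
      Matrix.aeval_self_charpoly, map_zero]

theorem IsHurwitz.exists_bound {M : Mat k k} (hM : IsHurwitz M) :
    ∃ c, ∀ (τ : ℝ) (x u : ℝ → Vec k), 0 ≤ τ → (∀ t ∈ Icc 0 τ, ‖u t‖ ≤ 1) →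
      SolvesOn (Icc 0 τ) x 0 (fun t => M (x t) + u t) → ∀ t ∈ Icc 0 τ, ‖x t‖ ≤ c := by
  obtain ⟨L, hML, hL⟩ := exists_complexification M
  obtain ⟨c, hc⟩ := exists_bound_of_aeval_eq_zero L ((LinearMap.charpoly_monic _).map _) hM hL
  refine ⟨c, fun τ x u hτ hu hx t ht => ?_⟩
  have hxc := hx.continuousOn hτ
  have hui : ∀ t ∈ Icc 0 τ, IntervalIntegrable u volume 0 t := by
    intro t ht
    have hMx : IntervalIntegrable (fun ξ => M (x ξ)) volume 0 t := by
      refine ContinuousOn.intervalIntegrable ?_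
      rw [uIcc_of_le ht.1]
      exact M.continuous.comp_continuousOn (hxc.mono (Icc_subset_Icc_right ht.2))
    simpa using (hx t ht).1.sub hMx
  have response : IsUnitResponse L τ (fun t => complexify (x t)) := by
    refine ⟨complexify.continuous.comp_continuousOn hxc, fun t => complexify (u t),
      fun t ht => (norm_complexify _).trans_le (hu t ht),
      fun t ht => ⟨complexify.integrable_comp (hui t ht).1,
        complexify.integrable_comp (hui t ht).2⟩,
      fun t ht => ?_⟩
    simp only [(hx t ht).2, zero_add, ← hML, ← map_add]
    exact (complexify.intervalIntegral_comp_comm (hx t ht).1).symm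
  simpa only [norm_complexify] using hc τ _ response t ht

lemma IsHurwitz.injective {M : Mat k k} (hM : IsHurwitz M) : Function.Injective M := by
  rw [injective_iff_map_eq_zero]
  intro v hv
  by_contra hne
  have eigenvalue_zero : Module.End.HasEigenvalue (M : Vec k →ₗ[ℝ] Vec k) 0 :=
    Module.End.hasEigenvalue_of_hasEigenvector (x := v)
      ⟨Module.End.mem_eigenspace_iff.2 (by simpa using hv), hne⟩
  have root_zero : (0 : ℂ) ∈ ((LinearMap.charpoly (M : Vec k →ₗ[ℝ] Vec k)).map
      (algebraMap ℝ ℂ)).roots := by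
    rw [Polynomial.mem_roots ((LinearMap.charpoly_monic _).map _).ne_zero]
    simpa using ((Module.End.hasEigenvalue_iff_isRoot_charpoly _ _).1 eigenvalue_zero).map
      (f := algebraMap ℝ ℂ)
  simpa using hM 0 root_zero

end Hurwitz

section FreeContinuation

variable {k : ℕ}

lemma exists_hasDerivAt_clm_apply (M : Mat k k) (τ : ℝ) (v : Vec k) :
    ∃ e : ℝ → Vec k, e τ = v ∧ ∀ t, HasDerivAt e (M (e t)) t := by
  refine ⟨fun t => NormedSpace.exp ((t - τ) • M) v, ?_, fun t => ?_⟩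
  · have : (τ - τ) • M = 0 := by
      rw [sub_self]; exact zero_smul ℝ M
    simp only [this, NormedSpace.exp_zero, one_apply_eq_self]
  · have hexp := (hasDerivAt_exp_smul_const' (𝕂 := ℝ) M (t - τ)).comp_sub_const t τ
    simpa using hexp.clm_apply (hasDerivAt_const t v)

/- The solution is continued by free motion. -/
lemma exists_solvesOn_Ici {M : Mat k k} {τ : ℝ} (hτ : 0 ≤ τ) {x u : ℝ → Vec k} {x₀ : Vec k}
    (hx : SolvesOn (Icc 0 τ) x x₀ (fun t => M (x t) + u t)) :
    ∃ x' : ℝ → Vec k, (∀ t ∈ Icc 0 τ, x' t = x t) ∧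
      SolvesOn (Ici 0) x' x₀ (fun t => M (x' t) + (Icc 0 τ).indicator u t) := by
  obtain ⟨e, heτ, he⟩ := exists_hasDerivAt_clm_apply M τ (x τ)
  have hMe : Continuous fun ξ => M (e ξ) :=
    M.continuous.comp (continuous_iff_continuousAt.2 fun t => (he t).continuousAt)
  let x' : ℝ → Vec k := fun t => if t ≤ τ then x t else e t
  have eq_before : ∀ t ∈ Icc 0 τ, x' t = x t := fun t ht => if_pos ht.2
  have solves_before :
      SolvesOn (Icc 0 τ) x' x₀ (fun t => M (x' t) + (Icc 0 τ).indicator u t) :=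
    (hx.congr_state eq_before).congr_rhs fun t ht => by
      rw [eq_before t ht, indicator_of_mem ht]
  refine ⟨x', eq_before, fun t ht => ?_⟩
  rcases le_or_gt t τ with htτ | htτ
  · exact solves_before t ⟨ht, htτ⟩
  have rhs_after : ∀ ξ ∈ uIoc τ t, M (x' ξ) + (Icc 0 τ).indicator u ξ = M (e ξ) := by
    intro ξ hξ
    rw [uIoc_of_le htτ.le] at hξ
    rw [show x' ξ = e ξ from if_neg (not_le.2 hξ.1),
      indicator_of_notMem (fun h => not_le.2 hξ.1 h.2), add_zero]
  obtain ⟨int_before, hxτ⟩ := solves_before τ ⟨hτ, le_rfl⟩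
  have int_after := (hMe.intervalIntegrable (μ := volume) τ t).congr fun ξ hξ =>
    (rhs_after ξ hξ).symm
  refine ⟨int_before.trans int_after, ?_⟩
  rw [← intervalIntegral.integral_add_adjacent_intervals int_before int_after, ← add_assoc, ← hxτ,
    intervalIntegral.integral_congr_ae (Eventually.of_forall rhs_after),
    intervalIntegral.integral_eq_sub_of_hasDerivAt (fun ξ _ => he ξ)
      (hMe.intervalIntegrable τ t), heτ, eq_before τ ⟨hτ, le_rfl⟩, add_sub_cancel]
  exact if_neg (not_le.2 htτ)

end FreeContinuation

/-! ### Gains of Lyapunov-stable systems -/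

lemma SolvesOn.hasDerivWithinAt_linear {d k : ℕ} {τ : ℝ} {A : ℝ → Mat d d} {B : ℝ → Mat d k}
    {x : ℝ → Vec d} {v : ℝ → Vec k} {x₀ : Vec d} (hA : ContinuousOn A (Icc 0 τ))
    (hB : ContinuousOn B (Icc 0 τ))
    (hx : SolvesOn (Icc 0 τ) x x₀ (fun t => A t (x t) + B t (v t))) {t : ℝ} (ht : t ∈ Ico 0 τ)
    (hv : ContinuousWithinAt v (Ici t) t) :
    HasDerivWithinAt x (A t (x t) + B t (v t)) (Ici t) t := by
  have mem_nhds : Icc 0 τ ∈ 𝓝[≥] t :=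
    mem_of_superset (Icc_mem_nhdsGE ht.2) (Icc_subset_Icc_left ht.1)
  have hxt := hx.continuousOn (ht.1.trans ht.2.le) t (Ico_subset_Icc_self ht)
  have hAt := hA t (Ico_subset_Icc_self ht)
  have hBt := hB t (Ico_subset_Icc_self ht)
  exact hx.hasDerivWithinAt_right ht
    (((hAt.clm_apply hxt).mono_of_mem_nhdsWithin mem_nhds).add
      ((hBt.mono_of_mem_nhdsWithin mem_nhds).clm_apply hv))

lemma one_sub_exp_half_le_sqrt {y : ℝ} (hy : 0 ≤ y) :
    1 - Real.exp (-(y / 2)) ≤ √(1 - Real.exp (-y)) := by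
  apply Real.le_sqrt_of_sq_le
  have exp_sq : Real.exp (-y) = Real.exp (-(y / 2)) ^ 2 := by
    rw [← Real.exp_nat_mul]; congr 1; push_cast; ring
  have exp_le_one : Real.exp (-(y / 2)) ≤ 1 := Real.exp_le_one_iff.2 (by linarith)
  rw [exp_sq]
  nlinarith [Real.exp_pos (-(y / 2))]

namespace IsLyapunov

variable {s d k : ℕ} {Θ Θd : Set (Vec s)} {A P : Vec s → Mat d d} {P' : Vec s → Vec s →L[ℝ] Mat d d}
  {B : Vec s → Mat d k} {μ : ℝ} (h : IsLyapunov Θ Θd A P P' μ)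

include h

lemma lamMin_nonneg : 0 ≤ lamMin Θ P := by
  refine Real.sInf_nonneg ?_
  rintro c ⟨θ, hθ, hc⟩
  obtain ⟨x, hx, hPx⟩ := exists_eigenvector_of_mem_spectrum hc
  have inner_pos := h.pos θ hθ x hx
  rw [hPx, real_inner_smul_right] at inner_pos
  exact (pos_of_mul_pos_left inner_pos real_inner_self_nonneg).le

lemma two_div_nonneg : 0 ≤ 2 / (μ * lamMin Θ P) :=
  div_nonneg zero_le_two (mul_nonneg h.mu_pos.le h.lamMin_nonneg)

lemma beta_nonneg (t : ℝ) : 0 ≤ beta Θ t μ P B :=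
  mul_nonneg (mul_nonneg (Real.sqrt_nonneg _) h.two_div_nonneg) (maxNorm_nonneg _ _)

lemma betaInf_nonneg : 0 ≤ betaInf Θ μ P B :=
  mul_nonneg (mul_nonneg (Real.sqrt_nonneg _) h.two_div_nonneg) (maxNorm_nonneg _ _)

lemma one_le_sqrt_lamMax_div_lamMin (hΘ : IsCompact Θ) (hne : Θ.Nonempty) (hd : 0 < d) :
    1 ≤ √(lamMax Θ P / lamMin Θ P) :=
  Real.one_le_sqrt.2
    ((one_le_div (h.lamMin_pos hΘ hne hd)).2 (h.lamMin_le_lamMax hΘ hne hd))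

lemma norm_comp_apply_le (hΘ : IsCompact Θ) (hB : ContinuousOn B Θ) {θ : Vec s} (hθ : θ ∈ Θ)
    {v : Vec k} {b : ℝ} (hv : ‖v‖ ≤ b) :
    ‖P θ (B θ v)‖ ≤ maxNorm Θ (fun θ => P θ ∘L B θ) * b :=
  ContinuousLinearMap.le_of_opNorm_le_of_le (P θ ∘L B θ)
    (norm_le_maxNorm hΘ (h.continuousOn.clm_comp hB) hθ) hv

variable {θ : ℝ → Vec s} {x : ℝ → Vec d} {v : ℝ → Vec k} {t₀ t b : ℝ}

lemma norm_le_beta_mul (hΘ : IsCompact Θ) (hB : ContinuousOn B Θ) (hθ : θ ∈ Trajectories Θ Θd)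
    (hx : ContinuousOn x (Icc 0 t)) (hx0 : x 0 = 0)
    (hx' : ∀ r ∈ Ico 0 t, HasDerivWithinAt x (A (θ r) (x r) + B (θ r) (v r)) (Ici r) r)
    (hb : 0 ≤ b) (hv : ∀ r ∈ Ico 0 t, ‖v r‖ ≤ b) {T : ℝ} (ht : 0 ≤ t) (htT : t ≤ T) :
    ‖x t‖ ≤ beta Θ T μ P B * b := by
  rcases d.eq_zero_or_pos with rfl | hd
  · rw [Subsingleton.elim (x t) 0, norm_zero]
    exact mul_nonneg (h.beta_nonneg T) hb
  have hNb : 0 ≤ maxNorm Θ (fun θ => P θ ∘L B θ) * b := mul_nonneg (maxNorm_nonneg _ _) hb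
  have decay := h.norm_le hΘ hd hθ le_rfl hx hx'
    (fun r hr => h.norm_comp_apply_le hΘ hB (Trajectories.mem hθ hr.1) (hv r hr)) hNb
    ⟨ht, le_rfl⟩
  rw [hx0, norm_zero, mul_zero, zero_add, sub_zero] at decay
  have hμT : 0 ≤ μ * T := mul_nonneg h.mu_pos.le (ht.trans htT)
  have factor_le : 1 - Real.exp (-(μ / 2 * t)) ≤
      √(√(lamMax Θ P / lamMin Θ P) * (1 - Real.exp (-(μ * T)))) :=
    calc 1 - Real.exp (-(μ / 2 * t)) ≤ 1 - Real.exp (-(μ * T / 2)) := by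
          have := mul_le_mul_of_nonneg_left htT h.mu_pos.le
          gcongr
          linarith
      _ ≤ √(1 - Real.exp (-(μ * T))) := one_sub_exp_half_le_sqrt hμT
      _ ≤ √(√(lamMax Θ P / lamMin Θ P) * (1 - Real.exp (-(μ * T)))) :=
          Real.sqrt_le_sqrt (le_mul_of_one_le_left
            (sub_nonneg.2 (Real.exp_le_one_iff.2 (neg_nonpos.2 hμT)))
            (h.one_le_sqrt_lamMax_div_lamMin hΘ ⟨θ 0, Trajectories.mem hθ le_rfl⟩ hd))
  calc ‖x t‖ ≤ _ := decay
    _ ≤ √(√(lamMax Θ P / lamMin Θ P) * (1 - Real.exp (-(μ * T)))) * (2 / (μ * lamMin Θ P)) *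
          (maxNorm Θ (fun θ => P θ ∘L B θ) * b) :=
        mul_le_mul_of_nonneg_right (mul_le_mul_of_nonneg_right factor_le h.two_div_nonneg) hNb
    _ = beta Θ T μ P B * b := by rw [beta, mul_assoc _ _ b]

lemma norm_le_add_betaInf_mul (hΘ : IsCompact Θ) (hB : ContinuousOn B Θ)
    (hθ : θ ∈ Trajectories Θ Θd) (ht₀ : 0 ≤ t₀) (hx : ContinuousOn x (Icc t₀ t))
    (hx' : ∀ r ∈ Ico t₀ t, HasDerivWithinAt x (A (θ r) (x r) + B (θ r) (v r)) (Ici r) r)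
    (hb : 0 ≤ b) (hv : ∀ r ∈ Ico t₀ t, ‖v r‖ ≤ b) (ht : t₀ ≤ t) :
    ‖x t‖ ≤ √(lamMax Θ P / lamMin Θ P) * ‖x t₀‖ + betaInf Θ μ P B * b := by
  rcases d.eq_zero_or_pos with rfl | hd
  · rw [Subsingleton.elim (x t) 0, norm_zero]
    exact add_nonneg (by positivity) (mul_nonneg h.betaInf_nonneg hb)
  have hNb : 0 ≤ maxNorm Θ (fun θ => P θ ∘L B θ) * b := mul_nonneg (maxNorm_nonneg _ _) hb
  have exp_le_one : Real.exp (-(μ / 2 * (t - t₀))) ≤ 1 :=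
    Real.exp_le_one_iff.2 (neg_nonpos.2 (mul_nonneg (half_pos h.mu_pos).le (sub_nonneg.2 ht)))
  have one_le : 1 ≤ √√(lamMax Θ P / lamMin Θ P) := Real.one_le_sqrt.2
    (h.one_le_sqrt_lamMax_div_lamMin hΘ ⟨θ t₀, Trajectories.mem hθ ht₀⟩ hd)
  have factor_le : 1 - Real.exp (-(μ / 2 * (t - t₀))) ≤ √√(lamMax Θ P / lamMin Θ P) :=
    (sub_le_self 1 (Real.exp_pos _).le).trans one_le
  calc ‖x t‖ ≤ _ := h.norm_le hΘ hd hθ ht₀ hx hx'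
        (fun r hr => h.norm_comp_apply_le hΘ hB (Trajectories.mem hθ (ht₀.trans hr.1)) (hv r hr))
        hNb ⟨ht, le_rfl⟩
    _ ≤ √(lamMax Θ P / lamMin Θ P) * ‖x t₀‖ +
          √√(lamMax Θ P / lamMin Θ P) * (2 / (μ * lamMin Θ P)) *
            (maxNorm Θ (fun θ => P θ ∘L B θ) * b) :=
        add_le_add
          (mul_le_mul_of_nonneg_right
            (mul_le_of_le_one_right (Real.sqrt_nonneg _) exp_le_one) (norm_nonneg _))
          (mul_le_mul_of_nonneg_right (mul_le_mul_of_nonneg_right factor_le h.two_div_nonneg) hNb)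
    _ = _ := by rw [betaInf, mul_assoc _ _ b]

theorem norm_le_of_switched_bound (hΘ : IsCompact Θ) (hB : ContinuousOn B Θ)
    (hθ : θ ∈ Trajectories Θ Θd) (hx : ContinuousOn x (Icc 0 t)) (hx0 : x 0 = 0)
    (hx' : ∀ r ∈ Ico 0 t, HasDerivWithinAt x (A (θ r) (x r) + B (θ r) (v r)) (Ici r) r)
    {T b₁ b₂ : ℝ} (hT : 0 ≤ T) (hb₁ : 0 ≤ b₁) (hb₂ : 0 ≤ b₂)
    (h₁ : ∀ r ∈ Ico 0 t, r < T → ‖v r‖ ≤ b₁) (h₂ : ∀ r ∈ Ico 0 t, T ≤ r → ‖v r‖ ≤ b₂)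
    (ht : 0 ≤ t) :
    ‖x t‖ ≤ √(lamMax Θ P / lamMin Θ P) * beta Θ T μ P B * b₁ + betaInf Θ μ P B * b₂ := by
  have hmin : 0 ≤ min t T := le_min ht hT
  have hmin_le : min t T ≤ t := min_le_left t T
  have first_phase : ‖x (min t T)‖ ≤ beta Θ T μ P B * b₁ :=
    h.norm_le_beta_mul hΘ hB hθ (hx.mono (Icc_subset_Icc_right hmin_le)) hx0
      (fun r hr => hx' r ⟨hr.1, hr.2.trans_le hmin_le⟩) hb₁
      (fun r hr => h₁ r ⟨hr.1, hr.2.trans_le hmin_le⟩ (hr.2.trans_le (min_le_right t T)))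
      hmin (min_le_right t T)
  calc ‖x t‖ ≤ √(lamMax Θ P / lamMin Θ P) * ‖x (min t T)‖ + betaInf Θ μ P B * b₂ :=
        h.norm_le_add_betaInf_mul hΘ hB hθ hmin (hx.mono (Icc_subset_Icc_left hmin))
          (fun r hr => hx' r ⟨hmin.trans hr.1, hr.2⟩) hb₂
          (fun r hr => h₂ r ⟨hmin.trans hr.1, hr.2⟩
            ((min_le_iff.1 hr.1).resolve_left (not_le.2 hr.2))) hmin_le
    _ ≤ √(lamMax Θ P / lamMin Θ P) * (beta Θ T μ P B * b₁) + betaInf Θ μ P B * b₂ := by gcongr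
    _ = _ := by rw [mul_assoc]

end IsLyapunov

namespace Setup

variable {n m p s nH nF : ℕ} {S : Setup n m p s nH nF} {θ : ℝ → Vec s} {τ : ℝ}

/-! ### The filter -/

lemma filter_contOn : S.filter.ContOn S.Θ :=
  ⟨continuousOn_const, continuousOn_const, continuousOn_const, continuousOn_const⟩

lemma l1ωC_nonneg : 0 ≤ S.l1ωC := ENNReal.toReal_nonneg

namespace Assumptions

variable (hS : S.Assumptions)

include hS

lemma ωK_inj : Function.Injective (S.ω ∘L S.K) := fun _ _ hvw =>
  (hS.filter_stable _ hS.ω_mem).injective (congrArg Neg.neg hvw)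

lemma K_inj : Function.Injective S.K :=
  Function.Injective.of_comp (f := S.ω) (g := S.K) hS.ωK_inj

lemma K_surj : Function.Surjective S.K :=
  (LinearMap.injective_iff_surjective (f := (S.K : Vec m →ₗ[ℝ] Vec m))).1 hS.K_inj

lemma ω_inj : Function.Injective S.ω := by
  intro v w hvw
  obtain ⟨v', rfl⟩ := hS.K_surj v
  obtain ⟨w', rfl⟩ := hS.K_surj w
  rw [hS.ωK_inj hvw]

lemma ωinv_ω (v : Vec m) : S.ωinv (S.ω v) = v := by
  obtain ⟨e, he⟩ := exists_equiv_of_injective hS.ω_inj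
  simp [ωinv, ← he]

lemma ω_ωinv (v : Vec m) : S.ω (S.ωinv v) = v := by
  obtain ⟨e, he⟩ := exists_equiv_of_injective hS.ω_inj
  simp [ωinv, ← he]

lemma norm_ωinv_pos (hm : 0 < m) : 0 < ‖S.ωinv‖ := by
  rw [norm_pos_iff]
  intro hzero
  have := congrArg (fun v : Vec m => v ⟨0, hm⟩)
    (hS.ω_ωinv (EuclideanSpace.single ⟨0, hm⟩ 1))
  simp [hzero] at this

lemma ppg_ωC_ne_top : IOMap.ppg S.mapωC S.adm ≠ ⊤ := by
  obtain ⟨c, hc⟩ := (hS.filter_stable _ hS.ω_mem).exists_bound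
  refine ne_top_of_le_ne_top (ENNReal.ofReal_ne_top (r := ‖S.ωinv‖ * (‖S.ω ∘L S.K‖ * c))) ?_
  refine iSup₂_le fun θ _ => iSup₂_le fun u _ => iSup_le fun hu => iSup₂_le fun y hy => ?_
  obtain ⟨v, ⟨x, hx, hv⟩, hy⟩ := hy
  refine linf_le_ofReal fun t ht => ?_
  have hxt : ‖x t‖ ≤ c := by
    refine hc t x u ht (fun r hr => ?_) (hx.mono Icc_subset_Ici_self) t ⟨ht, le_rfl⟩
    exact norm_le_of_linf_le zero_le_one (by simpa using hu) (mem_Ici.2 hr.1)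
  rw [hy t ht, hv t ht]
  simp only [filter, zero_apply, add_zero]
  exact ContinuousLinearMap.le_opNorm_of_le _ (ContinuousLinearMap.le_opNorm_of_le _ hxt)

variable (hθ : θ ∈ S.adm) (hτ : 0 ≤ τ) {u y : ℝ → Vec m} (hu : Measurable u)
  (hy : S.mapC (Icc 0 τ) θ u y)

include hθ hτ hu hy

/- The peak-to-peak gain only sees inputs on `[0, ∞)`, so the input is extended by zero and the
filter state by its free motion. -/
lemma norm_ωC_le_of_norm_le_one (hu1 : ∀ t ∈ Icc 0 τ, ‖u t‖ ≤ 1) {t : ℝ} (ht : t ∈ Icc 0 τ) :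
    ‖S.ωinv (y t)‖ ≤ S.l1ωC := by
  obtain ⟨x, hx, hxy⟩ := hy
  obtain ⟨x', hx'x, hx'⟩ := exists_solvesOn_Ici hτ (M := -(S.ω ∘L S.K)) hx
  have response : S.mapωC (Ici 0) θ ((Icc 0 τ).indicator u)
      (fun t => S.ωinv ((S.ω ∘L S.K) (x' t))) :=
    ⟨fun t => (S.ω ∘L S.K) (x' t), ⟨x', hx', fun t _ => by simp [filter]⟩, fun t _ => rfl⟩
  have input_le : linf (Ici 0) ((Icc 0 τ).indicator u) ≤ 1 := by
    rw [← ENNReal.ofReal_one]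
    refine linf_le_ofReal fun r _ => ?_
    by_cases hr : r ∈ Icc 0 τ
    · rw [indicator_of_mem hr]
      exact hu1 r hr
    · rw [indicator_of_notMem hr, norm_zero]
      exact zero_le_one
  have output_le : linf (Ici 0) (fun t => S.ωinv ((S.ω ∘L S.K) (x' t))) ≤
      ENNReal.ofReal S.l1ωC := by
    rw [l1ωC, ENNReal.ofReal_toReal hS.ppg_ωC_ne_top]
    exact le_iSup₂_of_le θ hθ (le_iSup₂_of_le _ (hu.indicator measurableSet_Icc)
      (le_iSup_of_le input_le (le_iSup₂_of_le _ response le_rfl)))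
  have hyt : y t = (S.ω ∘L S.K) (x' t) := by
    rw [hxy t ht, hx'x t ht]
    simp [filter]
  simpa only [hyt] using norm_le_of_linf_le l1ωC_nonneg output_le (mem_Ici.2 ht.1)

theorem norm_ωC_le {b : ℝ} (hb : ∀ t ∈ Icc 0 τ, ‖u t‖ ≤ b) {t : ℝ} (ht : t ∈ Icc 0 τ) :
    ‖S.ωinv (y t)‖ ≤ S.l1ωC * b := by
  have le_of_gt : ∀ c > b, ‖S.ωinv (y t)‖ ≤ S.l1ωC * c := by
    intro c hc
    have hc0 : 0 < c := (norm_nonneg _).trans_lt ((hb t ht).trans_lt hc)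
    have hunit := hS.norm_ωC_le_of_norm_le_one hθ hτ (hu.const_smul c⁻¹)
      (StateSpace.map_smul hy c⁻¹) (fun r hr => by
        rw [Pi.smul_apply, norm_smul, norm_inv, Real.norm_of_nonneg hc0.le,
          inv_mul_le_one₀ hc0]
        exact (hb r hr).trans hc.le) ht
    rwa [map_smul, norm_smul, norm_inv, Real.norm_of_nonneg hc0.le, inv_mul_le_iff₀ hc0,
      mul_comm] at hunit
  have hlim : Tendsto (fun c => S.l1ωC * c) (𝓝[>] b) (𝓝 (S.l1ωC * b)) :=
    ((continuous_const_mul S.l1ωC).tendsto b).mono_left nhdsWithin_le_nhds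
  exact ge_of_tendsto hlim (eventually_mem_nhdsWithin.mono le_of_gt)

end Assumptions

/-! ### The mapping from the estimation error to the input -/

namespace Assumptions

variable (hS : S.Assumptions) (hθ : θ ∈ S.adm) (hτ : 0 ≤ τ)

include hS hθ hτ

theorem norm_F_le {T : ℝ} (hT : 0 ≤ T) {v : ℝ → Vec n} {y : ℝ → Vec m} (hv : Measurable v)
    (hvr : ∀ t ∈ Ico 0 τ, ContinuousWithinAt v (Ici t) t)
    (hy : S.mapF (Icc 0 τ) θ v y) {b₁ b₂ : ℝ} (hb₁ : 0 ≤ b₁) (hb₂ : 0 ≤ b₂)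
    (h₁ : ∀ t ∈ Icc 0 τ, t < T → ‖v t‖ ≤ b₁) (h₂ : ∀ t ∈ Icc 0 τ, T ≤ t → ‖v t‖ ≤ b₂)
    {t : ℝ} (ht : t ∈ Icc 0 τ) :
    ‖y t‖ ≤ maxNorm S.Θ S.CF *
      (√(lamMax S.Θ S.PF / lamMin S.Θ S.PF) * beta S.Θ T S.μF S.PF S.BF * b₁ +
        betaInf S.Θ S.μF S.PF S.BF * b₂) := by
  have hbdd : linf (Icc 0 τ) v ≠ ⊤ := by
    refine ne_top_of_le_ne_top (ENNReal.ofReal_ne_top (r := max b₁ b₂))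
      (linf_le_ofReal fun t ht => ?_)
    rcases lt_or_ge t T with h | h
    · exact (h₁ t ht h).trans (le_max_left _ _)
    · exact (h₂ t ht h).trans (le_max_right _ _)
  obtain ⟨x, hx, hxy⟩ := (hS.realF θ hθ τ hτ v hv hbdd y).2 hy
  obtain ⟨hA, hB, hC, -⟩ := hS.sysF_cont
  simp only [sysF, zero_apply, add_zero] at hx hxy hA hB hC
  rw [hxy t ht]
  refine ContinuousLinearMap.le_of_opNorm_le_of_le _
    (norm_le_maxNorm isCompact_Θ hC (mem_Θ hθ ht.1)) ?_
  exact hS.lyapF.norm_le_of_switched_bound isCompact_Θ hB hθ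
    ((hx.continuousOn hτ).mono (Icc_subset_Icc_right ht.2)) (hx.zero_apply ⟨le_rfl, hτ⟩)
    (fun r hr => hx.hasDerivWithinAt_linear (Trajectories.continuousOn_comp hθ hA τ)
      (Trajectories.continuousOn_comp hθ hB τ) ⟨hr.1, hr.2.trans_le ht.2⟩
      (hvr r ⟨hr.1, hr.2.trans_le ht.2⟩))
    hT hb₁ hb₂ (fun r hr => h₁ r ⟨hr.1, hr.2.le.trans ht.2⟩)
    (fun r hr => h₂ r ⟨hr.1, hr.2.le.trans ht.2⟩) ht.1

end Assumptions

end Setup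

/-! ### The sampled estimate -/

section Sampling

variable {k l : ℕ} {a T τ t₀ t₁ : ℝ}

lemma measurable_clm_apply {W : ℝ → Mat l k} (hW : Continuous W) {v : ℝ → Vec k}
    (hv : Measurable v) : Measurable fun t => W t (v t) :=
  ContinuousLinearMap.measurable_apply₂.comp (hW.measurable.prodMk hv)

/-- The sample-and-hold signal that is `0` on `[0, T)` and `c i` on `[i T, (i + 1) T)` for
`1 ≤ i`. It encodes the estimate `σ̂_c`. -/
noncomputable def hold (T : ℝ) (c : ℕ → Vec k) (t : ℝ) : Vec k :=
  if t < T then 0 else c ⌊t / T⌋₊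

lemma measurable_hold (T : ℝ) (c : ℕ → Vec k) : Measurable (hold T c) :=
  Measurable.ite measurableSet_Iio measurable_const
    (measurable_from_nat.comp (Nat.measurable_floor.comp (measurable_id.div_const T)))

lemma natFloor_div_mul_le (hT : 0 < T) {t : ℝ} (ht : 0 ≤ t) : ⌊t / T⌋₊ * T ≤ t :=
  (le_div_iff₀ hT).1 (Nat.floor_le (div_nonneg ht hT.le))

lemma lt_natFloor_div_add_one_mul (hT : 0 < T) (t : ℝ) : t < (⌊t / T⌋₊ + 1) * T :=
  (div_lt_iff₀ hT).1 (Nat.lt_floor_add_one _)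

lemma exists_previous_period (hT : 0 < T) {t : ℝ} (ht : T ≤ t) :
    ∃ i : ℕ, (i + 1) * T ≤ t ∧ t < (i + 2) * T := by
  have floor_pos : 1 ≤ ⌊t / T⌋₊ := Nat.le_floor (by rwa [Nat.cast_one, one_le_div hT])
  obtain ⟨i, hi⟩ := Nat.exists_eq_add_of_le' floor_pos
  have hle := natFloor_div_mul_le hT (hT.le.trans ht)
  have hlt := lt_natFloor_div_add_one_mul hT t
  rw [hi] at hle hlt
  push_cast at hle hlt
  exact ⟨i, hle, by linarith⟩

lemma hold_continuousWithinAt (hT : 0 < T) (c : ℕ → Vec k) {t : ℝ} (ht : 0 ≤ t) :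
    ContinuousWithinAt (hold T c) (Ici t) t := by
  have eventually_const : ∀ᶠ r in 𝓝[≥] t, hold T c t = hold T c r := by
    rcases lt_or_ge t T with htT | htT
    · filter_upwards [Ico_mem_nhdsGE htT] with r hr
      simp only [hold, htT, hr.2, if_true]
    · filter_upwards [Ico_mem_nhdsGE (lt_natFloor_div_add_one_mul hT t)] with r hr
      have same_period : ⌊r / T⌋₊ = ⌊t / T⌋₊ := by
        rw [Nat.floor_eq_iff (div_nonneg (ht.trans hr.1) hT.le), le_div_iff₀ hT, div_lt_iff₀ hT]
        exact ⟨(natFloor_div_mul_le hT ht).trans hr.1, hr.2⟩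
      simp only [hold, htT.not_gt, (htT.trans hr.1).not_gt, if_false, same_period]
  exact tendsto_const_nhds.congr' eventually_const

lemma integral_exp_mul (ha : a ≠ 0) (t₀ t₁ : ℝ) :
    ∫ r in t₀..t₁, Real.exp (a * r) = (Real.exp (a * t₁) - Real.exp (a * t₀)) / a := by
  rw [intervalIntegral.integral_comp_mul_left Real.exp ha, integral_exp, smul_eq_mul,
    inv_mul_eq_div]

lemma norm_integral_exp_smul_sub_le (ha : a ≠ 0) (ht : t₀ ≤ t₁) {w : ℝ → Vec k}
    (hw : ContinuousOn w (Icc t₀ t₁)) {v : Vec k} {D : ℝ}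
    (hD : ∀ r ∈ Icc t₀ t₁, ‖w r - v‖ ≤ D) :
    ‖(∫ r in t₀..t₁, Real.exp (a * r) • w r) -
      ((Real.exp (a * t₁) - Real.exp (a * t₀)) / a) • v‖ ≤
        (Real.exp (a * t₁) - Real.exp (a * t₀)) / a * D := by
  have exp_cont : Continuous fun r : ℝ => Real.exp (a * r) := by fun_prop
  have hw_int : IntervalIntegrable (fun r => Real.exp (a * r) • w r) volume t₀ t₁ :=
    (exp_cont.continuousOn.smul hw).intervalIntegrable_of_Icc ht
  rw [← integral_exp_mul ha, ← intervalIntegral.integral_smul_const,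
    ← intervalIntegral.integral_sub hw_int (Continuous.intervalIntegrable (by fun_prop) _ _),
    ← intervalIntegral.integral_mul_const]
  refine intervalIntegral.norm_integral_le_of_norm_le ht (Eventually.of_forall fun r hr => ?_)
    ((exp_cont.intervalIntegrable _ _).mul_const _)
  rw [← smul_sub, norm_smul, Real.norm_of_nonneg (Real.exp_pos _).le]
  exact mul_le_mul_of_nonneg_left (hD r (Ioc_subset_Icc_self hr)) (Real.exp_pos _).le

lemma SolvesOn.exp_smul_sub_exp_smul {e g : ℝ → Vec k} {e₀ : Vec k}
    (he : SolvesOn (Icc 0 τ) e e₀ (fun t => g t - a • e t)) (h₀ : 0 ≤ t₀) (ht : t₀ ≤ t₁)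
    (h₁ : t₁ ≤ τ) (hg : ∀ t ∈ Ico t₀ t₁, ContinuousWithinAt g (Ici t) t) :
    Real.exp (a * t₁) • e t₁ - Real.exp (a * t₀) • e t₀ =
      ∫ r in t₀..t₁, Real.exp (a * r) • g r := by
  have e_cont := he.continuousOn (h₀.trans (ht.trans h₁))
  have e_cont' : ContinuousOn e (Icc t₀ t₁) := e_cont.mono (Icc_subset_Icc h₀ h₁)
  have exp_cont : Continuous fun r : ℝ => Real.exp (a * r) := by fun_prop
  have g_int : IntervalIntegrable g volume t₀ t₁ := by
    have rhs_int := he.intervalIntegrable ⟨h₀, ht.trans h₁⟩ ⟨h₀.trans ht, h₁⟩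
    simpa using rhs_int.add ((e_cont'.intervalIntegrable_of_Icc ht).smul a)
  refine (intervalIntegral.integral_eq_sub_of_hasDeriv_right_of_le ht
    (f := fun r => Real.exp (a * r) • e r) (exp_cont.continuousOn.smul e_cont') (fun r hr => ?_)
    (g_int.continuousOn_smul exp_cont.continuousOn)).symm
  have hrτ : r ∈ Ico 0 τ := ⟨h₀.trans hr.1.le, hr.2.trans_le h₁⟩
  have e_right : ContinuousWithinAt e (Ici r) r :=
    (e_cont r (Ico_subset_Icc_self hrτ)).mono_of_mem_nhdsWithin
      (mem_of_superset (Icc_mem_nhdsGE hrτ.2) (Icc_subset_Icc_left hrτ.1))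
  have e_deriv := (he.hasDerivWithinAt_right hrτ
    ((hg r (Ioo_subset_Ico_self hr)).sub (e_right.const_smul a))).mono Ioi_subset_Ici_self
  have exp_deriv : HasDerivWithinAt (fun r : ℝ => Real.exp (a * r)) (Real.exp (a * r) * a)
      (Ioi r) r := by
    simpa using ((hasDerivAt_id r).const_mul a).exp.hasDerivWithinAt
  exact (exp_deriv.smul e_deriv).congr_deriv (by module)

/-- The sampled gain is chosen so that the constant input `c` steers the initial error to `0` over
one period: only the disturbance remains. -/
lemma SolvesOn.exp_smul_eq_neg_integral {e σ σh : ℝ → Vec k} {e₀ : Vec k} (ha : 0 < a)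
    (hT : 0 < T) (he : SolvesOn (Icc 0 τ) e e₀ (fun t => σh t - σ t - a • e t))
    (hσ : ContinuousOn σ (Icc 0 τ)) (h₀ : 0 ≤ t₀) (h₁ : t₀ + T ≤ τ)
    (hσh : ∀ t ∈ Ico t₀ (t₀ + T), σh t = -((a / (Real.exp (a * T) - 1)) • e t₀)) :
    Real.exp (a * (t₀ + T)) • e (t₀ + T) =
      -∫ r in t₀..(t₀ + T), Real.exp (a * r) • σ r := by
  have hle : t₀ ≤ t₀ + T := by linarith
  set c : Vec k := -((a / (Real.exp (a * T) - 1)) • e t₀) with hc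
  have input_right : ∀ t ∈ Ico t₀ (t₀ + T),
      ContinuousWithinAt (fun t => σh t - σ t) (Ici t) t := by
    intro t ht
    have hσh_right : ContinuousWithinAt σh (Ici t) t :=
      tendsto_const_nhds.congr' <| by
        filter_upwards [Ico_mem_nhdsGE ht.2] with r hr
        rw [hσh r ⟨ht.1.trans hr.1, hr.2⟩, hσh t ht]
    have htτ : t ∈ Ico 0 τ := ⟨h₀.trans ht.1, ht.2.trans_le h₁⟩
    exact hσh_right.sub ((hσ t (Ico_subset_Icc_self htτ)).mono_of_mem_nhdsWithin
      (mem_of_superset (Icc_mem_nhdsGE htτ.2) (Icc_subset_Icc_left htτ.1)))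
  have integral_eq : ∫ r in t₀..(t₀ + T), Real.exp (a * r) • (σh r - σ r) =
      ((Real.exp (a * (t₀ + T)) - Real.exp (a * t₀)) / a) • c -
        ∫ r in t₀..(t₀ + T), Real.exp (a * r) • σ r := by
    have exp_cont : Continuous fun r : ℝ => Real.exp (a * r) := by fun_prop
    have hc_int : IntervalIntegrable (fun r => Real.exp (a * r) • c) volume t₀ (t₀ + T) :=
      (exp_cont.smul continuous_const).intervalIntegrable _ _
    have hσ_int : IntervalIntegrable (fun r => Real.exp (a * r) • σ r) volume t₀ (t₀ + T) :=
      (exp_cont.continuousOn.smul (hσ.mono (Icc_subset_Icc h₀ h₁))).intervalIntegrable_of_Icc hle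
    rw [← integral_exp_mul ha.ne', ← intervalIntegral.integral_smul_const,
      ← intervalIntegral.integral_sub hc_int hσ_int]
    refine intervalIntegral.integral_congr_Ioo_of_le hle fun r hr => ?_
    rw [hσh r (Ioo_subset_Ico_self hr), smul_sub]
  have cancel : ((Real.exp (a * (t₀ + T)) - Real.exp (a * t₀)) / a) • c =
      -(Real.exp (a * t₀) • e t₀) := by
    have gain_pos : 0 < Real.exp (a * T) - 1 :=
      sub_pos.2 (Real.one_lt_exp_iff.2 (mul_pos ha hT))
    rw [hc, smul_neg, smul_smul, mul_add, Real.exp_add]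
    congr 2
    field_simp
  have := he.exp_smul_sub_exp_smul h₀ hle h₁ input_right
  rw [integral_eq, cancel, sub_eq_iff_eq_add] at this
  rw [this]
  abel

lemma norm_neg_smul_sub_le {q E D : ℝ} {e w v : Vec k} (ha : 0 < a) (hq : 1 < q) (hE : 0 < E)
    (he : (E * q) • e = -w) (hw : ‖w - ((E * q - E) / a) • v‖ ≤ (E * q - E) / a * D) :
    ‖-((a / (q - 1)) • e) - q⁻¹ • v‖ ≤ q⁻¹ * D := by
  have : 0 < q := one_pos.trans hq
  have : 0 < q - 1 := sub_pos.2 hq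
  have e_eq : e = -((E * q)⁻¹ • w) := by
    rw [← smul_neg, ← he, inv_smul_smul₀ (by positivity)]
  have rescale : -((a / (q - 1)) • e) - q⁻¹ • v =
      (a / ((q - 1) * (E * q))) • (w - ((E * q - E) / a) • v) := by
    rw [e_eq, smul_neg, neg_neg, smul_smul, smul_sub, smul_smul]
    congr 2 <;> field_simp
  rw [rescale, norm_smul, Real.norm_of_nonneg (by positivity)]
  calc a / ((q - 1) * (E * q)) * ‖w - ((E * q - E) / a) • v‖
      ≤ a / ((q - 1) * (E * q)) * ((E * q - E) / a * D) :=
        mul_le_mul_of_nonneg_left hw (by positivity)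
    _ = q⁻¹ * D := by field_simp

/-- `σc` is the sampled estimate of the disturbance `σ` in the error equation `ė = σh - σ - a e`:
it is `0` during the first sampling period and `σh`, a multiple of the last error sample,
afterwards. -/
structure IsSampledEstimate (a T τ : ℝ) (e : ℝ → Vec k) (e₀ : Vec k) (σ σh σc : ℝ → Vec k) :
    Prop where
  continuousOn : ContinuousOn σ (Icc 0 τ)
  error : SolvesOn (Icc 0 τ) e e₀ (fun t => σh t - σ t - a • e t)
  law : ∀ i : ℕ, ∀ t ∈ Icc 0 τ, i * T ≤ t → t < (i + 1) * T →
    σh t = -((a / (Real.exp (a * T) - 1)) • e (i * T))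
  eq_zero : ∀ t ∈ Icc 0 τ, t < T → σc t = 0
  eq_of_le : ∀ t ∈ Icc 0 τ, T ≤ t → σc t = σh t

namespace IsSampledEstimate

variable {e σ σh σc : ℝ → Vec k} {e₀ : Vec k} (h : IsSampledEstimate a T τ e e₀ σ σh σc)

include h

lemma hold_eq (hT : 0 < T) {t : ℝ} (ht : t ∈ Icc 0 τ) :
    hold T (fun i => -((a / (Real.exp (a * T) - 1)) • e (i * T))) t = σc t := by
  rcases lt_or_ge t T with htT | htT
  · rw [h.eq_zero t ht htT, hold, if_pos htT]
  · rw [h.eq_of_le t ht htT, hold, if_neg htT.not_gt,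
      h.law _ t ht (natFloor_div_mul_le hT ht.1) (lt_natFloor_div_add_one_mul hT t)]

variable (ha : 0 < a) (hT : 0 < T)

include ha hT

/-- Up to the factor `exp (-a T)`, the estimate is a weighted average of `σ` over the previous
period. -/
theorem norm_sub_exp_smul_le {t : ℝ} (ht : t ∈ Icc 0 τ) (htT : T ≤ t) {v : Vec k} {D : ℝ}
    (hD : ∀ r ∈ Icc 0 τ, |r - t| ≤ 2 * T → ‖σ r - v‖ ≤ D) :
    ‖σc t - Real.exp (-(a * T)) • v‖ ≤ Real.exp (-(a * T)) * D := by
  obtain ⟨i, h₁, h₂⟩ := exists_previous_period hT htT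
  have h₀ : 0 ≤ i * T := by positivity
  have h₁τ : i * T + T ≤ τ := by linarith [ht.2]
  have error_eq := h.error.exp_smul_eq_neg_integral ha hT h.continuousOn h₀ h₁τ fun r hr =>
    h.law i r ⟨h₀.trans hr.1, hr.2.le.trans h₁τ⟩ hr.1 (by linarith [hr.2])
  have integral_bound := norm_integral_exp_smul_sub_le ha.ne' (by linarith)
    (h.continuousOn.mono (Icc_subset_Icc h₀ h₁τ)) fun r hr =>
      hD r ⟨h₀.trans hr.1, hr.2.trans h₁τ⟩
        (abs_le.2 ⟨by linarith [hr.1], by linarith [hr.2]⟩)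
  have estimate_eq : σc t = -((a / (Real.exp (a * T) - 1)) • e (i * T + T)) := by
    have hlaw := h.law (i + 1) t ht (by push_cast; linarith) (by push_cast; linarith)
    rwa [← h.eq_of_le t ht htT, Nat.cast_succ, add_one_mul] at hlaw
  rw [mul_add, Real.exp_add] at error_eq integral_bound
  rw [Real.exp_neg, estimate_eq]
  exact norm_neg_smul_sub_le ha (Real.one_lt_exp_iff.2 (mul_pos ha hT)) (Real.exp_pos _) error_eq
    integral_bound

variable {b : ℝ} (hb : ∀ t ∈ Icc 0 τ, ‖σ t‖ ≤ b)

include hb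

lemma norm_le {t : ℝ} (ht : t ∈ Icc 0 τ) : ‖σc t‖ ≤ Real.exp (-(a * T)) * b := by
  rcases lt_or_ge t T with htT | htT
  · rw [h.eq_zero t ht htT, norm_zero]
    exact mul_nonneg (Real.exp_pos _).le ((norm_nonneg _).trans (hb t ht))
  · simpa using h.norm_sub_exp_smul_le ha hT ht htT (v := 0) (D := b)
      fun r hr _ => by simpa using hb r hr

lemma norm_sub_le {L : ℝ} (hL : 0 ≤ L)
    (hσ : ∀ t₁ ∈ Icc 0 τ, ∀ t₂ ∈ Icc 0 τ, ‖σ t₁ - σ t₂‖ ≤ L * |t₁ - t₂|) {t : ℝ}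
    (ht : t ∈ Icc 0 τ) (htT : T ≤ t) :
    ‖σ t - σc t‖ ≤ 2 * T * L + (1 - Real.exp (-(a * T))) * b := by
  have exp_le : Real.exp (-(a * T)) ≤ 1 :=
    Real.exp_le_one_iff.2 (neg_nonpos.2 (mul_pos ha hT).le)
  have average_bound : ‖σc t - Real.exp (-(a * T)) • σ t‖ ≤ L * (2 * T) :=
    (h.norm_sub_exp_smul_le ha hT ht htT fun r hr hrt =>
      (hσ r hr t ht).trans (mul_le_mul_of_nonneg_left hrt hL)).trans
        (mul_le_of_le_one_left (by positivity) exp_le)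
  have bias_bound : ‖(1 - Real.exp (-(a * T))) • σ t‖ ≤ (1 - Real.exp (-(a * T))) * b := by
    rw [norm_smul, Real.norm_of_nonneg (sub_nonneg.2 exp_le)]
    exact mul_le_mul_of_nonneg_left (hb t ht) (sub_nonneg.2 exp_le)
  calc ‖σ t - σc t‖
      = ‖(1 - Real.exp (-(a * T))) • σ t - (σc t - Real.exp (-(a * T)) • σ t)‖ := by
        congr 1
        module
    _ ≤ (1 - Real.exp (-(a * T))) * b + L * (2 * T) :=
        (_root_.norm_sub_le _ _).trans (add_le_add bias_bound average_bound)
    _ = 2 * T * L + (1 - Real.exp (-(a * T))) * b := by ring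

end IsSampledEstimate

end Sampling

/-! ### Bounds that improve themselves -/

lemma forall_lt_of_self_improving {φ : ℝ → ℝ} {b τ : ℝ} (hφ : ContinuousOn φ (Icc 0 τ))
    (h0 : φ 0 < b) (hstep : ∀ t ∈ Icc 0 τ, (∀ r ∈ Icc 0 t, φ r ≤ b) → φ t < b) :
    ∀ t ∈ Icc 0 τ, φ t < b := by
  by_contra! ⟨t₁, ht₁, hbt₁⟩
  have compact : IsCompact (Icc 0 τ ∩ φ ⁻¹' Ici b) :=
    isCompact_Icc.of_isClosed_subset (hφ.preimage_isClosed_of_isClosed isClosed_Icc isClosed_Ici)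
      inter_subset_left
  obtain ⟨t, ⟨ht, hbt⟩, ht_least⟩ := compact.exists_isLeast ⟨t₁, ht₁, hbt₁⟩
  have first_time : ∀ r ∈ Icc 0 t, b ≤ φ r → r = t := fun r hr hbr =>
    le_antisymm hr.2 (ht_least ⟨⟨hr.1, hr.2.trans ht.2⟩, hbr⟩)
  obtain ⟨r, hr, hφr⟩ := intermediate_value_Icc ht.1 (hφ.mono (Icc_subset_Icc_right ht.2))
    ⟨h0.le, hbt⟩
  obtain rfl := first_time r hr hφr.ge
  refine (hstep r ht fun q hq => ?_).not_ge hbt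
  by_contra! hlt
  rw [first_time q hq hlt.le, hφr] at hlt
  exact lt_irrefl b hlt

lemma forall_le_div_of_contraction {φ : ℝ → ℝ} {κ d τ : ℝ} (hφ : ContinuousOn φ (Icc 0 τ))
    (hκ : κ < 1)
    (hstep : ∀ E, (∀ t ∈ Icc 0 τ, φ t ≤ E) → ∀ t ∈ Icc 0 τ, φ t ≤ κ * E + d) :
    ∀ t ∈ Icc 0 τ, φ t ≤ d / (1 - κ) := by
  intro t ht
  obtain ⟨t_max, ht_max, hmax⟩ := isCompact_Icc.exists_isMaxOn ⟨t, ht⟩ hφ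
  have le_max : ∀ t ∈ Icc 0 τ, φ t ≤ φ t_max := fun t ht => hmax ht
  have max_le := hstep _ le_max t_max ht_max
  refine (le_max t ht).trans ?_
  rw [le_div_iff₀ (by linarith)]
  linarith

namespace Setup

section Loops

variable {n m p s nH nF : ℕ} {S : Setup n m p s nH nF} {θ : ℝ → Vec s} {τ b : ℝ}

/-! ### Responses of the constituent systems -/

lemma mapHxm_of_solvesOn {v : ℝ → Vec m} {y : ℝ → Vec n}
    (h : SolvesOn (Icc 0 τ) y 0 (fun t => S.Am (θ t) (y t) + S.B (θ t) (v t))) :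
    S.mapHxm (Icc 0 τ) θ v y :=
  ⟨y, h, fun t _ => by simp⟩

lemma mapHxum_of_solvesOn {v : ℝ → Vec (n - m)} {y : ℝ → Vec n}
    (h : SolvesOn (Icc 0 τ) y 0 (fun t => S.Am (θ t) (y t) + S.Bu (θ t) (v t))) :
    S.mapHxum (Icc 0 τ) θ v y :=
  ⟨y, h, fun t _ => by simp⟩

lemma continuousOn_of_mapC (hθ : θ ∈ S.adm) (hτ : 0 ≤ τ) {v c : ℝ → Vec m}
    (hc : S.mapC (Icc 0 τ) θ v c) : ContinuousOn c (Icc 0 τ) :=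
  StateSpace.continuousOn_of_map hτ (filter_contOn (S := S)).2.2.1 hθ hc continuousOn_const

namespace Assumptions

variable (hS : S.Assumptions) (hθ : θ ∈ S.adm) (hτ : 0 ≤ τ)

include hS hθ hτ

lemma continuousOn_of_mapHbar {η : ℝ → Vec (n - m)} {h : ℝ → Vec m}
    (hη : ContinuousOn η (Icc 0 τ)) (hh : S.mapHbar (Icc 0 τ) θ η h) : ContinuousOn h (Icc 0 τ) :=
  StateSpace.continuousOn_of_map hτ hS.Hbar_cont.2.2.1 hθ hh
    ((Trajectories.continuousOn_comp hθ hS.Hbar_cont.2.2.2 τ).clm_apply hη)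

lemma exists_measurable_eq_Kr_r :
    ∃ v : ℝ → Vec m, Measurable v ∧ ∀ t ∈ Icc 0 τ, v t = S.Kr (θ t) (S.r t) := by
  obtain ⟨W, W_cont, hW⟩ := exists_continuous_extension hτ
    (Trajectories.continuousOn_comp hθ hS.Kr_cont τ)
  exact ⟨_, measurable_clm_apply W_cont hS.r_meas, fun t ht => by rw [hW t ht]⟩

lemma norm_Gxm_le {η c : ℝ → Vec m} {y : ℝ → Vec n} (hη : ContinuousOn η (Icc 0 τ))
    (hc : S.mapC (Icc 0 τ) θ η c)
    (hy : SolvesOn (Icc 0 τ) y 0 fun t => S.Am (θ t) (y t) + S.B (θ t) (η t - c t))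
    (hb : ∀ t ∈ Icc 0 τ, ‖η t‖ ≤ b) {t : ℝ} (ht : t ∈ Icc 0 τ) : ‖y t‖ ≤ S.gGxm * b := by
  obtain ⟨η', η'_cont, hη'⟩ := exists_continuous_extension hτ hη
  have response : S.mapGxm (Icc 0 τ) θ η' y :=
    ⟨fun t => η' t - c t, ⟨η', c, fun _ _ => rfl,
      StateSpace.map_congr hc (fun t ht => (hη' t ht).symm) fun _ _ => rfl, fun _ _ => rfl⟩,
      mapHxm_of_solvesOn (hy.congr_rhs fun t ht => by rw [hη' t ht])⟩
  exact hS.ppg_Gxm.norm_le hθ hτ η'_cont.measurable response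
    (fun r hr => by rw [hη' r hr]; exact hb r hr) ht

lemma norm_Gxum_le {η : ℝ → Vec (n - m)} {h c : ℝ → Vec m} {y : ℝ → Vec n}
    (hη : ContinuousOn η (Icc 0 τ)) (hh : S.mapHbar (Icc 0 τ) θ η h)
    (hc : S.mapC (Icc 0 τ) θ h c)
    (hy : SolvesOn (Icc 0 τ) y 0
      fun t => S.Am (θ t) (y t) + (S.Bu (θ t) (η t) - S.B (θ t) (c t)))
    (hb : ∀ t ∈ Icc 0 τ, ‖η t‖ ≤ b) {t : ℝ} (ht : t ∈ Icc 0 τ) : ‖y t‖ ≤ S.gGxum * b := by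
  obtain ⟨η', η'_cont, hη'⟩ := exists_continuous_extension hτ hη
  obtain ⟨z, hz⟩ := exists_solvesOn_linear hτ (Trajectories.continuousOn_comp hθ hS.Am_cont τ)
    ((Trajectories.continuousOn_comp hθ hS.B_cont τ).clm_apply
      (continuousOn_of_mapC hθ hτ hc)) 0
  have unmatched : SolvesOn (Icc 0 τ) (fun t => y t + z t) 0
      fun t => S.Am (θ t) (y t + z t) + S.Bu (θ t) (η' t) := by
    have sum_solves := hy.add hz
    rw [add_zero] at sum_solves
    exact sum_solves.congr_rhs fun t ht => by simp only [hη' t ht, map_add]; abel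
  have response : S.mapGxum (Icc 0 τ) θ η' y :=
    ⟨fun t => y t + z t, z, mapHxum_of_solvesOn unmatched,
      ⟨c, ⟨h, StateSpace.map_congr hh (fun t ht => (hη' t ht).symm) fun _ _ => rfl, hc⟩,
        mapHxm_of_solvesOn hz⟩, fun _ _ => (add_sub_cancel_right _ _).symm⟩
  exact hS.ppg_Gxum.norm_le hθ hτ η'_cont.measurable response
    (fun r hr => by rw [hη' r hr]; exact hb r hr) ht

lemma norm_Hxm_le {v : ℝ → Vec m} {y : ℝ → Vec n} (hv : ContinuousOn v (Icc 0 τ))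
    (hy : S.mapHxm (Icc 0 τ) θ v y) (hb : ∀ t ∈ Icc 0 τ, ‖v t‖ ≤ b) {t : ℝ}
    (ht : t ∈ Icc 0 τ) : ‖y t‖ ≤ S.gHxm * b := by
  obtain ⟨v', v'_cont, hv'⟩ := exists_continuous_extension hτ hv
  exact hS.ppg_Hxm.norm_le hθ hτ v'_cont.measurable
    (StateSpace.map_congr hy (fun t ht => (hv' t ht).symm) fun _ _ => rfl)
    (fun r hr => by rw [hv' r hr]; exact hb r hr) ht

lemma norm_HxmCKr_le {c : ℝ → Vec m} {y : ℝ → Vec n}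
    (hc : S.mapC (Icc 0 τ) θ (fun t => S.Kr (θ t) (S.r t)) c) (hy : S.mapHxm (Icc 0 τ) θ c y)
    {t : ℝ} (ht : t ∈ Icc 0 τ) : ‖y t‖ ≤ S.gHxmCKr * S.rNorm :=
  have response : S.mapHxmCKr (Icc 0 τ) θ S.r y :=
    ⟨c, ⟨fun t => S.Kr (θ t) (S.r t), fun _ _ => rfl, hc⟩, hy⟩
  hS.ppg_HxmCKr.norm_le hθ hτ hS.r_meas response (fun _ hr => hS.norm_r_le hr.1) ht

lemma norm_Hbar_le {η : ℝ → Vec (n - m)} {h : ℝ → Vec m} (hη : ContinuousOn η (Icc 0 τ))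
    (hh : S.mapHbar (Icc 0 τ) θ η h) (hb : ∀ t ∈ Icc 0 τ, ‖η t‖ ≤ b) {t : ℝ}
    (ht : t ∈ Icc 0 τ) : ‖h t‖ ≤ S.gHbar * b := by
  obtain ⟨η', η'_cont, hη'⟩ := exists_continuous_extension hτ hη
  exact hS.ppg_Hbar.norm_le hθ hτ η'_cont.measurable
    (StateSpace.map_congr hh (fun t ht => (hη' t ht).symm) fun _ _ => rfl)
    (fun r hr => by rw [hη' r hr]; exact hb r hr) ht

lemma norm_ωCHbar_le {η : ℝ → Vec (n - m)} {h c : ℝ → Vec m} (hη : ContinuousOn η (Icc 0 τ))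
    (hh : S.mapHbar (Icc 0 τ) θ η h) (hc : S.mapC (Icc 0 τ) θ h c)
    (hb : ∀ t ∈ Icc 0 τ, ‖η t‖ ≤ b) {t : ℝ} (ht : t ∈ Icc 0 τ) :
    ‖S.ωinv (c t)‖ ≤ S.gCHbar * b := by
  obtain ⟨η', η'_cont, hη'⟩ := exists_continuous_extension hτ hη
  have response : S.mapωCHbar (Icc 0 τ) θ η' (fun t => S.ωinv (c t)) :=
    ⟨h, StateSpace.map_congr hh (fun t ht => (hη' t ht).symm) fun _ _ => rfl, c, hc,
      fun _ _ => rfl⟩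
  exact hS.ppg_CHbar.norm_le (y := fun t => S.ωinv (c t)) hθ hτ η'_cont.measurable response
    (fun r hr => by rw [hη' r hr]; exact hb r hr) ht

lemma norm_free_le {x : ℝ → Vec n} {x₀ : Vec n}
    (hx : SolvesOn (Icc 0 τ) x x₀ (fun t => S.Am (θ t) (x t))) {t : ℝ} (ht : t ∈ Icc 0 τ) :
    ‖x t‖ ≤ √(lamMax S.Θ S.P / lamMin S.Θ S.P) * ‖x₀‖ := by
  have hsolves : SolvesOn (Icc 0 τ) x x₀
      (fun t => S.Am (θ t) (x t) + (0 : Mat n 0) ((fun _ : ℝ => 0) t)) :=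
    hx.congr_rhs fun t _ => by simp
  have hle := hS.lyap.norm_le_add_betaInf_mul (B := fun _ => (0 : Mat n 0)) (v := fun _ => 0)
    (b := 0) isCompact_Θ continuousOn_const hθ le_rfl
    ((hx.continuousOn hτ).mono (Icc_subset_Icc_right ht.2))
    (fun r hr => hsolves.hasDerivWithinAt_linear
      (Trajectories.continuousOn_comp hθ hS.Am_cont τ) continuousOn_const
      ⟨hr.1, hr.2.trans_le ht.2⟩ continuousWithinAt_const)
    le_rfl (fun r _ => by simp) ht.1
  rwa [mul_zero, add_zero, hx.zero_apply ⟨le_rfl, hτ⟩] at hle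

end Assumptions

/-! ### Filtered loops -/

/-- The loop in which the state `e` is driven by a disturbance `g` and by the output `c` of the
filter `𝓒`, whose input combines the matched and unmatched components `B†g` and `Bu†g` of the
disturbance with a signal `v`. The reference system has this form with `g` the uncertainty along
its state, `v = Kr r` and `c = -ω ur`; the adaptive system has it with a perturbed `v`. -/
structure IsFilteredLoop (S : Setup n m p s nH nF) (τ : ℝ) (θ : ℝ → Vec s) (g : ℝ → Vec n)
    (v : ℝ → Vec m) (e₀ : Vec n) (e : ℝ → Vec n) (c : ℝ → Vec m) : Prop where
  state : SolvesOn (Icc 0 τ) e e₀ fun t => S.Am (θ t) (e t) - S.B (θ t) (c t) + g t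
  filter : ∃ h, S.mapHbar (Icc 0 τ) θ (fun t => S.Bud (θ t) (g t)) h ∧
    S.mapC (Icc 0 τ) θ (fun t => S.Bd (θ t) (g t) + h t - v t) c

namespace IsFilteredLoop

lemma sub {g₁ g₂ e₁ e₂ : ℝ → Vec n} {v₁ v₂ c₁ c₂ : ℝ → Vec m} {e₀₁ e₀₂ : Vec n}
    (h₁ : S.IsFilteredLoop τ θ g₁ v₁ e₀₁ e₁ c₁) (h₂ : S.IsFilteredLoop τ θ g₂ v₂ e₀₂ e₂ c₂) :
    S.IsFilteredLoop τ θ (fun t => g₁ t - g₂ t) (fun t => v₁ t - v₂ t) (e₀₁ - e₀₂)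
      (fun t => e₁ t - e₂ t) (fun t => c₁ t - c₂ t) := by
  obtain ⟨ζ₁, hζ₁, hc₁⟩ := h₁.filter
  obtain ⟨ζ₂, hζ₂, hc₂⟩ := h₂.filter
  refine ⟨(h₁.state.sub h₂.state).congr_rhs fun t _ => ?_, fun t => ζ₁ t - ζ₂ t,
    StateSpace.map_congr (StateSpace.map_sub hζ₁ hζ₂) (fun t _ => (map_sub _ _ _).symm)
      fun _ _ => rfl,
    StateSpace.map_congr (StateSpace.map_sub hc₁ hc₂) (fun t _ => ?_) fun _ _ => rfl⟩
  all_goals simp only [map_sub]; abel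

variable {g e : ℝ → Vec n} {v c : ℝ → Vec m} {e₀ : Vec n} {b₁ b₂ b₃ : ℝ}
  (h : S.IsFilteredLoop τ θ g v e₀ e c) (hS : S.Assumptions) (hθ : θ ∈ S.adm) (hτ : 0 ≤ τ)

include h hτ

lemma filter_zero : c 0 = 0 := by
  have h0 : (0 : ℝ) ∈ Icc 0 τ := left_mem_Icc.2 hτ
  obtain ⟨_, -, z, hz, hcz⟩ := h.filter
  rw [hcz 0 h0, hz.zero_apply h0, map_zero, zero_add]
  rfl

include hθ

lemma continuousOn_filter : ContinuousOn c (Icc 0 τ) := by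
  obtain ⟨_, -, hc⟩ := h.filter
  exact continuousOn_of_mapC hθ hτ hc

variable (hg : ContinuousOn g (Icc 0 τ))

include hS hg

lemma exists_filter_decomposition : ∃ ζ c₁ c₂,
    S.mapC (Icc 0 τ) θ (fun t => S.Bd (θ t) (g t)) c₁ ∧
    S.mapHbar (Icc 0 τ) θ (fun t => S.Bud (θ t) (g t)) ζ ∧ S.mapC (Icc 0 τ) θ ζ c₂ ∧
    S.mapC (Icc 0 τ) θ v (fun t => c₁ t + c₂ t - c t) := by
  obtain ⟨ζ, hζ, hc⟩ := h.filter
  have hBd := (Trajectories.continuousOn_comp hθ hS.Bd_cont τ).clm_apply hg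
  have hBud := (Trajectories.continuousOn_comp hθ hS.Bud_cont τ).clm_apply hg
  obtain ⟨c₁, hc₁, -⟩ := StateSpace.exists_continuous_map hτ (filter_contOn (S := S)) hθ hBd
  obtain ⟨c₂, hc₂, -⟩ := StateSpace.exists_continuous_map hτ (filter_contOn (S := S)) hθ
    (hS.continuousOn_of_mapHbar hθ hτ hBud hζ)
  exact ⟨ζ, c₁, c₂, hc₁, hζ, hc₂, StateSpace.map_congr
    (StateSpace.map_sub (StateSpace.map_add hc₁ hc₂) hc) (fun t _ => by abel) fun _ _ => rfl⟩

variable (hb₁ : ∀ t ∈ Icc 0 τ, ‖S.Bd (θ t) (g t)‖ ≤ b₁)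
  (hb₂ : ∀ t ∈ Icc 0 τ, ‖S.Bud (θ t) (g t)‖ ≤ b₂)

include hb₁ hb₂

/- By linearity `e` is the sum of the `𝓖xm`-response to `B†g`, the `𝓖xum`-response to `Bu†g`, the
`𝓗xm 𝓒`-response to `v` and the free motion from `e₀`. -/
theorem norm_state_le
    (hv : ∀ cv y, S.mapC (Icc 0 τ) θ v cv → S.mapHxm (Icc 0 τ) θ cv y →
      ∀ t ∈ Icc 0 τ, ‖y t‖ ≤ b₃) {t : ℝ} (ht : t ∈ Icc 0 τ) :
    ‖e t‖ ≤ S.gGxm * b₁ + S.gGxum * b₂ + b₃ + √(lamMax S.Θ S.P / lamMin S.Θ S.P) * ‖e₀‖ := by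
  obtain ⟨ζ, c₁, c₂, hc₁, hζ, hc₂, hcv⟩ := h.exists_filter_decomposition hS hθ hτ hg
  have hBd := (Trajectories.continuousOn_comp hθ hS.Bd_cont τ).clm_apply hg
  have hBud := (Trajectories.continuousOn_comp hθ hS.Bud_cont τ).clm_apply hg
  have hA := Trajectories.continuousOn_comp hθ hS.Am_cont τ
  have hB := Trajectories.continuousOn_comp hθ hS.B_cont τ
  have hBu := Trajectories.continuousOn_comp hθ hS.Bu_cont τ
  obtain ⟨y₁, hy₁⟩ := exists_solvesOn_linear hτ hA
    (hB.clm_apply (hBd.sub (continuousOn_of_mapC hθ hτ hc₁))) 0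
  obtain ⟨y₂, hy₂⟩ := exists_solvesOn_linear hτ hA
    ((hBu.clm_apply hBud).sub (hB.clm_apply (continuousOn_of_mapC hθ hτ hc₂))) 0
  obtain ⟨y₀, hy₀⟩ := exists_solvesOn_linear hτ hA continuousOn_const e₀ (g := fun _ => 0)
  simp only [add_zero] at hy₀
  have hy₃ : SolvesOn (Icc 0 τ) (fun t => e t - y₀ t - y₁ t - y₂ t) 0 fun t =>
      S.Am (θ t) (e t - y₀ t - y₁ t - y₂ t) + S.B (θ t) (c₁ t + c₂ t - c t) := by
    have remainder := ((h.state.sub hy₀).sub hy₁).sub hy₂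
    simp only [sub_self] at remainder
    refine remainder.congr_rhs fun t ht => ?_
    rw [← hS.B_Bd_add_Bu_Bud (mem_Θ hθ ht.1) (g t)]
    simp only [map_sub, map_add, Pi.sub_apply]
    abel
  have sum_eq : e t = y₁ t + y₂ t + (e t - y₀ t - y₁ t - y₂ t) + y₀ t := by abel
  rw [sum_eq]
  exact norm_add_le_of_le (norm_add_le_of_le (norm_add_le_of_le
    (hS.norm_Gxm_le hθ hτ hBd hc₁ hy₁ hb₁ ht) (hS.norm_Gxum_le hθ hτ hBud hζ hc₂ hy₂ hb₂ ht))
    (hv _ _ hcv (mapHxm_of_solvesOn hy₃) t ht)) (hS.norm_free_le hθ hτ hy₀ ht)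

theorem norm_ωinv_filter_le
    (hv : ∀ cv, S.mapC (Icc 0 τ) θ v cv → ∀ t ∈ Icc 0 τ, ‖S.ωinv (cv t)‖ ≤ b₃) {t : ℝ}
    (ht : t ∈ Icc 0 τ) : ‖S.ωinv (c t)‖ ≤ S.l1ωC * b₁ + S.gCHbar * b₂ + b₃ := by
  obtain ⟨ζ, c₁, c₂, hc₁, hζ, hc₂, hcv⟩ := h.exists_filter_decomposition hS hθ hτ hg
  have hBd := (Trajectories.continuousOn_comp hθ hS.Bd_cont τ).clm_apply hg
  have hBud := (Trajectories.continuousOn_comp hθ hS.Bud_cont τ).clm_apply hg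
  obtain ⟨η, η_cont, hη⟩ := exists_continuous_extension hτ hBd
  have matched : ‖S.ωinv (c₁ t)‖ ≤ S.l1ωC * b₁ :=
    hS.norm_ωC_le hθ hτ η_cont.measurable
      (StateSpace.map_congr hc₁ (fun t ht => (hη t ht).symm) fun _ _ => rfl)
      (fun r hr => by rw [hη r hr]; exact hb₁ r hr) ht
  have sum_eq : S.ωinv (c t) =
      S.ωinv (c₁ t) + S.ωinv (c₂ t) - S.ωinv (c₁ t + c₂ t - c t) := by
    simp only [map_sub, map_add]; abel
  rw [sum_eq]
  exact norm_sub_le_of_le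
    (norm_add_le_of_le matched (hS.norm_ωCHbar_le hθ hτ hBud hζ hc₂ hb₂ ht)) (hv _ hcv t ht)

lemma norm_ωinv_filter_le_of_measurable {v' : ℝ → Vec m} (hv' : Measurable v')
    (hvv' : ∀ t ∈ Icc 0 τ, v' t = v t) (hb₃ : ∀ t ∈ Icc 0 τ, ‖v t‖ ≤ b₃) {t : ℝ}
    (ht : t ∈ Icc 0 τ) : ‖S.ωinv (c t)‖ ≤ S.l1ωC * (b₁ + S.gHbar * b₂ + b₃) := by
  obtain ⟨ζ, hζ, hc⟩ := h.filter
  have hBd := (Trajectories.continuousOn_comp hθ hS.Bd_cont τ).clm_apply hg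
  have hBud := (Trajectories.continuousOn_comp hθ hS.Bud_cont τ).clm_apply hg
  obtain ⟨w, w_cont, hw⟩ := exists_continuous_extension hτ
    (hBd.add (hS.continuousOn_of_mapHbar hθ hτ hBud hζ))
  have input_eq : ∀ t ∈ Icc 0 τ, S.Bd (θ t) (g t) + ζ t - v t = w t - v' t :=
    fun t ht => by rw [hw t ht, hvv' t ht, Pi.add_apply]
  refine hS.norm_ωC_le hθ hτ (w_cont.measurable.sub hv')
    (StateSpace.map_congr hc input_eq fun _ _ => rfl) (fun r hr => ?_) ht
  rw [Pi.sub_apply, ← input_eq r hr]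
  exact norm_sub_le_of_le
    (norm_add_le_of_le (hb₁ r hr) (hS.norm_Hbar_le hθ hτ hBud hζ hb₂ hr)) (hb₃ r hr)

end IsFilteredLoop

end Loops

section ClosedLoop

variable {n m p s nH nF : ℕ} {S : Setup n m p s nH nF} {f : ℝ → Vec n → Vec n}
  {θ : ℝ → Vec s} {T τ δ R : ℝ} {x₀ xh₀ : Vec n} {x : ℝ → Vec n} {u : ℝ → Vec m}
  {y : ℝ → Vec p}

/-! ### The adaptive closed loop -/

/-- The total uncertainty `B(θ)(ω - I)u + f̄(t, x)` along a solution: what the predictor, driven by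
the nominal input `B(θ)u`, does not account for. -/
noncomputable def sigma (S : Setup n m p s nH nF) (f : ℝ → Vec n → Vec n) (θ : ℝ → Vec s)
    (x : ℝ → Vec n) (u : ℝ → Vec m) (t : ℝ) : Vec n :=
  S.B (θ t) (S.ω (u t) - u t) + S.fbar f θ t (x t)

/-- The Lipschitz constant of the total uncertainty along solutions with `‖x‖ ≤ δ`, `‖u‖ ≤ R`,
`‖ẋ‖ ≤ bx` and `‖u̇‖ ≤ bu`. -/
noncomputable def sigmaRate (S : Setup n m p s nH nF) (δ R bx bu : ℝ) : ℝ :=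
  ‖S.ω - ContinuousLinearMap.id ℝ (Vec m)‖ * (S.bB * bu + S.LB * S.bθ' * R)
    + S.lfbar δ + S.Lfbar δ * bx

lemma plant_rhs_eq (t : ℝ) (v : Vec n) (w : Vec m) :
    S.A (θ t) v + S.B (θ t) (S.ω (S.Kx (θ t) v + w)) + f t v =
      S.Am (θ t) v + S.B (θ t) (S.ω w) + S.fbar f θ t v := by
  simp only [fbar, Am, add_apply, ContinuousLinearMap.comp_apply, map_add, map_sub]
  abel

namespace Assumptions

variable (hS : S.Assumptions) (hθ : θ ∈ S.adm)

include hS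

lemma Bd_sigma {t : ℝ} (ht : θ t ∈ S.Θ) :
    S.Bd (θ t) (S.sigma f θ x u t) = S.ω (u t) - u t + S.Bd (θ t) (S.fbar f θ t (x t)) := by
  rw [sigma, map_add, hS.Bd_B ht]

lemma Bud_sigma {t : ℝ} (ht : θ t ∈ S.Θ) :
    S.Bud (θ t) (S.sigma f θ x u t) = S.Bud (θ t) (S.fbar f θ t (x t)) := by
  rw [sigma, map_add, hS.Bud_B ht, zero_add]

lemma bias_nonneg (hT : 0 < T) (hσ : 0 ≤ S.bσ δ R) :
    0 ≤ (1 - Real.exp (-(S.a * T))) * S.bσ δ R :=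
  mul_nonneg
    (sub_nonneg.2 (Real.exp_le_one_iff.2 (neg_nonpos.2 (mul_pos hS.a_pos hT).le))) hσ

lemma le_bσtil (hn : 0 < n) (hT : 0 < T)
    (hL : 0 ≤ S.sigmaRate δ R (S.bx' δ R) (S.bu' T δ R)) (hσ : 0 ≤ S.bσ δ R) :
    2 * T * S.sigmaRate δ R (S.bx' δ R) (S.bu' T δ R)
      + (1 - Real.exp (-(S.a * T))) * S.bσ δ R ≤ S.bσtil T δ R := by
  have one_le_sqrt : 1 ≤ √(n : ℝ) := Real.one_le_sqrt.2 (by exact_mod_cast hn)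
  have := hS.bias_nonneg hT hσ
  refine (le_mul_of_one_le_left (by positivity) one_le_sqrt).trans_eq ?_
  rw [bσtil, ← sigmaRate]
  ring

lemma bσtil_nonneg (hT : 0 < T)
    (hL : 0 ≤ S.sigmaRate δ R (S.bx' δ R) (S.bu' T δ R)) (hσ : 0 ≤ S.bσ δ R) :
    0 ≤ S.bσtil T δ R := by
  rw [bσtil, ← sigmaRate, mul_right_comm _ (√(n : ℝ)) (S.bσ δ R)]
  have := hS.bias_nonneg hT hσ
  positivity

include hθ

lemma lfbar_nonneg (hδ : 0 ≤ δ) : 0 ≤ S.lfbar δ := by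
  have := hS.rate_nonneg hθ
  have := maxωI_nonneg (S := S)
  have := bB_nonneg (S := S)
  have := bKx_nonneg (S := S)
  have := hS.LB_pos
  have := hS.LKx_pos
  have := hS.lf_pos
  rw [lfbar]
  positivity

lemma sigmaRate_nonneg (hδ : 0 < δ) (hR : 0 ≤ R) {bx bu : ℝ} (hbx : 0 ≤ bx) (hbu : 0 ≤ bu) :
    0 ≤ S.sigmaRate δ R bx bu := by
  have := hS.rate_nonneg hθ
  have := bB_nonneg (S := S)
  have := hS.LB_pos
  have := hS.lfbar_nonneg hθ hδ.le
  have := hS.Lfbar_nonneg hδ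
  rw [sigmaRate]
  positivity

end Assumptions

namespace Uncertainty

variable (hf : S.Uncertainty f) (hS : S.Assumptions) (hθ : θ ∈ S.adm)

include hf hS hθ

lemma continuousOn_sigma (hx : ContinuousOn x (Icc 0 τ)) (hu : ContinuousOn u (Icc 0 τ)) :
    ContinuousOn (S.sigma f θ x u) (Icc 0 τ) :=
  ((Trajectories.continuousOn_comp hθ hS.B_cont τ).clm_apply
    ((S.ω.continuous.comp_continuousOn hu).sub hu)).add (hf.continuousOn_fbar hS hθ hx)

variable (hδ : 0 < δ)

include hδ

lemma norm_sigma_le {t : ℝ} (ht : 0 ≤ t) (hx : ‖x t‖ ≤ δ) (hu : ‖u t‖ ≤ R) :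
    ‖S.sigma f θ x u t‖ ≤ S.bσ δ R :=
  calc ‖S.sigma f θ x u t‖
      ≤ S.bB * S.maxωI * ‖u t‖ + (S.Lf δ * δ + S.bf0 + S.bB * S.maxωI * S.bKx * δ) :=
        norm_add_le_of_le (hS.norm_B_ωI_apply_le (mem_Θ hθ ht) (u t))
          (hf.norm_fbar_le hS hθ hδ ht hx)
    _ ≤ S.bB * S.maxωI * R + (S.Lf δ * δ + S.bf0 + S.bB * S.maxωI * S.bKx * δ) :=
        add_le_add_left
          (mul_le_mul_of_nonneg_left hu (mul_nonneg bB_nonneg maxωI_nonneg)) _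
    _ = S.bσ δ R := by
        rw [bσ]
        ring

lemma norm_sigma_sub_le {t₁ t₂ : ℝ} (h₁ : 0 ≤ t₁) (h₂ : 0 ≤ t₂) (hx₁ : ‖x t₁‖ ≤ δ)
    (hx₂ : ‖x t₂‖ ≤ δ) (hu₂ : ‖u t₂‖ ≤ R) {bx bu : ℝ} (hx : ‖x t₁ - x t₂‖ ≤ bx * |t₁ - t₂|)
    (hu : ‖u t₁ - u t₂‖ ≤ bu * |t₁ - t₂|) :
    ‖S.sigma f θ x u t₁ - S.sigma f θ x u t₂‖ ≤ S.sigmaRate δ R bx bu * |t₁ - t₂| := by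
  set W := S.ω - ContinuousLinearMap.id ℝ (Vec m) with hW
  have hθ₁ := mem_Θ hθ h₁
  have hθ₂ := mem_Θ hθ h₂
  have decomposition : S.sigma f θ x u t₁ - S.sigma f θ x u t₂ =
      (S.B (θ t₁) (W (u t₁ - u t₂)) + (S.B (θ t₁) - S.B (θ t₂)) (W (u t₂))) +
      ((S.fbar f θ t₁ (x t₁) - S.fbar f θ t₁ (x t₂)) +
        (S.fbar f θ t₁ (x t₂) - S.fbar f θ t₂ (x t₂))) := by
    simp only [sigma, hW, sub_apply, ContinuousLinearMap.id_apply, map_sub]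
    abel
  have input_change : ‖S.B (θ t₁) (W (u t₁ - u t₂))‖ ≤ S.bB * (‖W‖ * (bu * |t₁ - t₂|)) :=
    ContinuousLinearMap.le_of_opNorm_le_of_le _ (hS.norm_B_le hθ₁) (W.le_opNorm_of_le hu)
  have gain_change : ‖(S.B (θ t₁) - S.B (θ t₂)) (W (u t₂))‖ ≤
      S.LB * (S.bθ' * |t₁ - t₂|) * (‖W‖ * R) :=
    ContinuousLinearMap.le_of_opNorm_le_of_le _
      ((hS.B_lip _ hθ₁ _ hθ₂).trans (mul_le_mul_of_nonneg_left
        (Trajectories.norm_sub_le hS.rate_bound hθ h₂ h₁) hS.LB_pos.le))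
      (W.le_opNorm_of_le hu₂)
  have state_change : ‖S.fbar f θ t₁ (x t₁) - S.fbar f θ t₁ (x t₂)‖ ≤
      S.Lfbar δ * (bx * |t₁ - t₂|) :=
    (hf.norm_fbar_sub_le hS hθ hδ h₁ hx₁ hx₂).trans
      (mul_le_mul_of_nonneg_left hx (hS.Lfbar_nonneg hδ))
  have time_change := hf.norm_fbar_time_sub_le hS hθ h₁ h₂ hx₂
  calc ‖S.sigma f θ x u t₁ - S.sigma f θ x u t₂‖
      ≤ (S.bB * (‖W‖ * (bu * |t₁ - t₂|)) + S.LB * (S.bθ' * |t₁ - t₂|) * (‖W‖ * R)) +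
          (S.Lfbar δ * (bx * |t₁ - t₂|) + S.lfbar δ * |t₁ - t₂|) := by
        rw [decomposition]
        exact norm_add_le_of_le (norm_add_le_of_le input_change gain_change)
          (norm_add_le_of_le state_change time_change)
    _ = S.sigmaRate δ R bx bu * |t₁ - t₂| := by
        rw [sigmaRate]
        ring

lemma norm_plant_rhs_le {t : ℝ} (ht : 0 ≤ t) (hx : ‖x t‖ ≤ δ) (hu : ‖u t‖ ≤ R) :
    ‖S.A (θ t) (x t) + S.B (θ t) (S.ω (S.Kx (θ t) (x t) + u t)) + f t (x t)‖ ≤ S.bx' δ R := by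
  have hθt := mem_Θ hθ ht
  have nominal : ‖S.Am (θ t) (x t)‖ ≤ S.bAm * δ :=
    ContinuousLinearMap.le_of_opNorm_le_of_le _ (hS.norm_Am_le hθt) hx
  have input : ‖S.B (θ t) (S.ω (u t))‖ ≤ S.bB * (S.maxω * R) :=
    ContinuousLinearMap.le_of_opNorm_le_of_le _ (hS.norm_B_le hθt)
      (ContinuousLinearMap.le_of_opNorm_le_of_le _ hS.norm_ω_le hu)
  rw [plant_rhs_eq]
  refine (norm_add_le_of_le (norm_add_le_of_le nominal input)
    (hf.norm_fbar_le hS hθ hδ ht hx)).trans_eq ?_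
  rw [bx']
  ring

end Uncertainty

/-- The adaptive closed loop on `[0, τ]` in terms of the prediction error `e`, the sampled estimate
`σc` of the total uncertainty and its feedforward response `η`. -/
structure IsErrorLoop (S : Setup n m p s nH nF) (T τ : ℝ) (f : ℝ → Vec n → Vec n)
    (θ : ℝ → Vec s) (x₀ e₀ : Vec n) (x : ℝ → Vec n) (u : ℝ → Vec m) (e σh σc : ℝ → Vec n)
    (η : ℝ → Vec m) : Prop where
  estimate : IsSampledEstimate S.a T τ e e₀ (S.sigma f θ x u) σh σc
  plant : SolvesOn (Icc 0 τ) x x₀ fun t =>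
    S.A (θ t) (x t) + S.B (θ t) (S.ω (S.Kx (θ t) (x t) + u t)) + f t (x t)
  feedforward : S.mapHbar (Icc 0 τ) θ (fun t => S.Bud (θ t) (σc t)) η
  control : SolvesOn (Icc 0 τ) u 0 fun t =>
    -(S.K (u t + (S.Bd (θ t) (σc t) + η t - S.Kr (θ t) (S.r t))))

lemma AdaptiveSolution.exists_isErrorLoop (hS : S.Assumptions) (hf : S.Uncertainty f)
    (hθ : θ ∈ S.adm) (hτ : 0 ≤ τ) (h : S.AdaptiveSolution T f θ x₀ xh₀ (Icc 0 τ) x u y) :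
    ∃ e σh σc η, S.IsErrorLoop T τ f θ x₀ (xh₀ - x₀) x u e σh σc η := by
  obtain ⟨xh, σh, σc, σm, σum, η, plant, -, predictor, law, σc_init, σc_eq, split, hη, control⟩ := h
  have σm_eq : ∀ t ∈ Icc 0 τ, σm t = S.Bd (θ t) (σc t) := fun t ht => by
    rw [← split t ht, hS.Bd_decomp (mem_Θ hθ ht.1)]
  have σum_eq : ∀ t ∈ Icc 0 τ, σum t = S.Bud (θ t) (σc t) := fun t ht => by
    rw [← split t ht, hS.Bud_decomp (mem_Θ hθ ht.1)]
  have error_eq : SolvesOn (Icc 0 τ) (fun t => xh t - x t) (xh₀ - x₀)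
      (fun t => σh t - S.sigma f θ x u t - S.a • (xh t - x t)) :=
    (predictor.sub plant).congr_rhs fun t _ => by
      simp only [plant_rhs_eq, sigma, map_sub]
      abel
  have σ_cont := hf.continuousOn_sigma hS hθ (plant.continuousOn hτ) (control.continuousOn hτ)
  refine ⟨_, σh, σc, η, ⟨σ_cont, error_eq, law, σc_init, σc_eq⟩, plant,
    StateSpace.map_congr hη σum_eq fun _ _ => rfl, control.congr_rhs fun t ht => ?_⟩
  rw [σm_eq t ht, add_sub_assoc, add_assoc, add_sub_assoc]

lemma mapF_of_mapHbar_of_mapC {J : Set ℝ} {v : ℝ → Vec n} {η z : ℝ → Vec m}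
    (hη : S.mapHbar J θ (fun t => S.Bud (θ t) (v t)) η)
    (hz : S.mapC J θ (fun t => S.Bd (θ t) (v t) + η t) z) : S.mapF J θ v z :=
  ⟨_, ⟨_, η, fun _ _ => rfl, ⟨_, fun _ _ => rfl, hη⟩, fun _ _ => rfl⟩, hz⟩

/- The control law integrates `-K (u + w)`, so `-K⁻¹ u` is the state of the filter `𝓒`. -/
lemma Assumptions.mapC_of_control (hS : S.Assumptions) {w : ℝ → Vec m}
    (hu : SolvesOn (Icc 0 τ) u 0 (fun t => -(S.K (u t + w t)))) :
    S.mapC (Icc 0 τ) θ (fun t => w t - (S.ω (u t) - u t)) (fun t => -(S.ω (u t))) := by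
  obtain ⟨e, he⟩ := exists_equiv_of_injective hS.K_inj
  have K_symm : ∀ v, S.K (e.symm v) = v := fun v => by
    rw [← he, ContinuousLinearEquiv.coe_coe, e.apply_symm_apply]
  have symm_K : ∀ v, e.symm (S.K v) = v := fun v => by
    rw [← he, ContinuousLinearEquiv.coe_coe, e.symm_apply_apply]
  have state_eq := (hu.clm (e.symm : Mat m m)).const_smul (-1)
  simp only [ContinuousLinearEquiv.coe_coe, map_zero, smul_zero, map_neg, symm_K] at state_eq
  refine ⟨_, state_eq.congr_rhs fun t _ => ?_, fun t _ => ?_⟩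
  · simp only [filter, ContinuousLinearMap.comp_apply, neg_apply, map_smul, K_symm,
      ContinuousLinearMap.id_apply]
    module
  · simp only [filter, ContinuousLinearMap.comp_apply, map_neg, K_symm, zero_apply, add_zero,
      neg_one_smul]

namespace IsErrorLoop

variable {e₀ : Vec n} {e σh σc : ℝ → Vec n} {η : ℝ → Vec m}
  (h : S.IsErrorLoop T τ f θ x₀ e₀ x u e σh σc η) (hS : S.Assumptions) (hf : S.Uncertainty f)
  (hθ : θ ∈ S.adm) (hn : 0 < n) (hT : 0 < T) (hδ : 0 < δ) (hx : ∀ t ∈ Icc 0 τ, ‖x t‖ ≤ δ)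
  (hu : ∀ t ∈ Icc 0 τ, ‖u t‖ ≤ R)

include h hS hf hθ hn hT hδ hx hu

lemma norm_estimate_le {t : ℝ} (ht : t ∈ Icc 0 τ) : ‖σc t‖ ≤ S.bσhatc T δ R := by
  have sigma_le : ∀ t ∈ Icc 0 τ, ‖S.sigma f θ x u t‖ ≤ S.bσ δ R := fun t ht =>
    hf.norm_sigma_le hS hθ hδ ht.1 (hx t ht) (hu t ht)
  have one_le_sqrt : 1 ≤ √(n : ℝ) := Real.one_le_sqrt.2 (by exact_mod_cast hn)
  exact (h.estimate.norm_le hS.a_pos hT sigma_le ht).trans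
    (mul_le_mul_of_nonneg_right (le_mul_of_one_le_right (Real.exp_pos _).le one_le_sqrt)
      ((norm_nonneg _).trans (sigma_le t ht)))

lemma norm_feedforward_le {t : ℝ} (ht : t ∈ Icc 0 τ) :
    ‖η t‖ ≤ S.gHbar * (S.bBud * S.bσhatc T δ R) := by
  obtain ⟨W, W_cont, hW⟩ := exists_continuous_extension (ht.1.trans ht.2)
    (Trajectories.continuousOn_comp hθ hS.Bud_cont τ)
  have input_eq : ∀ t ∈ Icc 0 τ, S.Bud (θ t) (σc t) =
      W t (hold T (fun i => -((S.a / (Real.exp (S.a * T) - 1)) • e (i * T))) t) := fun t ht => by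
    rw [hW t ht, h.estimate.hold_eq hT ht]
  refine hS.ppg_Hbar.norm_le hθ (ht.1.trans ht.2)
    (measurable_clm_apply W_cont (measurable_hold T _))
    (StateSpace.map_congr h.feedforward input_eq fun _ _ => rfl) (fun r hr => ?_) ht
  rw [← input_eq r hr]
  exact ContinuousLinearMap.le_of_opNorm_le_of_le _ (hS.norm_Bud_le (mem_Θ hθ hr.1))
    (h.norm_estimate_le hS hf hθ hn hT hδ hx hu hr)

lemma norm_control_rhs_le {t : ℝ} (ht : t ∈ Icc 0 τ) :
    ‖-(S.K (u t + (S.Bd (θ t) (σc t) + η t - S.Kr (θ t) (S.r t))))‖ ≤ S.bu' T δ R := by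
  have matched : ‖S.Bd (θ t) (σc t)‖ ≤ S.bBd * S.bσhatc T δ R :=
    ContinuousLinearMap.le_of_opNorm_le_of_le _ (hS.norm_Bd_le (mem_Θ hθ ht.1))
      (h.norm_estimate_le hS hf hθ hn hT hδ hx hu ht)
  have unmatched := h.norm_feedforward_le hS hf hθ hn hT hδ hx hu ht
  have reference : ‖S.Kr (θ t) (S.r t)‖ ≤ S.bKr * S.rNorm :=
    ContinuousLinearMap.le_of_opNorm_le_of_le _ (hS.norm_Kr_le (mem_Θ hθ ht.1))
      (hS.norm_r_le ht.1)
  rw [norm_neg, bu']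
  refine S.K.le_opNorm_of_le ((norm_add_le_of_le (hu t ht)
    (norm_sub_le_of_le (norm_add_le_of_le matched unmatched) reference)).trans_eq ?_)
  ring

lemma sigmaRate_nonneg (hτ : 0 ≤ τ) : 0 ≤ S.sigmaRate δ R (S.bx' δ R) (S.bu' T δ R) := by
  have h0 : (0 : ℝ) ∈ Icc 0 τ := ⟨le_rfl, hτ⟩
  exact hS.sigmaRate_nonneg hθ hδ ((norm_nonneg _).trans (hu 0 h0))
    ((norm_nonneg _).trans (hf.norm_plant_rhs_le hS hθ hδ le_rfl (hx 0 h0) (hu 0 h0)))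
    ((norm_nonneg _).trans (h.norm_control_rhs_le hS hf hθ hn hT hδ hx hu h0))

lemma norm_sigma_sub_le {t₁ t₂ : ℝ} (h₁ : t₁ ∈ Icc 0 τ) (h₂ : t₂ ∈ Icc 0 τ) :
    ‖S.sigma f θ x u t₁ - S.sigma f θ x u t₂‖ ≤
      S.sigmaRate δ R (S.bx' δ R) (S.bu' T δ R) * |t₁ - t₂| :=
  hf.norm_sigma_sub_le hS hθ hδ h₁.1 h₂.1 (hx t₁ h₁) (hx t₂ h₂) (hu t₂ h₂)
    (h.plant.norm_sub_le
      (fun t ht => hf.norm_plant_rhs_le hS hθ hδ ht.1 (hx t ht) (hu t ht)) h₂ h₁)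
    (h.control.norm_sub_le (fun _ => h.norm_control_rhs_le hS hf hθ hn hT hδ hx hu) h₂ h₁)

lemma norm_sigma_sub_estimate_le {t : ℝ} (ht : t ∈ Icc 0 τ) (htT : T ≤ t) :
    ‖S.sigma f θ x u t - σc t‖ ≤ S.bσtil T δ R := by
  have sigma_le : ∀ t ∈ Icc 0 τ, ‖S.sigma f θ x u t‖ ≤ S.bσ δ R := fun t ht =>
    hf.norm_sigma_le hS hθ hδ ht.1 (hx t ht) (hu t ht)
  have rate_nonneg := h.sigmaRate_nonneg hS hf hθ hn hT hδ hx hu (ht.1.trans ht.2)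
  refine (h.estimate.norm_sub_le hS.a_pos hT sigma_le rate_nonneg
    (fun _ h₁ _ h₂ => h.norm_sigma_sub_le hS hf hθ hn hT hδ hx hu h₁ h₂) ht htT).trans ?_
  exact hS.le_bσtil hn hT rate_nonneg ((norm_nonneg _).trans (sigma_le t ht))

lemma norm_mapC_estimate_error_le {ζ z : ℝ → Vec m}
    (hζ : S.mapHbar (Icc 0 τ) θ (fun t => S.Bud (θ t) (S.fbar f θ t (x t))) ζ)
    (hz : S.mapC (Icc 0 τ) θ
      (fun t => S.Bd (θ t) (S.sigma f θ x u t - σc t) + (ζ t - η t)) z)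
    {t : ℝ} (ht : t ∈ Icc 0 τ) : ‖z t‖ ≤ S.γ0 T δ R := by
  have hτ : 0 ≤ τ := ht.1.trans ht.2
  have sigma_le : ∀ t ∈ Icc 0 τ, ‖S.sigma f θ x u t‖ ≤ S.bσ δ R := fun t ht =>
    hf.norm_sigma_le hS hθ hδ ht.1 (hx t ht) (hu t ht)
  have bσ_nonneg : 0 ≤ S.bσ δ R := (norm_nonneg _).trans (sigma_le t ht)
  obtain ⟨σ', σ'_cont, hσ'⟩ := exists_continuous_extension hτ h.estimate.continuousOn
  set c : ℕ → Vec n := fun i => -((S.a / (Real.exp (S.a * T) - 1)) • e (i * T))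
  have error_eq : ∀ t ∈ Icc 0 τ, σ' t - hold T c t = S.sigma f θ x u t - σc t :=
    fun t ht => by rw [hσ' t ht, h.estimate.hold_eq hT ht]
  have unmatched : S.mapHbar (Icc 0 τ) θ (fun t => S.Bud (θ t) (σ' t - hold T c t))
      (fun t => ζ t - η t) :=
    StateSpace.map_congr (StateSpace.map_sub hζ h.feedforward)
      (fun t ht => by rw [error_eq t ht, map_sub, hS.Bud_sigma (mem_Θ hθ ht.1)]) fun _ _ => rfl
  have hF : S.mapF (Icc 0 τ) θ (fun t => σ' t - hold T c t) z :=
    mapF_of_mapHbar_of_mapC unmatched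
      (StateSpace.map_congr hz (fun t ht => by rw [error_eq t ht]) fun _ _ => rfl)
  refine hS.norm_F_le hθ hτ hT.le (σ'_cont.measurable.sub (measurable_hold T c))
    (fun r hr => σ'_cont.continuousAt.continuousWithinAt.sub (hold_continuousWithinAt hT c hr.1))
    hF bσ_nonneg
    (hS.bσtil_nonneg hT (h.sigmaRate_nonneg hS hf hθ hn hT hδ hx hu hτ) bσ_nonneg)
    (fun r hr hrT => ?_) (fun r hr hTr => ?_) ht
  · rw [Pi.sub_apply, error_eq r hr, h.estimate.eq_zero r hr hrT, sub_zero]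
    exact sigma_le r hr
  · rw [Pi.sub_apply, error_eq r hr]
    exact h.norm_sigma_sub_estimate_le hS hf hθ hn hT hδ hx hu hr hTr

end IsErrorLoop

/- The adaptive law feeds the sampled estimate of the uncertainty to the filter where the reference
law feeds the uncertainty itself; `φ` is the effect of the estimation error. -/
theorem AdaptiveSolution.exists_isFilteredLoop (hS : S.Assumptions) (hf : S.Uncertainty f)
    (hθ : θ ∈ S.adm) (hn : 0 < n) (hT : 0 < T) (hτ : 0 ≤ τ) (hδ : 0 < δ)
    (hsol : S.AdaptiveSolution T f θ x₀ xh₀ (Icc 0 τ) x u y)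
    (hx : ∀ t ∈ Icc 0 τ, ‖x t‖ ≤ δ) (hu : ∀ t ∈ Icc 0 τ, ‖u t‖ ≤ R) :
    ∃ φ : ℝ → Vec m,
      S.IsFilteredLoop τ θ (fun t => S.fbar f θ t (x t))
        (fun t => S.Kr (θ t) (S.r t) + φ t) x₀ x (fun t => -(S.ω (u t))) ∧
      ∀ z, S.mapC (Icc 0 τ) θ φ z → ∀ t ∈ Icc 0 τ, ‖z t‖ ≤ S.γ0 T δ R := by
  obtain ⟨e, σh, σc, η, h⟩ := hsol.exists_isErrorLoop hS hf hθ hτ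
  obtain ⟨ζ, hζ, -⟩ := StateSpace.exists_continuous_map hτ hS.Hbar_cont hθ
    ((Trajectories.continuousOn_comp hθ hS.Bud_cont τ).clm_apply
      (hf.continuousOn_fbar hS hθ (h.plant.continuousOn hτ)))
  refine ⟨fun t => S.Bd (θ t) (S.sigma f θ x u t - σc t) + (ζ t - η t), ⟨?_, ζ, hζ, ?_⟩,
    fun z hz t ht => h.norm_mapC_estimate_error_le hS hf hθ hn hT hδ hx hu hζ hz ht⟩
  · exact h.plant.congr_rhs fun t _ => by rw [plant_rhs_eq, map_neg, sub_neg_eq_add]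
  · refine StateSpace.map_congr (hS.mapC_of_control h.control) (fun t ht => ?_) fun _ _ => rfl
    simp only [map_sub, hS.Bd_sigma (mem_Θ hθ ht.1)]
    abel

end ClosedLoop

section Reference

variable {n m p s nH nF : ℕ} {S : Setup n m p s nH nF} {f : ℝ → Vec n → Vec n}
  {θ : ℝ → Vec s} {τ : ℝ} {x₀ : Vec n}

/-! ### The stability condition -/

/-- The loop gain `‖𝓖xm‖ L_{f₁} + ‖𝓖xum‖ L_{f₂}` through the uncertainty, at radius `ρ`. -/
noncomputable def loopGain (S : Setup n m p s nH nF) : ℝ :=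
  S.gGxm * S.Lf1 S.ρ + S.gGxum * S.Lf2 S.ρ

namespace Assumptions

variable (hS : S.Assumptions)

include hS

lemma ρ0_le_ρin (hn : 0 < n) (hne : S.Θ.Nonempty) : S.ρ0 ≤ S.ρin :=
  le_mul_of_one_le_right hS.ρ0_pos.le (hS.lyap.one_le_sqrt_lamMax_div_lamMin isCompact_Θ hne hn)

end Assumptions

namespace StabilityCondition

variable (h : S.StabilityCondition) (hS : S.Assumptions) (hf : S.Uncertainty f)
  (hρr : 0 < S.ρr)

include h hS hf hρr

lemma ρin_lt (hγ1 : 0 < S.γ1) : S.ρin < S.ρr := by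
  have hρ : 0 < S.ρ := add_pos hρr hγ1
  have matched : 0 ≤ S.gGxm * (S.Lf1 S.ρ * S.ρr + S.bf10) :=
    mul_nonneg hS.ppg_Gxm.1.le
      (add_nonneg (mul_nonneg (hS.Lf1_nonneg hρ) hρr.le) hf.bf10_nonneg)
  have unmatched : 0 ≤ S.gGxum * (S.Lf2 S.ρ * S.ρr + S.bf20) :=
    mul_nonneg hS.ppg_Gxum.1.le
      (add_nonneg (mul_nonneg (hS.Lf2_nonneg hρ) hρr.le) hf.bf20_nonneg)
  have reference : 0 ≤ S.gHxmCKr * S.rNorm :=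
    mul_nonneg hS.ppg_HxmCKr.1.le ENNReal.toReal_nonneg
  rw [StabilityCondition] at h
  linarith

lemma loopGain_lt_one : S.loopGain < 1 := by
  have matched : 0 ≤ S.gGxm * S.bf10 := mul_nonneg hS.ppg_Gxm.1.le hf.bf10_nonneg
  have unmatched : 0 ≤ S.gGxum * S.bf20 := mul_nonneg hS.ppg_Gxum.1.le hf.bf20_nonneg
  have reference : 0 ≤ S.gHxmCKr * S.rNorm :=
    mul_nonneg hS.ppg_HxmCKr.1.le ENNReal.toReal_nonneg
  have initial : 0 ≤ S.ρin := mul_nonneg hS.ρ0_pos.le (Real.sqrt_nonneg _)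
  rw [StabilityCondition] at h
  have scaled : S.loopGain * S.ρr < 1 * S.ρr := by
    rw [loopGain]
    linarith
  exact lt_of_mul_lt_mul_right scaled hρr.le

end StabilityCondition

/-! ### The reference system -/

namespace ReferenceSolution

variable {xr : ℝ → Vec n} {ur : ℝ → Vec m} {yr : ℝ → Vec p}

lemma mono {J J' : Set ℝ} (h : S.ReferenceSolution f θ x₀ J xr ur yr) (hJ : J' ⊆ J) :
    S.ReferenceSolution f θ x₀ J' xr ur yr := by
  obtain ⟨η₁, η₂, h, c, split, state, hh, hc, input, output⟩ := h
  exact ⟨η₁, η₂, h, c, fun t ht => split t (hJ ht), state.mono hJ, StateSpace.map_mono hh hJ,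
    StateSpace.map_mono hc hJ, fun t ht => input t (hJ ht), fun t ht => output t (hJ ht)⟩

variable (hsol : S.ReferenceSolution f θ x₀ (Icc 0 τ) xr ur yr) (hS : S.Assumptions)
  (hθ : θ ∈ S.adm)

include hsol hS hθ

theorem exists_isFilteredLoop :
    ∃ c : ℝ → Vec m,
      S.IsFilteredLoop τ θ (fun t => S.fbar f θ t (xr t)) (fun t => S.Kr (θ t) (S.r t)) x₀ xr c ∧
      ∀ t ∈ Icc 0 τ, ur t = -(S.ωinv (c t)) := by
  obtain ⟨η₁, η₂, h, c, split, state, hh, hc, input, -⟩ := hsol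
  have matched : ∀ t ∈ Icc 0 τ, η₁ t = S.Bd (θ t) (S.fbar f θ t (xr t)) := fun t ht => by
    rw [fbar, ← split t ht, hS.Bd_decomp (mem_Θ hθ ht.1)]
  have unmatched : ∀ t ∈ Icc 0 τ, η₂ t = S.Bud (θ t) (S.fbar f θ t (xr t)) := fun t ht => by
    rw [fbar, ← split t ht, hS.Bud_decomp (mem_Θ hθ ht.1)]
  refine ⟨c, ⟨state.congr_rhs fun t ht => ?_, h,
    StateSpace.map_congr hh unmatched fun _ _ => rfl,
    StateSpace.map_congr hc (fun t ht => by rw [matched t ht]) fun _ _ => rfl⟩, input⟩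
  rw [input t ht, map_neg, hS.ω_ωinv, fbar, ← split t ht, map_add, map_neg]
  abel

lemma continuousOn_state (hτ : 0 ≤ τ) : ContinuousOn xr (Icc 0 τ) := by
  obtain ⟨c, loop, -⟩ := hsol.exists_isFilteredLoop hS hθ
  exact loop.state.continuousOn hτ

lemma state_zero (hτ : 0 ≤ τ) : xr 0 = x₀ := by
  obtain ⟨c, loop, -⟩ := hsol.exists_isFilteredLoop hS hθ
  exact loop.state.zero_apply (left_mem_Icc.2 hτ)

lemma continuousOn_input (hτ : 0 ≤ τ) : ContinuousOn ur (Icc 0 τ) := by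
  obtain ⟨c, loop, input⟩ := hsol.exists_isFilteredLoop hS hθ
  exact (S.ωinv.continuous.comp_continuousOn (loop.continuousOn_filter hθ hτ)).neg.congr input

lemma input_zero (hτ : 0 ≤ τ) : ur 0 = 0 := by
  obtain ⟨c, loop, input⟩ := hsol.exists_isFilteredLoop hS hθ
  rw [input 0 (left_mem_Icc.2 hτ), loop.filter_zero hτ, map_zero, neg_zero]

variable (hf : S.Uncertainty f) (hρr : 0 < S.ρr)

include hf hρr

lemma norm_input_le (hτ : 0 ≤ τ) (hxr : ∀ t ∈ Icc 0 τ, ‖xr t‖ ≤ S.ρr) {t : ℝ}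
    (ht : t ∈ Icc 0 τ) : ‖ur t‖ ≤ S.ρur := by
  obtain ⟨c, loop, input⟩ := hsol.exists_isFilteredLoop hS hθ
  obtain ⟨v, v_meas, hv⟩ := hS.exists_measurable_eq_Kr_r hθ hτ
  have matched : ∀ t ∈ Icc 0 τ,
      ‖S.Bd (θ t) (S.fbar f θ t (xr t))‖ ≤ S.Lf1 S.ρr * S.ρr + S.bf10 := fun t ht =>
    (hf.norm_Bd_fbar_le hS hθ hρr ht.1 (hxr t ht)).trans
      (by gcongr; exacts [hS.Lf1_nonneg hρr, hxr t ht])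
  have unmatched : ∀ t ∈ Icc 0 τ,
      ‖S.Bud (θ t) (S.fbar f θ t (xr t))‖ ≤ S.Lf2 S.ρr * S.ρr + S.bf20 := fun t ht =>
    (hf.norm_Bud_fbar_le hS hθ hρr ht.1 (hxr t ht)).trans
      (by gcongr; exacts [hS.Lf2_nonneg hρr, hxr t ht])
  have reference : ∀ t ∈ Icc 0 τ, ‖S.Kr (θ t) (S.r t)‖ ≤ S.bKr * S.rNorm := fun t ht =>
    ContinuousLinearMap.le_of_opNorm_le_of_le _ (hS.norm_Kr_le (mem_Θ hθ ht.1))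
      (hS.norm_r_le ht.1)
  rw [input t ht, norm_neg]
  refine (loop.norm_ωinv_filter_le_of_measurable hS hθ hτ
    (hf.continuousOn_fbar hS hθ (hsol.continuousOn_state hS hθ hτ)) matched unmatched v_meas hv
    reference ht).trans_eq ?_
  rw [ρur]
  ring

variable (hγ1 : 0 < S.γ1) (hstab : S.StabilityCondition) (hx₀ : ‖x₀‖ ≤ S.ρ0)

include hγ1 hstab hx₀

lemma norm_state_lt_of_le (hτ : 0 ≤ τ) (hxr : ∀ t ∈ Icc 0 τ, ‖xr t‖ ≤ S.ρr) {t : ℝ}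
    (ht : t ∈ Icc 0 τ) : ‖xr t‖ < S.ρr := by
  obtain ⟨c, loop, -⟩ := hsol.exists_isFilteredLoop hS hθ
  have hρ : 0 < S.ρ := add_pos hρr hγ1
  have state_le : ∀ t ∈ Icc 0 τ, ‖xr t‖ ≤ S.ρ := fun t ht =>
    (hxr t ht).trans (le_add_of_nonneg_right hγ1.le)
  have matched : ∀ t ∈ Icc 0 τ,
      ‖S.Bd (θ t) (S.fbar f θ t (xr t))‖ ≤ S.Lf1 S.ρ * S.ρr + S.bf10 := fun t ht =>
    (hf.norm_Bd_fbar_le hS hθ hρ ht.1 (state_le t ht)).trans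
      (by gcongr; exacts [hS.Lf1_nonneg hρ, hxr t ht])
  have unmatched : ∀ t ∈ Icc 0 τ,
      ‖S.Bud (θ t) (S.fbar f θ t (xr t))‖ ≤ S.Lf2 S.ρ * S.ρr + S.bf20 := fun t ht =>
    (hf.norm_Bud_fbar_le hS hθ hρ ht.1 (state_le t ht)).trans
      (by gcongr; exacts [hS.Lf2_nonneg hρ, hxr t ht])
  have response := loop.norm_state_le hS hθ hτ
    (hf.continuousOn_fbar hS hθ (hsol.continuousOn_state hS hθ hτ)) matched unmatched
    (fun _ _ hc hy _ hr => hS.norm_HxmCKr_le hθ hτ hc hy hr) ht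
  have initial : √(lamMax S.Θ S.P / lamMin S.Θ S.P) * ‖x₀‖ ≤ S.ρin := by
    rw [ρin, mul_comm]
    exact mul_le_mul_of_nonneg_right hx₀ (Real.sqrt_nonneg _)
  rw [StabilityCondition] at hstab
  linarith

theorem norm_state_lt (hn : 0 < n) : ∀ t ∈ Icc 0 τ, ‖xr t‖ < S.ρr := by
  rcases lt_or_ge τ 0 with hτ | hτ
  · simp [Icc_eq_empty hτ.not_ge]
  refine forall_lt_of_self_improving (hsol.continuousOn_state hS hθ hτ).norm ?_ fun t ht hb => ?_
  · rw [hsol.state_zero hS hθ hτ]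
    exact (hx₀.trans (hS.ρ0_le_ρin hn ⟨_, mem_Θ hθ le_rfl⟩)).trans_lt
      (hstab.ρin_lt hS hf hρr hγ1)
  · exact (hsol.mono (Icc_subset_Icc_right ht.2)).norm_state_lt_of_le hS hθ hf hρr hγ1 hstab hx₀
      ht.1 hb (right_mem_Icc.2 ht.1)

end ReferenceSolution

end Reference

section Comparison

variable {n m p s nH nF : ℕ} {S : Setup n m p s nH nF} {f : ℝ → Vec n → Vec n}
  {θ : ℝ → Vec s} {T τ : ℝ} {x₀ xh₀ : Vec n} {x xr : ℝ → Vec n} {u ur : ℝ → Vec m}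
  {y yr : ℝ → Vec p}

namespace AdaptiveSolution

lemma mono {J J' : Set ℝ} (h : S.AdaptiveSolution T f θ x₀ xh₀ J x u y) (hJ : J' ⊆ J) :
    S.AdaptiveSolution T f θ x₀ xh₀ J' x u y := by
  obtain ⟨xh, σh, σc, σm, σum, ηh₂, plant, output, predictor, law, law_init, law_eq, split, hη,
    control⟩ := h
  exact ⟨xh, σh, σc, σm, σum, ηh₂, plant.mono hJ, fun t ht => output t (hJ ht),
    predictor.mono hJ, fun i t ht => law i t (hJ ht), fun t ht => law_init t (hJ ht),
    fun t ht => law_eq t (hJ ht), fun t ht => split t (hJ ht), StateSpace.map_mono hη hJ,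
    control.mono hJ⟩

variable (hsol : S.AdaptiveSolution T f θ x₀ xh₀ (Icc 0 τ) x u y) (hτ : 0 ≤ τ)

include hsol hτ

lemma continuousOn_state : ContinuousOn x (Icc 0 τ) := by
  obtain ⟨_, _, _, _, _, _, plant, -⟩ := hsol
  exact plant.continuousOn hτ

lemma state_zero : x 0 = x₀ := by
  obtain ⟨_, _, _, _, _, _, plant, -⟩ := hsol
  exact plant.zero_apply (left_mem_Icc.2 hτ)

lemma continuousOn_input : ContinuousOn u (Icc 0 τ) := by
  obtain ⟨_, _, _, _, _, _, -, -, -, -, -, -, -, -, control⟩ := hsol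
  exact control.continuousOn hτ

lemma input_zero : u 0 = 0 := by
  obtain ⟨_, _, _, _, _, _, -, -, -, -, -, -, -, -, control⟩ := hsol
  exact control.zero_apply (left_mem_Icc.2 hτ)

end AdaptiveSolution

/-! ### The deviation from the reference system -/

/-- The gain from the estimation error to the deviation `xr - x` of the states. -/
noncomputable def errorGain (S : Setup n m p s nH nF) : ℝ := S.gHxm / (1 - S.loopGain)

/-- The gain from the deviation `xr - x` of the states to the deviation `ur - u` of the inputs. -/
noncomputable def inputGain (S : Setup n m p s nH nF) : ℝ :=
  S.l1ωC * S.Lf1 S.ρ + S.gCHbar * S.Lf2 S.ρ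

lemma gammaConstraint_iff {γ0bar : ℝ} :
    S.GammaConstraint γ0bar ↔ S.errorGain * γ0bar < S.γ1 := by
  rw [GammaConstraint, errorGain, loopGain, ← sub_sub]

namespace Assumptions

variable (hS : S.Assumptions)

include hS

lemma errorGain_pos (h : S.loopGain < 1) : 0 < S.errorGain :=
  div_pos hS.ppg_Hxm.1 (sub_pos.2 h)

lemma inputGain_nonneg (hρ : 0 < S.ρ) : 0 ≤ S.inputGain :=
  add_nonneg (mul_nonneg l1ωC_nonneg (hS.Lf1_nonneg hρ))
    (mul_nonneg hS.ppg_CHbar.1.le (hS.Lf2_nonneg hρ))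

lemma exists_gammaConstraint (hγ1 : 0 < S.γ1) (h : S.loopGain < 1) :
    ∃ γ0bar, 0 < γ0bar ∧ S.GammaConstraint γ0bar := by
  have gain_pos := hS.errorGain_pos h
  refine ⟨S.γ1 / 2 / S.errorGain, by positivity, gammaConstraint_iff.2 ?_⟩
  rw [mul_div_cancel₀ _ gain_pos.ne']
  exact half_lt_self hγ1

lemma norm_output_sub_le (hθ : θ ∈ S.adm) {J : Set ℝ} (hJ : J ⊆ Ici 0)
    (hsol : S.AdaptiveSolution T f θ x₀ xh₀ J x u y)
    (href : S.ReferenceSolution f θ x₀ J xr ur yr) {t b : ℝ} (ht : t ∈ J)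
    (hb : ‖xr t - x t‖ ≤ b) : ‖yr t - y t‖ ≤ S.bC * b := by
  obtain ⟨_, _, _, _, _, _, -, output, -⟩ := hsol
  obtain ⟨_, _, _, _, -, -, -, -, -, output_ref⟩ := href
  rw [output t ht, output_ref t ht, ← map_sub]
  exact ContinuousLinearMap.le_of_opNorm_le_of_le _ (hS.norm_C_le (mem_Θ hθ (hJ ht))) hb

end Assumptions

section Deviation

variable {R : ℝ} (hS : S.Assumptions) (hf : S.Uncertainty f) (hθ : θ ∈ S.adm) (hn : 0 < n)
  (hT : 0 < T) (hτ : 0 ≤ τ) (hρ : 0 < S.ρ)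
  (hsol : S.AdaptiveSolution T f θ x₀ xh₀ (Icc 0 τ) x u y)
  (href : S.ReferenceSolution f θ x₀ (Icc 0 τ) xr ur yr)
  (hx : ∀ t ∈ Icc 0 τ, ‖x t‖ ≤ S.ρ) (hu : ∀ t ∈ Icc 0 τ, ‖u t‖ ≤ R)

include hS hf hθ hn hT hτ hρ hsol href hx hu

theorem exists_isFilteredLoop_sub :
    ∃ φ c : ℝ → Vec m,
      S.IsFilteredLoop τ θ (fun t => S.fbar f θ t (xr t) - S.fbar f θ t (x t)) φ 0
        (fun t => xr t - x t) c ∧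
      (∀ t ∈ Icc 0 τ, S.ωinv (c t) = -(ur t - u t)) ∧
      ∀ z, S.mapC (Icc 0 τ) θ φ z → ∀ t ∈ Icc 0 τ, ‖z t‖ ≤ S.γ0 T S.ρ R := by
  obtain ⟨φ, loop, φ_response⟩ := hsol.exists_isFilteredLoop hS hf hθ hn hT hτ hρ hx hu
  obtain ⟨c, loop_ref, input⟩ := href.exists_isFilteredLoop hS hθ
  refine ⟨fun t => -φ t, fun t => c t - -(S.ω (u t)), ?_, fun t ht => ?_, fun z hz t ht => ?_⟩
  · simpa only [sub_add_cancel_left, sub_self] using loop_ref.sub loop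
  · rw [map_sub, map_neg, hS.ωinv_ω, input t ht]
    abel
  · rw [← norm_neg]
    exact φ_response (fun t => -z t)
      (StateSpace.map_congr (StateSpace.map_neg hz) (fun t _ => neg_neg _) fun _ _ => rfl) t ht

variable (hxr : ∀ t ∈ Icc 0 τ, ‖xr t‖ ≤ S.ρ)

include hxr

lemma norm_state_sub_le_of_le {E : ℝ} (hE : ∀ t ∈ Icc 0 τ, ‖xr t - x t‖ ≤ E) :
    ∀ t ∈ Icc 0 τ, ‖xr t - x t‖ ≤ S.loopGain * E + S.gHxm * S.γ0 T S.ρ R := by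
  intro t ht
  obtain ⟨φ, c, loop, -, φ_response⟩ :=
    exists_isFilteredLoop_sub hS hf hθ hn hT hτ hρ hsol href hx hu
  have fbar_cont := (hf.continuousOn_fbar hS hθ (href.continuousOn_state hS hθ hτ)).sub
    (hf.continuousOn_fbar hS hθ (hsol.continuousOn_state hτ))
  refine (loop.norm_state_le hS hθ hτ fbar_cont
    (fun r hr => (hf.norm_Bd_fbar_sub_le hS hθ hρ hr.1 (hxr r hr) (hx r hr)).trans
      (mul_le_mul_of_nonneg_left (hE r hr) (hS.Lf1_nonneg hρ)))
    (fun r hr => (hf.norm_Bud_fbar_sub_le hS hθ hρ hr.1 (hxr r hr) (hx r hr)).trans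
      (mul_le_mul_of_nonneg_left (hE r hr) (hS.Lf2_nonneg hρ)))
    (fun cv _ hcv hy _ hr => hS.norm_Hxm_le hθ hτ (continuousOn_of_mapC hθ hτ hcv) hy
      (φ_response cv hcv) hr) ht).trans_eq ?_
  rw [norm_zero, loopGain]
  ring

theorem norm_state_sub_le (hgain : S.loopGain < 1) :
    ∀ t ∈ Icc 0 τ, ‖xr t - x t‖ ≤ S.errorGain * S.γ0 T S.ρ R := by
  rw [errorGain, div_mul_eq_mul_div]
  exact forall_le_div_of_contraction
    ((href.continuousOn_state hS hθ hτ).sub (hsol.continuousOn_state hτ)).norm hgain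
    fun E hE => norm_state_sub_le_of_le hS hf hθ hn hT hτ hρ hsol href hx hu hxr hE

theorem norm_input_sub_le {E : ℝ} (hE : ∀ t ∈ Icc 0 τ, ‖xr t - x t‖ ≤ E) :
    ∀ t ∈ Icc 0 τ, ‖ur t - u t‖ ≤ S.inputGain * E + ‖S.ωinv‖ * S.γ0 T S.ρ R := by
  intro t ht
  obtain ⟨φ, c, loop, input, φ_response⟩ :=
    exists_isFilteredLoop_sub hS hf hθ hn hT hτ hρ hsol href hx hu
  have fbar_cont := (hf.continuousOn_fbar hS hθ (href.continuousOn_state hS hθ hτ)).sub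
    (hf.continuousOn_fbar hS hθ (hsol.continuousOn_state hτ))
  rw [← norm_neg, ← input t ht]
  refine (loop.norm_ωinv_filter_le hS hθ hτ fbar_cont
    (fun r hr => (hf.norm_Bd_fbar_sub_le hS hθ hρ hr.1 (hxr r hr) (hx r hr)).trans
      (mul_le_mul_of_nonneg_left (hE r hr) (hS.Lf1_nonneg hρ)))
    (fun r hr => (hf.norm_Bud_fbar_sub_le hS hθ hρ hr.1 (hxr r hr) (hx r hr)).trans
      (mul_le_mul_of_nonneg_left (hE r hr) (hS.Lf2_nonneg hρ)))
    (fun cv hcv r hr => S.ωinv.le_opNorm_of_le (φ_response cv hcv r hr)) ht).trans_eq ?_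
  rw [inputGain]
  ring

end Deviation

/-! ### The performance bounds -/

section Performance

variable {γ0bar : ℝ} (hm : 0 < m) (hS : S.Assumptions) (hf : S.Uncertainty f) (hθ : θ ∈ S.adm)
  (hρr : 0 < S.ρr) (hγ1 : 0 < S.γ1) (hstab : S.StabilityCondition)
  (hγ : S.GammaConstraint γ0bar) (hT : 0 < T) (hγ0 : S.γ0 T S.ρ (S.ρu γ0bar) < γ0bar)
  (hx₀ : ‖x₀‖ ≤ S.ρ0) (hτ : 0 ≤ τ) (hsol : S.AdaptiveSolution T f θ x₀ xh₀ (Icc 0 τ) x u y)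
  (href : S.ReferenceSolution f θ x₀ (Icc 0 τ) xr ur yr)

include hm hS hf hθ hρr hγ1 hstab hx₀ hτ href

lemma norm_state_le_and_norm_input_le (hdx : ∀ t ∈ Icc 0 τ, ‖xr t - x t‖ ≤ S.γ1)
    (hdu : ∀ t ∈ Icc 0 τ, ‖ur t - u t‖ ≤ S.γ2 γ0bar) :
    (∀ t ∈ Icc 0 τ, ‖xr t‖ ≤ S.ρ) ∧ (∀ t ∈ Icc 0 τ, ‖x t‖ ≤ S.ρ) ∧
      ∀ t ∈ Icc 0 τ, ‖u t‖ ≤ S.ρu γ0bar := by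
  have hn : 0 < n := hm.trans_le (hS.m_le_n (mem_Θ hθ le_rfl))
  have ref_state_le : ∀ t ∈ Icc 0 τ, ‖xr t‖ ≤ S.ρr := fun t ht =>
    (href.norm_state_lt hS hθ hf hρr hγ1 hstab hx₀ hn t ht).le
  refine ⟨fun t ht => (ref_state_le t ht).trans (le_add_of_nonneg_right hγ1.le),
    fun t ht => ?_, fun t ht => ?_⟩
  · exact (norm_le_norm_add_norm_sub (xr t) (x t)).trans
      (add_le_add (ref_state_le t ht) (hdx t ht))
  · exact (norm_le_norm_add_norm_sub (ur t) (u t)).trans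
      (add_le_add (href.norm_input_le hS hθ hf hρr hτ ref_state_le ht) (hdu t ht))

include hT hsol

lemma norm_sub_le_of_norm_sub_le (hdx : ∀ t ∈ Icc 0 τ, ‖xr t - x t‖ ≤ S.γ1)
    (hdu : ∀ t ∈ Icc 0 τ, ‖ur t - u t‖ ≤ S.γ2 γ0bar) :
    (∀ t ∈ Icc 0 τ, ‖xr t - x t‖ ≤ S.errorGain * S.γ0 T S.ρ (S.ρu γ0bar)) ∧
      ∀ E, (∀ t ∈ Icc 0 τ, ‖xr t - x t‖ ≤ E) → ∀ t ∈ Icc 0 τ,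
        ‖ur t - u t‖ ≤ S.inputGain * E + ‖S.ωinv‖ * S.γ0 T S.ρ (S.ρu γ0bar) := by
  have hn : 0 < n := hm.trans_le (hS.m_le_n (mem_Θ hθ le_rfl))
  have hρ : 0 < S.ρ := add_pos hρr hγ1
  obtain ⟨hxr, hx, hu⟩ :=
    norm_state_le_and_norm_input_le hm hS hf hθ hρr hγ1 hstab hx₀ hτ href hdx hdu
  exact ⟨norm_state_sub_le hS hf hθ hn hT hτ hρ hsol href hx hu hxr
      (hstab.loopGain_lt_one hS hf hρr),
    fun _ => norm_input_sub_le hS hf hθ hn hT hτ hρ hsol href hx hu hxr⟩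

include hγ hγ0

lemma norm_sub_lt_of_norm_sub_le (hdx : ∀ t ∈ Icc 0 τ, ‖xr t - x t‖ ≤ S.γ1)
    (hdu : ∀ t ∈ Icc 0 τ, ‖ur t - u t‖ ≤ S.γ2 γ0bar) {t : ℝ} (ht : t ∈ Icc 0 τ) :
    ‖xr t - x t‖ < S.γ1 ∧ ‖ur t - u t‖ < S.γ2 γ0bar := by
  obtain ⟨state_le, input_le⟩ :=
    norm_sub_le_of_norm_sub_le hm hS hf hθ hρr hγ1 hstab hT hx₀ hτ hsol href hdx hdu
  have gain_pos := hS.errorGain_pos (hstab.loopGain_lt_one hS hf hρr)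
  constructor
  · calc ‖xr t - x t‖ ≤ S.errorGain * S.γ0 T S.ρ (S.ρu γ0bar) := state_le t ht
      _ < S.errorGain * γ0bar := mul_lt_mul_of_pos_left hγ0 gain_pos
      _ < S.γ1 := gammaConstraint_iff.1 hγ
  · calc ‖ur t - u t‖ ≤ S.inputGain * S.γ1 + ‖S.ωinv‖ * S.γ0 T S.ρ (S.ρu γ0bar) :=
          input_le _ hdx t ht
      _ < S.inputGain * S.γ1 + ‖S.ωinv‖ * γ0bar := by
          gcongr
          exact hS.norm_ωinv_pos hm
      _ = S.γ2 γ0bar := rfl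

/- The bounds `γ₁` and `γ₂` on the deviations are strict at time `0` and self-improving, so neither
deviation can reach its bound. -/
theorem norm_sub_lt (hγ0bar : 0 < γ0bar) :
    ∀ t ∈ Icc 0 τ, ‖xr t - x t‖ < S.γ1 ∧ ‖ur t - u t‖ < S.γ2 γ0bar := by
  have γ2_pos : 0 < S.γ2 γ0bar :=
    add_pos_of_nonneg_of_pos (mul_nonneg (hS.inputGain_nonneg (add_pos hρr hγ1)) hγ1.le)
      (mul_pos (hS.norm_ωinv_pos hm) hγ0bar)
  have excess_cont : ContinuousOn
      (fun t => max (‖xr t - x t‖ - S.γ1) (‖ur t - u t‖ - S.γ2 γ0bar)) (Icc 0 τ) :=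
    (((href.continuousOn_state hS hθ hτ).sub (hsol.continuousOn_state hτ)).norm.sub
      continuousOn_const).sup
    (((href.continuousOn_input hS hθ hτ).sub (hsol.continuousOn_input hτ)).norm.sub
      continuousOn_const)
  have excess_neg := forall_lt_of_self_improving (b := 0) excess_cont ?_ fun t ht hle => ?_
  · simpa only [max_lt_iff, sub_neg] using excess_neg
  · simp [href.state_zero hS hθ hτ, hsol.state_zero hτ, href.input_zero hS hθ hτ,
      hsol.input_zero hτ, hγ1, γ2_pos]
  · simp only [max_le_iff, sub_nonpos] at hle
    have hsub : Icc 0 t ⊆ Icc 0 τ := Icc_subset_Icc_right ht.2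
    simpa only [max_lt_iff, sub_neg] using
      norm_sub_lt_of_norm_sub_le hm hS hf hθ hρr hγ1 hstab hγ hT hγ0 hx₀ ht.1 (hsol.mono hsub)
        (href.mono hsub) (fun r hr => (hle r hr).1) (fun r hr => (hle r hr).2)
        (right_mem_Icc.2 ht.1)

theorem norm_le_of_gammaConstraint (hγ0bar : 0 < γ0bar) {t : ℝ} (ht : t ∈ Icc 0 τ) :
    ‖x t‖ ≤ S.ρ ∧ ‖u t‖ ≤ S.ρu γ0bar ∧ ‖xr t - x t‖ ≤ S.γ1 ∧ ‖ur t - u t‖ ≤ S.γ2 γ0bar := by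
  have dev := norm_sub_lt hm hS hf hθ hρr hγ1 hstab hγ hT hγ0 hx₀ hτ hsol href hγ0bar
  obtain ⟨-, hx, hu⟩ := norm_state_le_and_norm_input_le hm hS hf hθ hρr hγ1 hstab hx₀ hτ href
    (fun r hr => (dev r hr).1.le) fun r hr => (dev r hr).2.le
  exact ⟨hx t ht, hu t ht, (dev t ht).1.le, (dev t ht).2.le⟩

theorem norm_sub_le_γ0 (hγ0bar : 0 < γ0bar) {t : ℝ} (ht : t ∈ Icc 0 τ) :
    ‖xr t - x t‖ ≤ S.errorGain * S.γ0 T S.ρ (S.ρu γ0bar) ∧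
      ‖ur t - u t‖ ≤ S.inputGain * (S.errorGain * S.γ0 T S.ρ (S.ρu γ0bar)) +
        ‖S.ωinv‖ * S.γ0 T S.ρ (S.ρu γ0bar) := by
  have dev := norm_sub_lt hm hS hf hθ hρr hγ1 hstab hγ hT hγ0 hx₀ hτ hsol href hγ0bar
  obtain ⟨state_le, input_le⟩ :=
    norm_sub_le_of_norm_sub_le hm hS hf hθ hρr hγ1 hstab hT hx₀ hτ hsol href
      (fun r hr => (dev r hr).1.le) fun r hr => (dev r hr).2.le
  exact ⟨state_le t ht, input_le _ state_le t ht⟩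

end Performance

/-! ### Runs on arbitrary intervals and small sampling times -/

lemma forAllRuns_of_Icc
    {Q : Set ℝ → (ℝ → Vec n) → (ℝ → Vec m) → (ℝ → Vec p) →
      (ℝ → Vec n) → (ℝ → Vec m) → (ℝ → Vec p) → Prop}
    {R : Vec n → Vec m → Vec n → Vec m → Prop}
    (hR : ∀ θ ∈ S.adm, ∀ f, S.Uncertainty f → ∀ x₀ xh₀ : Vec n, ‖x₀‖ ≤ S.ρ0 → ∀ τ : ℝ, 0 ≤ τ →
      ∀ x u y, S.AdaptiveSolution T f θ x₀ xh₀ (Icc 0 τ) x u y →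
      ∀ xr ur yr, S.ReferenceSolution f θ x₀ (Icc 0 τ) xr ur yr →
      R (x τ) (u τ) (xr τ) (ur τ))
    (hQ : ∀ θ ∈ S.adm, ∀ f x₀ xh₀ J x u y xr ur yr, J ⊆ Ici 0 →
      S.AdaptiveSolution T f θ x₀ xh₀ J x u y → S.ReferenceSolution f θ x₀ J xr ur yr →
      (∀ t ∈ J, R (x t) (u t) (xr t) (ur t)) → Q J x u y xr ur yr) :
    S.ForAllRuns T Q := by
  intro θ hθ f hf x₀ xh₀ hx₀ J hJ h0 hJ0 x u y hsol xr ur yr href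
  refine hQ θ hθ f x₀ xh₀ J x u y xr ur yr hJ0 hsol href fun t ht => ?_
  have hsub : Icc 0 t ⊆ J := hJ.out h0 ht
  exact hR θ hθ f hf x₀ xh₀ hx₀ t (hJ0 ht) x u y (hsol.mono hsub) xr ur yr (href.mono hsub)

theorem forAllRuns_le {γ0bar : ℝ} (hm : 0 < m) (hS : S.Assumptions) (hρr : 0 < S.ρr)
    (hγ1 : 0 < S.γ1) (hstab : S.StabilityCondition) (hγ0bar : 0 < γ0bar)
    (hγ : S.GammaConstraint γ0bar) (hT : 0 < T) (hγ0 : S.γ0 T S.ρ (S.ρu γ0bar) < γ0bar) :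
    S.ForAllRuns T fun J x u y xr ur yr =>
      linf J x ≤ ENNReal.ofReal S.ρ ∧ linf J u ≤ ENNReal.ofReal (S.ρu γ0bar) ∧
      linf J (fun t => xr t - x t) ≤ ENNReal.ofReal S.γ1 ∧
      linf J (fun t => ur t - u t) ≤ ENNReal.ofReal (S.γ2 γ0bar) ∧
      linf J (fun t => yr t - y t) ≤ ENNReal.ofReal (S.bC * S.γ1) :=
  forAllRuns_of_Icc
    (R := fun x u xr ur => ‖x‖ ≤ S.ρ ∧ ‖u‖ ≤ S.ρu γ0bar ∧ ‖xr - x‖ ≤ S.γ1 ∧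
      ‖ur - u‖ ≤ S.γ2 γ0bar)
    (fun _ hθ _ hf _ _ hx₀ _ hτ _ _ _ hsol _ _ _ href => norm_le_of_gammaConstraint hm hS hf hθ
      hρr hγ1 hstab hγ hT hγ0 hx₀ hτ hsol href hγ0bar (right_mem_Icc.2 hτ))
    fun _ hθ _ _ _ _ _ _ _ _ _ _ hJ hsol href h =>
      ⟨linf_le_ofReal fun t ht => (h t ht).1, linf_le_ofReal fun t ht => (h t ht).2.1,
        linf_le_ofReal fun t ht => (h t ht).2.2.1, linf_le_ofReal fun t ht => (h t ht).2.2.2,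
        linf_le_ofReal fun t ht => hS.norm_output_sub_le hθ hJ hsol href ht (h t ht).2.2.1⟩

theorem forAllRuns_sub_le_γ0 {γ0bar : ℝ} (hm : 0 < m) (hS : S.Assumptions) (hρr : 0 < S.ρr)
    (hγ1 : 0 < S.γ1) (hstab : S.StabilityCondition) (hγ0bar : 0 < γ0bar)
    (hγ : S.GammaConstraint γ0bar) (hT : 0 < T) (hγ0 : S.γ0 T S.ρ (S.ρu γ0bar) < γ0bar) :
    S.ForAllRuns T fun J x u y xr ur yr =>
      linf J (fun t => xr t - x t) ≤
        ENNReal.ofReal (S.errorGain * S.γ0 T S.ρ (S.ρu γ0bar)) ∧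
      linf J (fun t => ur t - u t) ≤
        ENNReal.ofReal (S.inputGain * (S.errorGain * S.γ0 T S.ρ (S.ρu γ0bar)) +
          ‖S.ωinv‖ * S.γ0 T S.ρ (S.ρu γ0bar)) ∧
      linf J (fun t => yr t - y t) ≤
        ENNReal.ofReal (S.bC * (S.errorGain * S.γ0 T S.ρ (S.ρu γ0bar))) :=
  forAllRuns_of_Icc
    (R := fun x u xr ur => ‖xr - x‖ ≤ S.errorGain * S.γ0 T S.ρ (S.ρu γ0bar) ∧
      ‖ur - u‖ ≤ S.inputGain * (S.errorGain * S.γ0 T S.ρ (S.ρu γ0bar)) +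
        ‖S.ωinv‖ * S.γ0 T S.ρ (S.ρu γ0bar))
    (fun _ hθ _ hf _ _ hx₀ _ hτ _ _ _ hsol _ _ _ href => norm_sub_le_γ0 hm hS hf hθ
      hρr hγ1 hstab hγ hT hγ0 hx₀ hτ hsol href hγ0bar (right_mem_Icc.2 hτ))
    fun _ hθ _ _ _ _ _ _ _ _ _ _ hJ hsol href h =>
      ⟨linf_le_ofReal fun t ht => (h t ht).1, linf_le_ofReal fun t ht => (h t ht).2,
        linf_le_ofReal fun t ht => hS.norm_output_sub_le hθ hJ hsol href ht (h t ht).1⟩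

theorem tendsto_γ0 (S : Setup n m p s nH nF) (ρ R : ℝ) :
    Tendsto (fun T => S.γ0 T ρ R) (𝓝[>] 0) (𝓝 0) := by
  have cont : Continuous fun T => S.γ0 T ρ R := by
    unfold γ0 beta bσtil bu' bσhatc
    fun_prop
  have at_zero : S.γ0 0 ρ R = 0 := by simp [γ0, beta, bσtil]
  simpa only [at_zero] using (cont.tendsto 0).mono_left nhdsWithin_le_nhds

lemma eventually_γ0_small {γ0bar ε : ℝ} (hγ0bar : 0 < γ0bar) (hε : 0 < ε) :
    ∀ᶠ T in 𝓝[>] 0, S.γ0 T S.ρ (S.ρu γ0bar) < γ0bar ∧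
      S.errorGain * S.γ0 T S.ρ (S.ρu γ0bar) < ε ∧
      S.inputGain * (S.errorGain * S.γ0 T S.ρ (S.ρu γ0bar)) +
        ‖S.ωinv‖ * S.γ0 T S.ρ (S.ρu γ0bar) < ε ∧
      S.bC * (S.errorGain * S.γ0 T S.ρ (S.ρu γ0bar)) < ε := by
  have estimate := tendsto_γ0 S S.ρ (S.ρu γ0bar)
  have state := estimate.const_mul S.errorGain
  have input := (state.const_mul S.inputGain).add (estimate.const_mul ‖S.ωinv‖)
  have output := state.const_mul S.bC
  simp only [mul_zero, add_zero] at state input output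
  exact (estimate.eventually_lt_const hγ0bar).and ((state.eventually_lt_const hε).and
    ((input.eventually_lt_const hε).and (output.eventually_lt_const hε)))

theorem eventually_forAllRuns_sub_le (hm : 0 < m) (hS : S.Assumptions) (hρr : 0 < S.ρr)
    (hγ1 : 0 < S.γ1) (hstab : S.StabilityCondition) {ε : ℝ} (hε : 0 < ε) :
    ∀ᶠ T in 𝓝[>] 0, S.ForAllRuns T fun J x u y xr ur yr =>
      linf J (fun t => xr t - x t) ≤ ENNReal.ofReal ε ∧
      linf J (fun t => ur t - u t) ≤ ENNReal.ofReal ε ∧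
      linf J (fun t => yr t - y t) ≤ ENNReal.ofReal ε := by
  by_cases hne : ∃ f, S.Uncertainty f
  · obtain ⟨f₀, hf₀⟩ := hne
    obtain ⟨γ0bar, hγ0bar, hγ⟩ :=
      hS.exists_gammaConstraint hγ1 (hstab.loopGain_lt_one hS hf₀ hρr)
    filter_upwards [eventually_γ0_small hγ0bar hε, self_mem_nhdsWithin] with T hsmall hT
    obtain ⟨hγ0, state, input, output⟩ := hsmall
    intro θ hθ f hf x₀ xh₀ hx₀ J hJ h0 hJ0 x u y hsol xr ur yr href
    obtain ⟨state_le, input_le, output_le⟩ := forAllRuns_sub_le_γ0 hm hS hρr hγ1 hstab hγ0bar hγ hT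
      hγ0 θ hθ f hf x₀ xh₀ hx₀ J hJ h0 hJ0 x u y hsol xr ur yr href
    exact ⟨state_le.trans (ENNReal.ofReal_le_ofReal state.le),
      input_le.trans (ENNReal.ofReal_le_ofReal input.le),
      output_le.trans (ENNReal.ofReal_le_ofReal output.le)⟩
  · exact .of_forall fun T θ _ f hf => (hne ⟨f, hf⟩).elim

end Comparison

end Setup

end LPV

theorem mainTheorem1 {n m p s nH nF : ℕ} (hm : 0 < m) (S : LPV.Setup n m p s nH nF)
    (hS : S.Assumptions) (hρr : 0 < S.ρr) (hγ1 : 0 < S.γ1) (hstab : S.StabilityCondition) :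
    (∀ γ0bar : ℝ, 0 < γ0bar → S.GammaConstraint γ0bar →
      ∀ T : ℝ, 0 < T → S.γ0 T S.ρ (S.ρu γ0bar) < γ0bar →
        S.ForAllRuns T fun J x u y xr ur yr =>
          LPV.linf J x ≤ ENNReal.ofReal S.ρ ∧
          LPV.linf J u ≤ ENNReal.ofReal (S.ρu γ0bar) ∧
          LPV.linf J (fun t => xr t - x t) ≤ ENNReal.ofReal S.γ1 ∧
          LPV.linf J (fun t => ur t - u t) ≤ ENNReal.ofReal (S.γ2 γ0bar) ∧
          LPV.linf J (fun t => yr t - y t) ≤ ENNReal.ofReal (S.bC * S.γ1)) ∧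
    (∀ γ0bar : ℝ, Tendsto (fun T => S.γ0 T S.ρ (S.ρu γ0bar)) (𝓝[>] 0) (𝓝 0)) ∧
    (∀ ε : ℝ, 0 < ε → ∃ T₀ : ℝ, 0 < T₀ ∧ ∀ T : ℝ, 0 < T → T < T₀ →
      S.ForAllRuns T fun J x u y xr ur yr =>
        LPV.linf J (fun t => xr t - x t) ≤ ENNReal.ofReal ε ∧
        LPV.linf J (fun t => ur t - u t) ≤ ENNReal.ofReal ε ∧
        LPV.linf J (fun t => yr t - y t) ≤ ENNReal.ofReal ε) := by
  refine ⟨fun γ0bar hγ0bar hγ T hT hγ0 =>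
    LPV.Setup.forAllRuns_le hm hS hρr hγ1 hstab hγ0bar hγ hT hγ0,
    fun γ0bar => S.tendsto_γ0 _ _, fun ε hε => ?_⟩
  obtain ⟨T₀, hT₀, hsub⟩ := mem_nhdsGT_iff_exists_Ioo_subset.1
    (LPV.Setup.eventually_forAllRuns_sub_le hm hS hρr hγ1 hstab hε)
  exact ⟨T₀, hT₀, fun T hT hTT₀ => hsub ⟨hT, hTT₀⟩⟩
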